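/- Let $C=\{f=0\}\subset\mathbb{C}^2$ be the curve of a reduced polynomial $f(x,y)$ of degree $n$, let $\pi(x,y)=x$ and $L_x=\pi^{-1}(x)$. Let $X=\{p_1,\dots,p_N\}$ be the set of $x\in\mathbb{C}$ such that $L_x$ contains a singularity of $C$ or is tangent to $C$ (i.e. contains a point with $f=\partial f/\partial y=0$). Assume that $\pi$ is generic: $f(x,\cdot)$ has degree $n$ for every $x$, and $L_{p_i}$ contains exactly one point $q_i$ at which $f=\partial f/\partial y=0$. Let $m_i$ be the multiplicity of the root $q_i$ of $f(p_i,\cdot)$, i.e. the number of points of $L_x\cap C$ that collapse as $x\to p_i$ (so $m_i=2$ at a simple tangency, and $m_i$ is the multiplicity of the singularity when $L_{p_i}$ is not in its tangent cone). *The base.* Let $D\subset\mathbb{C}$ be a closed round disk, and let $U_i$ be open round disks centered at $p_i$ whose closures are pairwise disjoint and lie in the interior of $D$. Let $p_0\in D$ and let $s_0,\dots,s_N$ be smooth embedded regular arcs starting at $p_0$ in pairwise different directions and meeting pairwise only in $p_0$. For $i\ge1$, $s_i$ ends at a point $p_i'\in\partial U_i$, lies in the interior of $D$, meets $\overline{U_i}$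 only in $p_i'$, transversely to $\partial U_i$, and misses $\overline{U_j}$ for $j\neq i$. The arc $s_0$ misses all $\overline{U_j}$, ends on $\partial D$ transversely, and otherwise lies in the interior of $D$. For $\delta>0$ let $\nu(s_i)$ be the open $\delta$-neighbourhood of $s_i$ and $\nu(\Gamma)=\bigcup_{i=0}^N\nu(s_i)\cup\bigcup_{i=1}^N U_i$. *The complement.* Let $D_y\subset\mathbb{C}$ be a closed round disk whose interior contains all $y$ with $f(x,y)=0$ for some $x\in D$. Let $g:\mathbb{C}^2\to(0,\infty)$ be smooth. For $\varepsilon>0$ let $\nu(C)=\{g\,|f|<\varepsilon\}$, $M_0=(D\times D_y)\setminus\nu(C)$, $\pi_0=\pi|_{M_0}$ and $M_1=\pi_0^{-1}(D\setminus\nu(\Gamma))$. *The pieces near $p_i$.* Let $V_i\subset U_i$ be a closed round disk centered at $p_i$, of positive radius smaller than that of $U_i$, such that for all $a\in V_i$ the fibre $\pi_0^{-1}(a)$ is diffeomorphic to a closed disk with $n-(m_i-1)$ holes, and $g|f|$ restricted to $\{a\}\times D_y$ has no critical point at the level $\varepsilon$. Put $c_i=\partial U_i\setminus\nu(s_i)$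 and let $A=\bigcup_{a\in c_i}\ell_a$, where $\ell_a$ is the intersection of the segment $[p_i,a]$ with $\overline{U_i\setminus V_i}$. Then there are $\delta_0>0$ and $\varepsilon_0>0$, depending on the data above other than $\delta,\varepsilon,V_i$, such that for all $0<\delta<\delta_0$, all $0<\varepsilon<\varepsilon_0$, all $1\le i\le N$ and all $V_i$ as above, $$M_1\cup\pi_0^{-1}(A\cup V_i)\ \text{ is diffeomorphic to }\ M_1$$ as compact manifolds with boundary, after smoothing corners. Here a smoothing of corners of a compact set $Z\subset\mathbb{C}^2$ is a set $Z'=\{z\in Z:\varphi(z)\le0\}$ given by a smooth function $\varphi$, positive on $\partial Z$, and a smooth vector field $v$ that points strictly into $Z$ at every point of $\partial Z$ and satisfies $d\varphi(v)<0$ on $\{z\in Z:\varphi(z)\ge0\}$. The vector field points strictly into $Z$ at $z$ if some neighbourhoods $O$ of $z$ and $W$ of $v(z)$ and some $\eta>0$ satisfy $y+tw\in Z$ for all $y\in Z\cap O$, $w\in W$, $0<t<\eta$. The assertion is that such smoothings of both sets exist and are diffeomorphic. -/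

import Mathlib

open scoped ContDiff

namespace PlaneCurve

/-! ### Smooth domains, smoothing of corners, diffeomorphisms -/

section Domains

variable {E F : Type*} [NormedAddCommGroup E] [NormedSpace ℝ E]
  [NormedAddCommGroup F] [NormedSpace ℝ F]

/-- Diffeomorphism of subsets of normed spaces: mutually inverse maps, smooth up to the
boundary. -/
def Diffeomorphic (S : Set E) (T : Set F) : Prop :=
  ∃ (Φ : E → F) (Ψ : F → E), ContDiffOn ℝ ∞ Φ S ∧ ContDiffOn ℝ ∞ Ψ T ∧
    Set.MapsTo Φ S T ∧ Set.MapsTo Ψ T S ∧ Set.LeftInvOn Ψ Φ S ∧ Set.RightInvOn Ψ Φ T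

/-- The vector `w` points strictly into `X` at `x`: all nearby vectors, applied at all nearby
points of `X`, lead into `X` for a short, uniform time. At a point of a smooth boundary this says
that `w` is transverse to the boundary and points inwards; at a corner (convex or re-entrant) it
says so for all faces simultaneously. At a cusp there is no such vector. -/
def PointsInto (X : Set E) (x w : E) : Prop :=
  ∃ η : ℝ, 0 < η ∧ ∀ y ∈ X, ‖y - x‖ < η → ∀ u : E, ‖u - w‖ < η →
    ∀ t : ℝ, 0 < t → t < η → y + t • u ∈ X

/-- `X'` is obtained from the compact domain `X` by smoothing corners: there is a smooth vector
field `v` pointing strictly into `X` along its whole boundary, and a smooth function `φ`, positive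
on the boundary of `X`, such that `X'` is the part of `X` where `φ ≤ 0` and such that `φ` strictly
decreases along `v` on the rest of `X` and on `φ = 0`. So the boundary of `X'` is a smooth
hypersurface inside `X`, transverse to `v`, and every point of the boundary of `X` is joined to
it by a trajectory of `v` in the region between the two. -/
def IsCornerSmoothing (X X' : Set E) : Prop :=
  IsCompact X ∧ ∃ (v : E → E) (φ : E → ℝ), ContDiff ℝ ∞ v ∧ ContDiff ℝ ∞ φ ∧
    (∀ x ∈ frontier X, PointsInto X x (v x) ∧ 0 < φ x) ∧
    (∀ x ∈ X, 0 ≤ φ x → fderiv ℝ φ x (v x) < 0) ∧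
    X' = {x ∈ X | φ x ≤ 0}

/-- `X` and `Y` are diffeomorphic compact manifolds with boundary, after smoothing corners. -/
def DiffeomorphicUpToCorners (X : Set E) (Y : Set F) : Prop :=
  ∃ (X' : Set E) (Y' : Set F),
    IsCornerSmoothing X X' ∧ IsCornerSmoothing Y Y' ∧ Diffeomorphic X' Y'

/-- `S` is diffeomorphic to a closed disc with `k` holes: the closed unit disc minus `k` open round
discs with disjoint closures in the open unit disc. -/
def IsHoledDisc (k : ℕ) (S : Set ℂ) : Prop :=
  ∃ (z : Fin k → ℂ) (t : Fin k → ℝ), (∀ j, 0 < t j) ∧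
    (∀ j, Metric.closedBall (z j) (t j) ⊆ Metric.ball 0 1) ∧
    (∀ j l, j ≠ l → Disjoint (Metric.closedBall (z j) (t j)) (Metric.closedBall (z l) (t l))) ∧
    Diffeomorphic S (Metric.closedBall (0 : ℂ) 1 \ ⋃ j, Metric.ball (z j) (t j))

end Domains

/-! ### The curve and its projection `(x, y) ↦ x` -/

/-- The value `f(x, y)`. -/
noncomputable def value (f : MvPolynomial (Fin 2) ℂ) (x y : ℂ) : ℂ :=
  MvPolynomial.eval ![x, y] f

/-- The polynomial `f(x, ·)` in one variable. -/
noncomputable def fibrePoly (f : MvPolynomial (Fin 2) ℂ) (x : ℂ) : Polynomial ℂ :=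
  MvPolynomial.aeval ![Polynomial.C x, Polynomial.X] f

/-- The point `(x, y)` of the curve is a singularity of the curve, or the vertical line `L_x` is
tangent to the curve there: `f = ∂f/∂y = 0`. -/
def IsSpecialPoint (f : MvPolynomial (Fin 2) ℂ) (x y : ℂ) : Prop :=
  value f x y = 0 ∧ value (MvPolynomial.pderiv 1 f) x y = 0

/-- The set `X` of all `x` whose fibre `L_x` contains a singularity of the curve or is tangent
to it. -/
def specialValues (f : MvPolynomial (Fin 2) ℂ) : Set ℂ :=
  {x | ∃ y, IsSpecialPoint f x y}

/-- The projection is generic: every fibre meets the curve in `n = deg f` points counted with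
multiplicity, and contains at most one special point. -/
structure IsGenericProjection (f : MvPolynomial (Fin 2) ℂ) : Prop where
  natDegree_fibre : ∀ x, (fibrePoly f x).natDegree = f.totalDegree
  special_unique : ∀ x y y', IsSpecialPoint f x y → IsSpecialPoint f x y' → y = y'

/-! ### The base: discs and arcs -/

/-- The arc parametrized by `γ` on `[0, 1]`. -/
def arc (γ : ℝ → ℂ) : Set ℂ := γ '' Set.Icc 0 1

/-- The disc `D = closedBall c R`, the discs `U_i = ball (p i) (r i)` around the special values, and
the smooth arcs `s_0 = γ 0` from the base point `p₀` to `∂D` and `s_i = γ i.succ` from `p₀` to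
a point `p'_i` of `∂U_i`, which form a non-intersecting arc system in `D`. -/
structure IsArcSystem {N : ℕ} (p : Fin N → ℂ) (r : Fin N → ℝ) (c : ℂ) (R : ℝ)
    (p₀ : ℂ) (γ : Fin (N + 1) → ℝ → ℂ) : Prop where
  radius_pos : ∀ i, 0 < r i
  discs_subset : ∀ i, Metric.closedBall (p i) (r i) ⊆ Metric.ball c R
  discs_disjoint : ∀ i j, i ≠ j →
    Disjoint (Metric.closedBall (p i) (r i)) (Metric.closedBall (p j) (r j))
  smooth : ∀ k, ContDiff ℝ ∞ (γ k)
  regular : ∀ k, ∀ t ∈ Set.Icc (0 : ℝ) 1, deriv (γ k) t ≠ 0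
  injOn : ∀ k, Set.InjOn (γ k) (Set.Icc 0 1)
  start : ∀ k, γ k 0 = p₀
  /-- Different arcs meet only in `p₀`, which they leave in different directions. -/
  inter : ∀ k l, k ≠ l → arc (γ k) ∩ arc (γ l) = {p₀}
  directions : ∀ k l, k ≠ l → ¬ SameRay ℝ (deriv (γ k) 0) (deriv (γ l) 0)
  /-- `s_i` lies in the interior of `D`. -/
  arc_subset : ∀ i : Fin N, arc (γ i.succ) ⊆ Metric.ball c R
  /-- `s_i` meets the closure of `U_i` only in its end point `p'_i`, transversely to `∂U_i`, and
  does not meet the closure of any other `U_j`. -/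
  arc_inter_disc : ∀ i : Fin N, arc (γ i.succ) ∩ Metric.closedBall (p i) (r i) = {γ i.succ 1}
  arc_end : ∀ i : Fin N, γ i.succ 1 ∈ Metric.sphere (p i) (r i)
  arc_transverse : ∀ i : Fin N, inner ℝ (γ i.succ 1 - p i) (deriv (γ i.succ) 1) ≠ 0
  arc_disjoint : ∀ i j : Fin N, i ≠ j →
    Disjoint (arc (γ i.succ)) (Metric.closedBall (p j) (r j))
  /-- `s_0` lies in the interior of `D` except for its end point, where it meets `∂D`
  transversely, and does not meet the closure of any `U_j`. -/
  arc₀_subset : γ 0 '' Set.Ico 0 1 ⊆ Metric.ball c R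
  arc₀_end : γ 0 1 ∈ Metric.sphere c R
  arc₀_transverse : inner ℝ (γ 0 1 - c) (deriv (γ 0) 1) ≠ 0
  arc₀_disjoint : ∀ j : Fin N, Disjoint (arc (γ 0)) (Metric.closedBall (p j) (r j))

/-- `ν(Γ)`: the union of the open tubes of radius `δ` around all arcs and of all discs `U_i`. -/
def graphNbhd {N : ℕ} (p : Fin N → ℂ) (r : Fin N → ℝ) (γ : Fin (N + 1) → ℝ → ℂ) (δ : ℝ) :
    Set ℂ :=
  (⋃ k, Metric.thickening δ (arc (γ k))) ∪ ⋃ i, Metric.ball (p i) (r i)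

/-- The region `A` of the disc `U = ball p r` with concentric disc `V = closedBall p r'`: the union
over `a ∈ ∂U \ ν(s)` of the parts in the closure of `U \ V` of the segments from `p` to `a`. -/
def regionA (p : ℂ) (r r' : ℝ) (s : Set ℂ) (δ : ℝ) : Set ℂ :=
  ⋃ a ∈ Metric.sphere p r \ Metric.thickening δ s,
    segment ℝ p a ∩ closure (Metric.ball p r \ Metric.closedBall p r')

/-! ### The complement -/

/-- The tube `ν(C)` around the curve: `g |f| < ε`, where `g` is a positive smooth function. -/
def curveNbhd (f : MvPolynomial (Fin 2) ℂ) (g : ℂ × ℂ → ℝ) (ε : ℝ) : Set (ℂ × ℂ) :=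
  {z | g z * ‖value f z.1 z.2‖ < ε}

/-- `π₀⁻¹(S)`, where `π₀` is the restriction of the first projection to
`M₀ = (D × D_y) \ ν(C)`. -/
def preim (D Dy : Set ℂ) (ν : Set (ℂ × ℂ)) (S : Set ℂ) : Set (ℂ × ℂ) :=
  {z ∈ (D ×ˢ Dy) \ ν | z.1 ∈ S}

/-- `M₁ = π₀⁻¹(D \ ν(Γ))`. -/
def pieceM₁ {N : ℕ} (D Dy : Set ℂ) (ν : Set (ℂ × ℂ)) (p : Fin N → ℂ) (r : Fin N → ℝ)
    (γ : Fin (N + 1) → ℝ → ℂ) (δ : ℝ) : Set (ℂ × ℂ) :=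
  preim D Dy ν (D \ graphNbhd p r γ δ)

/-- `M₁ ∪ π₀⁻¹(A ∪ V_i)`, where `V_i = closedBall (p i) r'`. -/
def pieceM₂ {N : ℕ} (D Dy : Set ℂ) (ν : Set (ℂ × ℂ)) (p : Fin N → ℂ) (r : Fin N → ℝ)
    (γ : Fin (N + 1) → ℝ → ℂ) (δ : ℝ) (i : Fin N) (r' : ℝ) : Set (ℂ × ℂ) :=
  pieceM₁ D Dy ν p r γ δ ∪
    preim D Dy ν (regionA (p i) (r i) r' (arc (γ i.succ)) δ ∪ Metric.closedBall (p i) r')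

/-- `V` is a disc as used around a special value: for every `a ∈ V` the fibre `π₀⁻¹(a)` is
a disc with `k` holes, and `a` is not a critical value of the projection on `∂ν(C)`, i.e. `g |f|`
has no critical point on the line `L_a` at the level `ε`. -/
def IsModelDisc (f : MvPolynomial (Fin 2) ℂ) (g : ℂ × ℂ → ℝ) (ε : ℝ) (Dy : Set ℂ) (k : ℕ)
    (V : Set ℂ) : Prop :=
  ∀ a ∈ V, IsHoledDisc k {y ∈ Dy | (a, y) ∉ curveNbhd f g ε} ∧
    ∀ y ∈ Dy, g (a, y) * ‖value f a y‖ = ε →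
      fderiv ℝ (fun w : ℂ => g (a, w) * ‖value f a w‖) y ≠ 0

end PlaneCurve

/-! Write X for M₁ ∪ π₀⁻¹(A ∪ V_i) and Y for M₁. No flow is integrated: one and the same smooth
domain is a smoothing of corners of both. Describe Y as `{H ≥ 0}` with H continuous, and suppose
that a smooth field v points into X along X and that H grows at a definite rate along v wherever H ≤
0 on X. By compactness H still grows where H ≤ η, a convolution h of H is smooth and grows along v
there too, and `{h ≥ η/2}` smooths both sets with the same v
(`diffeomorphicUpToCorners_of_increasing`). The conditions on v at a point are convex and open, so a
partition of unity reduces everything to finding one vector at each point of X.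

Here H is the minimum of a function H_B of x, of T² - |y - b|² and of g|f| - ε. For H_B, the
defining function of the disc U_i in the list of constraints is replaced by a function Ψ that is
very negative inside U_i, grows radially on A, and grows on V_i in the direction opposite to the
slit which the tube of s_i cuts out of ∂U_i (`exists_slit_disc_function`). That this slit is a
single interval with the expected behaviour at its ends is `exists_slit`; the corners away from it
are handled by `IsArcSystem.eventually_exists_inward`. Together they give
`IsArcSystem.eventually_base_model`.

In the total space a base vector u must be completed to (u, v) increasing g|f| on the level ε. Where
g|f| is not critical along the vertical line, a fibre component v achieves any prescribed
derivative. By `exists_level_bound`, for small ε the remaining points lie over the discs U_j, and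
there g|f| itself grows in the radial direction of the base. Over V_i such points are excluded by
assumption; over A radial vectors also point into the base and increase Ψ, up to an arbitrarily
small correction. This is why A is made of radial segments.

Radial growth is the analytic core (`exists_radial_increase`). At a fibre-critical point, |f_y| ≤
K|f| with K controlled by g. With a Puiseux parameter, x = p + ρtᴹ and f = a(t)∏(y - Y_j(t)), the
bound says that ∑ 1/(y - Y_j) stays bounded. If y tends to the special point under this constraint,
then t ∂_t log f tends to a positive integer (`exists_tendsto_logDeriv`), so (x - p) f_x / f has
real part bounded below, while the contribution of g is O(|x - p|). -/

namespace PlaneCurve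

open Filter Topology Metric Set

/-! ### Calculus of inward vectors and of directions of uniform increase. -/

section Increasing

variable {E : Type*} [NormedAddCommGroup E] [NormedSpace ℝ E]

/-- The function `H` increases at a definite rate in all directions close to `w`, at all points
close to `x`. -/
def IncreasesAlong (H : E → ℝ) (x w : E) : Prop :=
  ∃ η : ℝ, 0 < η ∧ ∃ c : ℝ, 0 < c ∧ ∀ y : E, ‖y - x‖ < η → ∀ u : E, ‖u - w‖ < η →
    ∀ t : ℝ, 0 < t → t < η → H y + c * t ≤ H (y + t • u)

/-- The condition at `(x, w)` already covers all points and vectors within `η`, so radius `η / 2`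
remains for every pair within `η / 2`. This openness, jointly in point and vector, is what a
partition of unity needs. -/
theorem PointsInto.eventually {X : Set E} {x w : E} (h : PointsInto X x w) :
    ∀ᶠ q : E × E in 𝓝 (x, w), PointsInto X q.1 q.2 := by
  obtain ⟨η, hη, H⟩ := h
  rw [nhds_prod_eq]
  filter_upwards [prod_mem_prod (ball_mem_nhds x (half_pos hη)) (ball_mem_nhds w (half_pos hη))]
  rintro ⟨x', w'⟩ ⟨hx, hw⟩
  rw [mem_ball, dist_eq_norm] at hx hw
  refine ⟨η / 2, half_pos hη, fun y hy hyx u hu t ht htη => H y hy ?_ u ?_ t ht (by linarith)⟩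
  · calc ‖y - x‖ = ‖(y - x') + (x' - x)‖ := by congr 1; abel
      _ ≤ _ := norm_add_le _ _
      _ < η := by linarith
  · calc ‖u - w‖ = ‖(u - w') + (w' - w)‖ := by congr 1; abel
      _ ≤ _ := norm_add_le _ _
      _ < η := by linarith

theorem IncreasesAlong.eventually {H : E → ℝ} {x w : E} (h : IncreasesAlong H x w) :
    ∀ᶠ q : E × E in 𝓝 (x, w), IncreasesAlong H q.1 q.2 := by
  obtain ⟨η, hη, c, hc, H⟩ := h
  rw [nhds_prod_eq]
  filter_upwards [prod_mem_prod (ball_mem_nhds x (half_pos hη)) (ball_mem_nhds w (half_pos hη))]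
  rintro ⟨x', w'⟩ ⟨hx, hw⟩
  rw [mem_ball, dist_eq_norm] at hx hw
  refine ⟨η / 2, half_pos hη, c, hc, fun y hyx u hu t ht htη => H y ?_ u ?_ t ht (by linarith)⟩
  · calc ‖y - x‖ = ‖(y - x') + (x' - x)‖ := by congr 1; abel
      _ ≤ _ := norm_add_le _ _
      _ < η := by linarith
  · calc ‖u - w‖ = ‖(u - w') + (w' - w)‖ := by congr 1; abel
      _ ≤ _ := norm_add_le _ _
      _ < η := by linarith

/-- Short steps along vectors near `w` stay in a given ball. It is needed when a step is broken into
two, or when only the germ of a set or function is known. -/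
theorem exists_pos_forall_add_smul_near {η : ℝ} (hη : 0 < η) (w : E) :
    ∃ η' > 0, η' ≤ η / 2 ∧ ∀ x y u : E, ‖y - x‖ < η' → ‖u - w‖ < η' → ∀ t : ℝ, 0 < t → t < η' →
      ‖y + t • u - x‖ < η := by
  refine ⟨min (η / 2) (min 1 (η / (2 * (‖w‖ + 1)))), by positivity, min_le_left _ _, ?_⟩
  intro x y u hy hu t ht ht'
  have h1 : ‖u‖ ≤ ‖w‖ + 1 := by
    have : ‖u - w‖ < 1 := lt_of_lt_of_le hu ((min_le_right _ _).trans (min_le_left _ _))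
    linarith [norm_le_insert' u w]
  have h2 : t < η / (2 * (‖w‖ + 1)) := lt_of_lt_of_le ht' ((min_le_right _ _).trans (min_le_right _ _))
  have h3 : ‖y - x‖ < η / 2 := lt_of_lt_of_le hy (min_le_left _ _)
  have hw : 0 < ‖w‖ + 1 := by positivity
  have h4 : t * (‖w‖ + 1) < η / 2 := by
    rw [lt_div_iff₀ (by positivity)] at h2; linarith
  calc ‖y + t • u - x‖ = ‖(y - x) + t • u‖ := by congr 1; abel
    _ ≤ ‖y - x‖ + t * ‖u‖ := by
      refine (norm_add_le _ _).trans ?_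
      rw [norm_smul, Real.norm_of_nonneg ht.le]
    _ ≤ ‖y - x‖ + t * (‖w‖ + 1) := by gcongr
    _ < η := by linarith

/-- A step of length `t` along a convex combination is a step of length `t * a` followed by one of
length `t * b`. The deviation `d` of `u` is added to both vectors, so each partial step is covered
by one of the hypotheses. -/
theorem PointsInto.convex (X : Set E) (x : E) : Convex ℝ {w | PointsInto X x w} := by
  rw [convex_iff_forall_pos]
  intro w₁ h₁ w₂ h₂ a b ha hb hab
  obtain ⟨η₁, hη₁, H₁⟩ := h₁
  obtain ⟨η₂, hη₂, H₂⟩ := h₂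
  have hη : 0 < min η₁ η₂ := lt_min hη₁ hη₂
  obtain ⟨η', hη', hle, hnear⟩ := exists_pos_forall_add_smul_near hη w₁
  refine ⟨η', hη', fun y hy hyx u hu t ht htη => ?_⟩
  set d := u - (a • w₁ + b • w₂) with hd
  have hu' : u = a • (w₁ + d) + b • (w₂ + d) := by
    have : a • d + b • d = d := by rw [← add_smul, hab, one_smul]
    rw [smul_add, smul_add, add_add_add_comm, this, hd]; abel
  have ha1 : a ≤ 1 := by linarith
  have hb1 : b ≤ 1 := by linarith
  have hat : t * a ≤ t := by nlinarith
  have hbt : t * b ≤ t := by nlinarith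
  have e1 : y + (t * a) • (w₁ + d) ∈ X :=
    H₁ y hy (by linarith [min_le_left η₁ η₂]) _ (by simpa using (by linarith [min_le_left η₁ η₂] : ‖d‖ < η₁)) _ (by positivity)
      (by linarith [min_le_left η₁ η₂])
  have e2 := H₂ _ e1 ((hnear x y (w₁ + d) hyx (by simpa using hu) _ (by positivity)
    (by linarith)).trans_le (min_le_right _ _)) (w₂ + d)
      (by simpa using (by linarith [min_le_right η₁ η₂] : ‖d‖ < η₂)) (t * b) (by positivity)
      (by linarith [min_le_right η₁ η₂])
  convert e2 using 1
  rw [hu', smul_add, smul_smul, smul_smul, add_assoc]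

theorem IncreasesAlong.convex (H : E → ℝ) (x : E) : Convex ℝ {w | IncreasesAlong H x w} := by
  rw [convex_iff_forall_pos]
  intro w₁ h₁ w₂ h₂ a b ha hb hab
  obtain ⟨η₁, hη₁, c₁, hc₁, H₁⟩ := h₁
  obtain ⟨η₂, hη₂, c₂, hc₂, H₂⟩ := h₂
  have hη : 0 < min η₁ η₂ := lt_min hη₁ hη₂
  obtain ⟨η', hη', hle, hnear⟩ := exists_pos_forall_add_smul_near hη w₁
  refine ⟨η', hη', c₁ * a + c₂ * b, by positivity, fun y hyx u hu t ht htη => ?_⟩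
  set d := u - (a • w₁ + b • w₂) with hd
  have hu' : u = a • (w₁ + d) + b • (w₂ + d) := by
    have : a • d + b • d = d := by rw [← add_smul, hab, one_smul]
    rw [smul_add, smul_add, add_add_add_comm, this, hd]; abel
  have ha1 : a ≤ 1 := by linarith
  have hb1 : b ≤ 1 := by linarith
  have hat : t * a ≤ t := by nlinarith
  have hbt : t * b ≤ t := by nlinarith
  have e1 :=
    H₁ y (by linarith [min_le_left η₁ η₂]) (w₁ + d) (by simpa using (by linarith [min_le_left η₁ η₂] : ‖d‖ < η₁))
      (t * a) (by positivity) (by linarith [min_le_left η₁ η₂])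
  have e2 := H₂ _ ((hnear x y (w₁ + d) hyx (by simpa using hu) (t * a) (by positivity)
    (by linarith)).trans_le (min_le_right _ _)) (w₂ + d)
      (by simpa using (by linarith [min_le_right η₁ η₂] : ‖d‖ < η₂)) (t * b) (by positivity)
      (by linarith [min_le_right η₁ η₂])
  have e3 : y + t • u = y + (t * a) • (w₁ + d) + (t * b) • (w₂ + d) := by
    rw [hu', smul_add, smul_smul, smul_smul, add_assoc]
  rw [e3]
  linarith

theorem pointsInto_of_mem_nhds {X : Set E} {x : E} (h : X ∈ 𝓝 x) (w : E) : PointsInto X x w := by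
  obtain ⟨η, hη, hX⟩ := Metric.mem_nhds_iff.1 h
  obtain ⟨η', hη', -, hnear⟩ := exists_pos_forall_add_smul_near hη w
  refine ⟨η', hη', fun y _ hy u hu t ht htη => hX ?_⟩
  rw [mem_ball, dist_eq_norm]
  exact hnear x y u hy hu t ht htη

theorem PointsInto.inter {X Y : Set E} {x w : E} (hX : PointsInto X x w) (hY : PointsInto Y x w) :
    PointsInto (X ∩ Y) x w := by
  obtain ⟨η₁, hη₁, H₁⟩ := hX
  obtain ⟨η₂, hη₂, H₂⟩ := hY
  refine ⟨min η₁ η₂, lt_min hη₁ hη₂, fun y hy hyx u hu t ht htη => ⟨?_, ?_⟩⟩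
  · exact H₁ y hy.1 (hyx.trans_le (min_le_left _ _)) u (hu.trans_le (min_le_left _ _)) t ht
      (htη.trans_le (min_le_left _ _))
  · exact H₂ y hy.2 (hyx.trans_le (min_le_right _ _)) u (hu.trans_le (min_le_right _ _)) t ht
      (htη.trans_le (min_le_right _ _))

theorem PointsInto.union {X Y : Set E} {x w : E} (hX : PointsInto X x w) (hY : PointsInto Y x w) :
    PointsInto (X ∪ Y) x w := by
  obtain ⟨η₁, hη₁, H₁⟩ := hX
  obtain ⟨η₂, hη₂, H₂⟩ := hY
  refine ⟨min η₁ η₂, lt_min hη₁ hη₂, fun y hy hyx u hu t ht htη => ?_⟩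
  rcases hy with hy | hy
  · exact Or.inl (H₁ y hy (hyx.trans_le (min_le_left _ _)) u (hu.trans_le (min_le_left _ _)) t ht
      (htη.trans_le (min_le_left _ _)))
  · exact Or.inr (H₂ y hy (hyx.trans_le (min_le_right _ _)) u (hu.trans_le (min_le_right _ _)) t ht
      (htη.trans_le (min_le_right _ _)))

/-- Pointing into a set only depends on the germ of the set. -/
theorem PointsInto.congr {X Y : Set E} {x w : E} (hX : PointsInto X x w)
    (h : ∀ᶠ y in 𝓝 x, y ∈ X ↔ y ∈ Y) : PointsInto Y x w := by
  obtain ⟨η₁, hη₁, H₁⟩ := hX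
  obtain ⟨η₂, hη₂, H₂⟩ := Metric.eventually_nhds_iff.1 h
  obtain ⟨η', hη', hle, hnear⟩ := exists_pos_forall_add_smul_near (lt_min hη₁ hη₂) w
  have l1 := min_le_left η₁ η₂
  have l2 := min_le_right η₁ η₂
  have l3 := lt_min hη₁ hη₂
  refine ⟨η', hη', fun y hy hyx u hu t ht htη => ?_⟩
  refine (H₂ ?_).1 (H₁ y ((H₂ ?_).2 hy) ?_ u ?_ t ht ?_)
  · rw [dist_eq_norm]; exact (hnear x y u hyx hu t ht htη).trans_le l2
  · rw [dist_eq_norm]; linarith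
  all_goals linarith

theorem PointsInto.preimage {F : Type*} [NormedAddCommGroup F] [NormedSpace ℝ F] {S : Set E}
    {x w : E × F} (h : PointsInto S x.1 w.1) : PointsInto {z : E × F | z.1 ∈ S} x w := by
  obtain ⟨η, hη, H⟩ := h
  refine ⟨η, hη, fun y hy hyx u hu t ht htη => H y.1 hy ?_ u.1 ?_ t ht htη⟩
  · exact (norm_fst_le (y - x)).trans_lt hyx
  · exact (norm_fst_le (u - w)).trans_lt hu

theorem IncreasesAlong.comp_fst {F : Type*} [NormedAddCommGroup F] [NormedSpace ℝ F] {H : E → ℝ}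
    {x w : E × F} (h : IncreasesAlong H x.1 w.1) : IncreasesAlong (fun z : E × F => H z.1) x w := by
  obtain ⟨η, hη, c, hc, H⟩ := h
  refine ⟨η, hη, c, hc, fun y hyx u hu t ht htη => H y.1 ?_ u.1 ?_ t ht htη⟩
  · exact (norm_fst_le (y - x)).trans_lt hyx
  · exact (norm_fst_le (u - w)).trans_lt hu

theorem IncreasesAlong.pointsInto {H : E → ℝ} {x w : E} (h : IncreasesAlong H x w) (a : ℝ) :
    PointsInto {z | a ≤ H z} x w := by
  obtain ⟨η, hη, c, hc, H⟩ := h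
  refine ⟨η, hη, fun y hy hyx u hu t ht htη => ?_⟩
  have := H y hyx u hu t ht htη
  have : 0 < c * t := by positivity
  simp only [mem_ofPred_eq] at hy ⊢
  linarith

theorem IncreasesAlong.congr {H₁ H₂ : E → ℝ} {x w : E} (h₁ : IncreasesAlong H₁ x w)
    (h : H₁ =ᶠ[𝓝 x] H₂) : IncreasesAlong H₂ x w := by
  obtain ⟨η₁, hη₁, c, hc, H₁⟩ := h₁
  obtain ⟨η₂, hη₂, H₂⟩ := Metric.eventually_nhds_iff.1 h
  obtain ⟨η', hη', hle, hnear⟩ := exists_pos_forall_add_smul_near (lt_min hη₁ hη₂) w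
  have l1 := min_le_left η₁ η₂
  have l2 := min_le_right η₁ η₂
  have l3 := lt_min hη₁ hη₂
  refine ⟨η', hη', c, hc, fun y hyx u hu t ht htη => ?_⟩
  have := H₁ y (by linarith) u (by linarith) t ht (by linarith)
  rwa [H₂ (by rw [dist_eq_norm]; linarith),
    H₂ (by rw [dist_eq_norm]; exact (hnear x y u hyx hu t ht htη).trans_le l2)] at this

theorem IncreasesAlong.min {H₁ H₂ : E → ℝ} {x w : E} (h₁ : IncreasesAlong H₁ x w)
    (h₂ : IncreasesAlong H₂ x w) : IncreasesAlong (fun z => min (H₁ z) (H₂ z)) x w := by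
  obtain ⟨η₁, hη₁, c₁, hc₁, H₁⟩ := h₁
  obtain ⟨η₂, hη₂, c₂, hc₂, H₂⟩ := h₂
  have l1 := min_le_left η₁ η₂
  have l2 := min_le_right η₁ η₂
  refine ⟨Min.min η₁ η₂, lt_min hη₁ hη₂, Min.min c₁ c₂, lt_min hc₁ hc₂,
    fun y hyx u hu t ht htη => le_min ?_ ?_⟩
  · refine le_trans ?_ (H₁ y (by linarith) u (by linarith) t ht (by linarith))
    gcongr <;> apply min_le_left
  · refine le_trans ?_ (H₂ y (by linarith) u (by linarith) t ht (by linarith))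
    gcongr <;> apply min_le_right

/-- A minimum of two continuous functions increases as soon as those do that realize it. -/
theorem IncreasesAlong.min_of_active {H₁ H₂ : E → ℝ} {x w : E} (c₁ : ContinuousAt H₁ x)
    (c₂ : ContinuousAt H₂ x) (h₁ : H₁ x ≤ H₂ x → IncreasesAlong H₁ x w)
    (h₂ : H₂ x ≤ H₁ x → IncreasesAlong H₂ x w) :
    IncreasesAlong (fun z => Min.min (H₁ z) (H₂ z)) x w := by
  rcases lt_trichotomy (H₁ x) (H₂ x) with h | h | h
  · refine (h₁ h.le).congr ?_
    filter_upwards [c₁.eventually_lt c₂ h] with y hy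
    rw [min_eq_left hy.le]
  · exact (h₁ h.le).min (h₂ h.ge)
  · refine (h₂ h.le).congr ?_
    filter_upwards [c₂.eventually_lt c₁ h] with y hy
    rw [min_eq_right hy.le]

/-- By continuity only the members attaining the minimum at `x` matter near `x`. A vector thus has
to respect only the boundary faces through the point. -/
theorem IncreasesAlong.inf'_of_active {ι : Type*} {s : Finset ι} (hs : s.Nonempty)
    {H : ι → E → ℝ} {x w : E} (hc : ∀ i ∈ s, ContinuousAt (H i) x)
    (h : ∀ i ∈ s, (∀ j ∈ s, H i x ≤ H j x) → IncreasesAlong (H i) x w) :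
    IncreasesAlong (fun z => s.inf' hs (fun i => H i z)) x w := by
  classical
  induction hs using Finset.Nonempty.cons_induction with
  | singleton a => simpa using h a (by simp) (by simp)
  | cons a s ha hs ih =>
    simp only [Finset.inf'_cons hs]
    have hcs : ContinuousAt (fun z => s.inf' hs (fun i => H i z)) x :=
      ContinuousAt.finset_inf'_apply hs fun i hi => hc i (by simp [hi])
    refine IncreasesAlong.min_of_active (hc a (by simp)) hcs (fun hle => ?_) (fun hle => ?_)
    · refine h a (by simp) fun j hj => ?_
      rcases Finset.mem_cons.1 hj with rfl | hj
      · rfl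
      · exact hle.trans (Finset.inf'_le _ hj)
    · refine ih (fun i hi => hc i (by simp [hi])) fun i hi hmin => h i (by simp [hi]) fun j hj => ?_
      rcases Finset.mem_cons.1 hj with rfl | hj
      · exact (Finset.le_inf' hs _ hmin).trans hle
      · exact hmin j hj

theorem IncreasesAlong.sub_const {H : E → ℝ} {x w : E} (h : IncreasesAlong H x w) (a : ℝ) :
    IncreasesAlong (fun z => H z - a) x w := by
  obtain ⟨η, hη, c, hc, H⟩ := h
  refine ⟨η, hη, c, hc, fun y hyx u hu t ht htη => ?_⟩
  linarith [H y hyx u hu t ht htη]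

/-- Strict differentiability gives the uniformity in the starting point. With `c` a quarter of the
derivative, the linear part exceeds `3 * c * t` and the error is at most `c * t`. -/
theorem _root_.HasStrictFDerivAt.increasesAlong {H : E → ℝ} {H' : E →L[ℝ] ℝ} {x w : E}
    (h : HasStrictFDerivAt H H' x) (hw : 0 < H' w) : IncreasesAlong H x w := by
  set c := H' w / 4 with hc
  have hc0 : 0 < c := by positivity
  have h1 := h.isLittleO.def (c := c / (‖w‖ + 1)) (by positivity)
  obtain ⟨η₁, hη₁, H₁⟩ := Metric.eventually_nhds_iff.1 h1
  have h2 : ∀ᶠ u in 𝓝 w, 3 * c < H' u := by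
    refine H'.continuous.continuousAt.eventually (lt_mem_nhds ?_)
    linarith
  obtain ⟨η₂, hη₂, H₂⟩ := Metric.eventually_nhds_iff.1 h2
  obtain ⟨η', hη', hle, hnear⟩ := exists_pos_forall_add_smul_near (lt_min hη₁ hη₂) w
  have l1 := min_le_left η₁ η₂
  have l2 := min_le_right η₁ η₂
  have l3 := lt_min hη₁ hη₂
  refine ⟨Min.min η' 1, by positivity, c, hc0, fun y hyx u hu t ht htη => ?_⟩
  have k1 := min_le_left η' 1
  have k2 := min_le_right η' 1
  have h3 := @H₁ (y + t • u, y) (by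
    rw [Prod.dist_eq, dist_eq_norm, dist_eq_norm]
    exact max_lt ((hnear x y u (by linarith) (by linarith) t ht (by linarith)).trans_le l1)
      (by dsimp only; linarith))
  have h4 := @H₂ u (by rw [dist_eq_norm]; linarith)
  have h5 : ‖u‖ ≤ ‖w‖ + 1 := by linarith [norm_le_insert' u w]
  simp only [add_sub_cancel_left, map_smul, smul_eq_mul, norm_smul, Real.norm_of_nonneg ht.le] at h3
  have h6 : c / (‖w‖ + 1) * (t * ‖u‖) ≤ c * t := by
    calc c / (‖w‖ + 1) * (t * ‖u‖) ≤ c / (‖w‖ + 1) * (t * (‖w‖ + 1)) := by gcongr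
      _ = c * t := by field_simp
  have h7 := (abs_le.1 (h3.trans h6)).1
  nlinarith

/-- The distance to a compact set increases in all directions that lead away from all nearest
points. -/
theorem increasesAlong_infDist {E : Type*} [NormedAddCommGroup E] [InnerProductSpace ℝ E]
    {K : Set E} (hK : IsCompact K) (hne : K.Nonempty) {x w : E} (hx : x ∉ K)
    (h : ∀ q ∈ K, dist x q = infDist x K → 0 < inner ℝ (x - q) w) :
    IncreasesAlong (fun z => infDist z K) x w := by
  have hd : 0 < infDist x K := (hK.isClosed.notMem_iff_infDist_pos hne).1 hx
  obtain ⟨q₀, hq₀, hq₀x⟩ := hK.exists_infDist_eq_dist hne x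
  have cN : IsCompact {q ∈ K | dist x q = infDist x K} :=
    hK.inter_right (t := {q | dist x q = infDist x K})
      (isClosed_eq (by fun_prop) continuous_const)
  obtain ⟨q₁, hq₁, hmin⟩ := cN.exists_isMinOn ⟨q₀, hq₀, hq₀x.symm⟩
    (f := fun q => inner ℝ (x - q) w) (by fun_prop)
  set c := inner ℝ (x - q₁) w / 2 with hc
  have hc0 : 0 < c := half_pos (h q₁ hq₁.1 hq₁.2)
  have cF : IsCompact {q ∈ K | inner ℝ (x - q) w ≤ c} :=
    hK.inter_right (t := {q | inner ℝ (x - q) w ≤ c})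
      (isClosed_le (by fun_prop) continuous_const)
  -- Points of `K` with small inner product are not nearest to `x`, so by compactness they lose by a
  -- fixed margin `m`. They cannot become nearest to points close to `x`.
  obtain ⟨m, hm, hmK⟩ : ∃ m > 0, ∀ q ∈ K, inner ℝ (x - q) w ≤ c → infDist x K + m ≤ dist x q := by
    rcases Set.eq_empty_or_nonempty {q ∈ K | inner ℝ (x - q) w ≤ c} with he | hn
    · refine ⟨1, one_pos, fun q hq hqc => ?_⟩
      exact absurd (show q ∈ {q ∈ K | inner ℝ (x - q) w ≤ c} from ⟨hq, hqc⟩) (by simp [he])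
    · obtain ⟨q₂, hq₂, hmin₂⟩ := cF.exists_isMinOn hn (f := fun q => dist x q) (by fun_prop)
      have h1 : infDist x K ≤ dist x q₂ := infDist_le_dist_of_mem hq₂.1
      have h2 : infDist x K ≠ dist x q₂ := by
        intro he
        have := hmin (show q₂ ∈ {q ∈ K | dist x q = infDist x K} from ⟨hq₂.1, he.symm⟩)
        simp only [mem_ofPred_eq] at this
        have := hq₂.2
        linarith
      refine ⟨dist x q₂ - infDist x K, by linarith [lt_of_le_of_ne h1 h2], fun q hq hqc => ?_⟩
      have := hmin₂ (show q ∈ {q ∈ K | inner ℝ (x - q) w ≤ c} from ⟨hq, hqc⟩)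
      simp only [mem_ofPred_eq] at this
      linarith
  set B := infDist x K + 1 with hB
  have hB0 : 0 < B := by positivity
  obtain ⟨η₁, hη₁, hη₁m, hη₁1, hη₁B, hη₁w⟩ : ∃ η₁ > 0, η₁ ≤ m / 4 ∧ η₁ ≤ 1 / 4 ∧
      η₁ * (‖w‖ + 1) ≤ c / 4 ∧ B * η₁ ≤ c / 4 := by
    refine ⟨Min.min (Min.min (m / 4) (1 / 4)) (Min.min (c / 4 / (‖w‖ + 1)) (c / 4 / B)),
      by positivity, ?_, ?_, ?_, ?_⟩
    · exact (min_le_left _ _).trans (min_le_left _ _)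
    · exact (min_le_left _ _).trans (min_le_right _ _)
    · rw [← le_div_iff₀ (by positivity)]; exact (min_le_right _ _).trans (min_le_left _ _)
    · rw [mul_comm, ← le_div_iff₀ (by positivity)]; exact (min_le_right _ _).trans (min_le_right _ _)
  obtain ⟨η', hη', hle, hnear⟩ := exists_pos_forall_add_smul_near hη₁ w
  refine ⟨η', hη', c / (4 * B), by positivity, fun y hyx u hu t ht htη => ?_⟩
  -- Choosing `q` nearest to the end of the step makes the distance there a norm; at the start `‖y -
  -- q‖` is an upper bound, which is the direction needed.
  obtain ⟨q, hq, hqy⟩ := hK.exists_infDist_eq_dist hne (y + t • u)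
  have n1 := hnear x y u hyx hu t ht htη
  have n2 : dist x q < infDist x K + 2 * η₁ := by
    have : infDist (y + t • u) K ≤ infDist x K + dist (y + t • u) x := infDist_le_infDist_add_dist
    have h3 := dist_triangle x (y + t • u) q
    rw [← hqy, dist_comm x (y + t • u), dist_eq_norm (y + t • u) x] at h3
    rw [dist_eq_norm] at this
    linarith
  have n3 : c < inner ℝ (x - q) w := by
    by_contra! hcon
    linarith [hmK q hq hcon]
  have n4 : ‖x - q‖ ≤ B := by rw [← dist_eq_norm]; linarith
  have n5 : inner ℝ (x - q) w - inner ℝ (y - q) u ≤ c / 2 := by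
    have e : inner ℝ (x - q) w - inner ℝ (y - q) u
        = inner ℝ (x - y) u + inner ℝ (x - q) (w - u) := by
      simp only [inner_sub_left, inner_sub_right]; ring
    have hu1 : ‖u‖ ≤ ‖w‖ + 1 := by linarith [norm_le_insert' u w]
    have h1 : inner ℝ (x - y) u ≤ η₁ * (‖w‖ + 1) := (real_inner_le_norm _ _).trans (by
      rw [norm_sub_rev]; gcongr; linarith)
    have h2 : inner ℝ (x - q) (w - u) ≤ B * η₁ := (real_inner_le_norm _ _).trans (by
      rw [norm_sub_rev w]; gcongr; linarith)
    linarith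
  have n6 : c / 2 ≤ inner ℝ (y - q) u := by linarith
  have n7 : infDist y K ≤ dist y q := infDist_le_dist_of_mem hq
  show infDist y K + c / (4 * B) * t ≤ infDist (y + t • u) K
  rw [hqy, dist_eq_norm]
  rw [dist_eq_norm] at n7
  have n8 : ‖y - q‖ ^ 2 + 2 * t * (c / 2) ≤ ‖y + t • u - q‖ ^ 2 := by
    have e : y + t • u - q = (y - q) + t • u := by abel
    rw [e, norm_add_sq_real, inner_smul_right]
    nlinarith [sq_nonneg ‖t • u‖]
  have n9 : ‖y - q‖ ≤ ‖y + t • u - q‖ := by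
    refine (pow_le_pow_iff_left₀ (norm_nonneg _) (norm_nonneg _) two_ne_zero).1 ?_
    nlinarith
  have n10 : ‖y + t • u - q‖ ≤ 2 * B := by
    rw [← dist_eq_norm, ← hqy]
    have : infDist (y + t • u) K ≤ infDist x K + dist (y + t • u) x := infDist_le_infDist_add_dist
    rw [dist_eq_norm] at this
    linarith
  have n11 : c * t ≤ (‖y + t • u - q‖ - ‖y - q‖) * (4 * B) := by
    have hd0 : 0 ≤ ‖y + t • u - q‖ - ‖y - q‖ := by linarith
    nlinarith [norm_nonneg (y - q)]
  have n12 : c / (4 * B) * t ≤ ‖y + t • u - q‖ - ‖y - q‖ := by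
    rw [div_mul_eq_mul_div, div_le_iff₀ (by positivity)]; exact n11
  linarith

end Increasing
end PlaneCurve

namespace PlaneCurve

open Filter Topology Metric Set MeasureTheory

/-! ### Smoothing by convolution, and the criterion for equality after smoothing corners. -/

section Smoothing

variable {E : Type*} [NormedAddCommGroup E] [NormedSpace ℝ E] [FiniteDimensional ℝ E]

/-- Smoothing of a continuous function that increases along a vector field on a compact set. -/
theorem exists_smooth_increasing {H : E → ℝ} (hH : Continuous H) {v : E → E} {K : Set E}
    (hK : IsCompact K) (hv : ∀ x ∈ K, IncreasesAlong H x (v x)) (hvc : Continuous v)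
    {τ : ℝ} (hτ : 0 < τ) {L : Set E} (hL : IsCompact L) :
    ∃ h : E → ℝ, ContDiff ℝ ∞ h ∧ (∀ x ∈ L, |h x - H x| ≤ τ) ∧
      ∀ x ∈ K, 0 < fderiv ℝ h x (v x) := by
  borelize E
  let μ : Measure E := Measure.addHaar
  -- uniform rate of increase
  obtain ⟨ρ₁, hρ₁, hinc⟩ : ∃ ρ > 0, ∀ x ∈ K, ∀ s : E, ‖s‖ < ρ → ∀ t : ℝ, 0 < t → t < ρ →
      H (x - s) + ρ * t ≤ H (x - s + t • v x) := by
    have key : ∀ x ∈ K, ∃ U ∈ 𝓝[K] x, ∃ ρ > 0, ∀ y ∈ U, ∀ s : E, ‖s‖ < ρ → ∀ t : ℝ, 0 < t → t < ρ →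
        H (y - s) + ρ * t ≤ H (y - s + t • v y) := by
      intro x hx
      obtain ⟨η, hη, c, hc, h⟩ := hv x hx
      have h1 : ∀ᶠ y in 𝓝 x, ‖v y - v x‖ < η := by
        have := hvc.continuousAt (x := x) (ball_mem_nhds (v x) hη)
        filter_upwards [this] with y hy
        rwa [mem_preimage, mem_ball, dist_eq_norm] at hy
      have h2 : ∀ᶠ y in 𝓝 x, ‖y - x‖ < η / 2 := by
        filter_upwards [ball_mem_nhds x (half_pos hη)] with y hy
        rwa [mem_ball, dist_eq_norm] at hy
      refine ⟨_, mem_nhdsWithin_of_mem_nhds (h1.and h2), Min.min c (η / 2), by positivity, ?_⟩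
      rintro y ⟨hy1, hy2⟩ s hs t ht htρ
      have l1 := min_le_left c (η / 2)
      have l2 := min_le_right c (η / 2)
      have := h (y - s) (by
        calc ‖y - s - x‖ = ‖(y - x) - s‖ := by congr 1; abel
          _ ≤ ‖y - x‖ + ‖s‖ := norm_sub_le _ _
          _ < η := by linarith) (v y) hy1 t ht (by linarith)
      have : Min.min c (η / 2) * t ≤ c * t := by gcongr
      linarith
    choose! U hU ρ hρ hUρ using key
    obtain ⟨T, hTK⟩ := hK.elim_nhdsWithin_subcover' (fun x _ => U x) (fun x hx => hU x hx)
    rcases T.eq_empty_or_nonempty with rfl | hTne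
    · refine ⟨1, one_pos, fun x hx => ?_⟩
      exact absurd (hTK hx) (by simp)
    refine ⟨T.inf' hTne (fun x => ρ x), by simpa [Finset.lt_inf'_iff] using fun a ha _ => hρ a ha, ?_⟩
    intro x hx s hs t ht htρ
    obtain ⟨a, haT, hxa⟩ := mem_iUnion₂.1 (hTK hx)
    have hle : T.inf' hTne (fun x => ρ x) ≤ ρ a := Finset.inf'_le _ haT
    have := hUρ a a.2 x hxa s (by linarith) t ht (by linarith)
    have : T.inf' hTne (fun x => ρ x) * t ≤ ρ a * t := by gcongr
    linarith
  -- uniform continuity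
  obtain ⟨ρ₂, hρ₂, hcont⟩ : ∃ ρ > 0, ∀ x ∈ L, ∀ y ∈ ball x ρ, dist (H y) (H x) ≤ τ := by
    have hu := (hL.cthickening (r := 1)).uniformContinuousOn_of_continuous hH.continuousOn
    obtain ⟨ρ, hρ, h⟩ := Metric.uniformContinuousOn_iff.1 hu τ hτ
    refine ⟨Min.min ρ 1, by positivity, fun x hx y hy => ?_⟩
    rw [mem_ball] at hy
    refine (h y ?_ x ?_ (hy.trans_le (min_le_left _ _))).le
    · exact mem_cthickening_of_dist_le y x 1 L hx (hy.le.trans (min_le_right _ _))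
    · exact self_subset_cthickening L hx
  set ρ := Min.min ρ₁ ρ₂ with hρ
  have hρ0 : 0 < ρ := lt_min hρ₁ hρ₂
  -- The support is so small that every translate `H (· - s)` in the average increases along the
  -- frozen vector `v x` at rate `ρ₁`, and differs from `H` by at most `τ` on `L`.
  let φ : ContDiffBump (0 : E) := ⟨ρ / 2, ρ, half_pos hρ0, half_lt_self hρ0⟩
  let h : E → ℝ := MeasureTheory.convolution (φ.normed μ) H (ContinuousLinearMap.lsmul ℝ ℝ) μ
  have hsm : ContDiff ℝ ∞ h :=
    φ.hasCompactSupport_normed.contDiff_convolution_left _ φ.contDiff_normed hH.locallyIntegrable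
  have hform : ∀ x, h x = ∫ s, φ.normed μ s * H (x - s) ∂μ := fun x => rfl
  have hint : ∀ x, Integrable (fun s => φ.normed μ s * H (x - s)) μ := fun x =>
    Continuous.integrable_of_hasCompactSupport
      (φ.continuous_normed.mul (hH.comp (by fun_prop))) φ.hasCompactSupport_normed.mul_right
  refine ⟨h, hsm, fun x hx => ?_, fun x hx => ?_⟩
  · rw [← Real.dist_eq]
    refine φ.dist_normed_convolution_le hH.aestronglyMeasurable fun y hy => hcont x hx y ?_
    exact ball_subset_ball (min_le_right _ _) hy
  · have hstep : ∀ t : ℝ, 0 < t → t < ρ₁ → h x + ρ₁ * t ≤ h (x + t • v x) := by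
      intro t ht htρ
      have e1 : h x + ρ₁ * t = ∫ s, φ.normed μ s * (H (x - s) + ρ₁ * t) ∂μ := by
        simp_rw [mul_add]
        rw [integral_add (hint x) (φ.integrable_normed.mul_const _), integral_mul_const,
          φ.integral_normed, one_mul, hform]
      rw [e1, hform]
      refine integral_mono ?_ (hint _) fun s => ?_
      · simp_rw [mul_add]
        exact (hint x).add (φ.integrable_normed.mul_const _)
      · by_cases hs : s ∈ Function.support (φ.normed μ)
        · rw [φ.support_normed_eq, mem_ball_zero_iff] at hs
          have := hinc x hx s (hs.trans_le (min_le_left _ _)) t ht htρ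
          have e2 : x + t • v x - s = x - s + t • v x := by abel
          dsimp only
          rw [e2]
          exact mul_le_mul_of_nonneg_left this (φ.nonneg_normed s)
        · rw [Function.notMem_support] at hs
          simp [hs]
    have hd : HasDerivAt (fun t : ℝ => h (x + t • v x)) (fderiv ℝ h x (v x)) 0 := by
      have h1 : HasFDerivAt h (fderiv ℝ h x) (x + (0 : ℝ) • v x) := by
        simpa using (hsm.differentiable (by simp) x).hasFDerivAt
      have h2 : HasDerivAt (fun t : ℝ => x + t • v x) (v x) 0 := by
        simpa using ((hasDerivAt_id (0 : ℝ)).smul_const (v x)).const_add x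
      exact h1.comp_hasDerivAt (0 : ℝ) h2
    have hge : ρ₁ ≤ fderiv ℝ h x (v x) := by
      have hlim := (hasDerivAt_iff_tendsto_slope_zero.1 hd).mono_left
        
        (nhdsWithin_mono (0 : ℝ) (s := Ioi 0) (t := {0}ᶜ) fun t ht => ne_of_gt ht)
      refine ge_of_tendsto hlim ?_
      filter_upwards [Ioo_mem_nhdsGT hρ₁] with t ht
      have := hstep t ht.1 ht.2
      simp only [zero_add, zero_smul, add_zero, smul_eq_mul]
      rw [inv_mul_eq_div, le_div_iff₀ ht.1]
      linarith
    linarith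

/-- A vector field pointing into two nested domains along which a boundary function of the smaller
one increases wherever it is nonpositive shows that the domains agree after smoothing corners. -/
theorem diffeomorphicUpToCorners_of_increasing {X Y : Set E} (hX : IsCompact X) (hYX : Y ⊆ X)
    {H : E → ℝ} (hH : Continuous H) (hY : Y = {z | 0 ≤ H z})
    (hloc : ∀ z ∈ X, ∃ w, PointsInto X z w ∧ (H z ≤ 0 → IncreasesAlong H z w)) :
    DiffeomorphicUpToCorners X Y := by
  classical
  -- The fibrewise conditions are convex, and a constant vector that satisfies them at a point
  -- satisfies them nearby. Off `X`, which is closed, and for the increase also where `H > 0`, they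
  -- are void.
  obtain ⟨v, hv⟩ := exists_contMDiffMap_forall_mem_convex_of_local_const (n := ⊤)
    (modelWithCornersSelf ℝ E) (F := E)
    (t := fun z => {w | z ∈ X → PointsInto X z w ∧ (H z ≤ 0 → IncreasesAlong H z w)})
    (fun z => by
      by_cases hz : z ∈ X
      · by_cases h0 : H z ≤ 0
        · convert! (PointsInto.convex X z).inter (IncreasesAlong.convex H z) using 1
          ext w
          simp [hz, h0]
        · simpa [hz, h0] using PointsInto.convex X z
      · simpa [hz] using convex_univ)
    (fun z => by
      by_cases hz : z ∈ X
      · obtain ⟨w, hw1, hw2⟩ := hloc z hz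
        refine ⟨w, ?_⟩
        have h1 : ∀ᶠ y in 𝓝 z, PointsInto X y w :=
          (Continuous.continuousAt (f := fun y : E => (y, w)) (by fun_prop)).eventually hw1.eventually
        have h2 : ∀ᶠ y in 𝓝 z, H y ≤ 0 → IncreasesAlong H y w := by
          by_cases h0 : H z ≤ 0
          · have := (Continuous.continuousAt (x := z) (f := fun y : E => (y, w))
              (by fun_prop)).eventually (hw2 h0).eventually
            filter_upwards [this] with y hy _ using hy
          · filter_upwards [hH.continuousAt.eventually (lt_mem_nhds (not_le.1 h0))] with y hy hy'
            exact absurd hy' (not_le.2 hy)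
        filter_upwards [h1, h2] with y hy1 hy2 _ using ⟨hy1, hy2⟩
      · refine ⟨0, ?_⟩
        filter_upwards [hX.isClosed.isOpen_compl.mem_nhds hz] with y hy hy'
        exact absurd hy' hy)
  have hvs : ContDiff ℝ ∞ v := v.contMDiff.contDiff
  have hvc : Continuous v := hvs.continuous
  -- the function increases slightly beyond its zero set
  obtain ⟨η, hη, hinc⟩ : ∃ η > 0, ∀ z ∈ X, H z ≤ η → IncreasesAlong H z (v z) := by
    have hO : IsOpen {z | IncreasesAlong H z (v z)} := by
      rw [isOpen_iff_mem_nhds]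
      intro z hz
      exact (Continuous.continuousAt (f := fun y : E => (y, v y)) (by fun_prop)).eventually
        (IncreasesAlong.eventually hz)
    have hC : IsCompact (X \ {z | IncreasesAlong H z (v z)}) := hX.diff hO
    rcases (X \ {z | IncreasesAlong H z (v z)}).eq_empty_or_nonempty with he | hne
    · refine ⟨1, one_pos, fun z hz _ => ?_⟩
      by_contra hcon
      have : z ∈ X \ {z | IncreasesAlong H z (v z)} := ⟨hz, hcon⟩
      simp [he] at this
    · obtain ⟨z₀, hz₀, hmin⟩ := hC.exists_isMinOn hne hH.continuousOn
      have hpos : 0 < H z₀ := by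
        by_contra! hcon
        exact hz₀.2 ((hv z₀ hz₀.1).2 hcon)
      refine ⟨H z₀ / 2, half_pos hpos, fun z hz hzη => ?_⟩
      by_contra hcon
      have : H z₀ ≤ H z := hmin (show z ∈ X \ {z | IncreasesAlong H z (v z)} from ⟨hz, hcon⟩)
      linarith
  -- With error `η / 4` and cut at `η / 2`: `h ≤ η / 2` forces `H ≤ 3 * η / 4`, where `H` increases
  -- along `v`; `H ≤ 0` forces `h ≤ η / 4`; and `h ≥ η / 2` forces `H > 0`. Hence the cut misses
  -- both boundaries and gives the same set in `X` and in `Y`.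
  obtain ⟨h, hsm, happ, hder⟩ := exists_smooth_increasing hH
    (K := X ∩ {z | H z ≤ η}) (hX.inter_right (isClosed_le hH continuous_const))
    (fun z hz => hinc z hz.1 hz.2) hvc (τ := η / 4) (by positivity) hX
  have hint : {z | 0 < H z} ⊆ interior Y :=
    interior_maximal (by rw [hY]; exact fun z (hz : 0 < H z) => hz.le)
      (isOpen_lt continuous_const hH)
  have hYc : IsClosed Y := by rw [hY]; exact isClosed_le continuous_const hH
  have hYcomp : IsCompact Y := hX.of_isClosed_subset hYc hYX
  have hφs : ContDiff ℝ ∞ (fun z => η / 2 - h z) := contDiff_const.sub hsm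
  have hφd : ∀ z ∈ X, 0 ≤ η / 2 - h z → fderiv ℝ (fun z => η / 2 - h z) z (v z) < 0 := by
    intro z hz h0
    have h1 := (abs_le.1 (happ z hz)).1
    have h2 := hder z ⟨hz, by simp only [mem_ofPred_eq]; linarith⟩
    rw [fderiv_const_sub]
    simpa using h2
  have hφp : ∀ z ∈ X, z ∉ interior Y → H z ≤ 0 ∧ 0 < η / 2 - h z := by
    intro z hz hzY
    have h0 : H z ≤ 0 := by
      by_contra! hcon
      exact hzY (hint hcon)
    have h1 := (abs_le.1 (happ z hz)).2
    exact ⟨h0, by linarith⟩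
  have hXY : {z ∈ X | η / 2 - h z ≤ 0} = {z ∈ Y | η / 2 - h z ≤ 0} := by
    ext z
    refine ⟨fun hz => ⟨?_, hz.2⟩, fun hz => ⟨hYX hz.1, hz.2⟩⟩
    by_contra hcon
    have := (hφp z hz.1 (fun hi => hcon (interior_subset hi))).2
    linarith [hz.2]
  refine ⟨{z ∈ X | η / 2 - h z ≤ 0}, {z ∈ Y | η / 2 - h z ≤ 0}, ⟨hX, v, _, hvs, hφs, ?_, hφd, rfl⟩,
    ⟨hYcomp, v, _, hvs, hφs, ?_, fun z hz => hφd z (hYX hz), rfl⟩, ?_⟩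
  · intro z hz
    have hzX : z ∈ X := hX.isClosed.frontier_subset hz
    refine ⟨(hv z hzX).1, (hφp z hzX fun hi => ?_).2⟩
    exact hz.2 (interior_mono hYX hi)
  · intro z hz
    have hzY : z ∈ Y := hYc.frontier_subset hz
    have hzp := hφp z (hYX hzY) hz.2
    refine ⟨?_, hzp.2⟩
    rw [hY]
    exact ((hv z (hYX hzY)).2 hzp.1).pointsInto 0
  · rw [hXY]
    exact ⟨id, id, contDiffOn_id, contDiffOn_id, mapsTo_id _, mapsTo_id _, fun _ _ => rfl,
      fun _ _ => rfl⟩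

end Smoothing
end PlaneCurve

namespace PlaneCurve

open Filter Topology Metric Set

/-! ### The polynomial as a function of two variables and as a family of polynomials in `y`. -/

section Value

variable (f : MvPolynomial (Fin 2) ℂ)

theorem eval_fibrePoly (x y : ℂ) : (fibrePoly f x).eval y = value f x y := by
  induction f using MvPolynomial.induction_on with
  | C a => simp [fibrePoly, value]
  | add p q hp hq => simp_all [fibrePoly, value]
  | mul_X p i hp => fin_cases i <;> simp_all [fibrePoly, value]

theorem differentiable_coeff_fibrePoly (k : ℕ) :
    Differentiable ℂ (fun x => (fibrePoly f x).coeff k) := by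
  induction f using MvPolynomial.induction_on generalizing k with
  | C a => simp [fibrePoly]
  | add p q hp hq =>
    have e : (fun x => (fibrePoly (p + q) x).coeff k)
        = fun x => (fibrePoly p x).coeff k + (fibrePoly q x).coeff k := by
      funext x; simp [fibrePoly]
    rw [e]
    exact (hp k).add (hq k)
  | mul_X p i hp =>
    fin_cases i
    · have e : (fun x => (fibrePoly (p * MvPolynomial.X 0) x).coeff k)
          = fun x => (fibrePoly p x).coeff k * x := by
        funext x; simp [fibrePoly]
      exact e ▸ (hp k).mul differentiable_id
    · cases k with
      | zero =>
        have e : (fun x => (fibrePoly (p * MvPolynomial.X 1) x).coeff 0) = fun x => 0 := by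
          funext x; simp [fibrePoly]
        exact e ▸ differentiable_const _
      | succ k =>
        have e : (fun x => (fibrePoly (p * MvPolynomial.X 1) x).coeff (k + 1))
            = fun x => (fibrePoly p x).coeff k := by
          funext x; simp [fibrePoly]
        exact e ▸ hp k

theorem hasStrictFDerivAt_value (z : ℂ × ℂ) :
    HasStrictFDerivAt (fun z : ℂ × ℂ => value f z.1 z.2)
      (value (MvPolynomial.pderiv 0 f) z.1 z.2 • ContinuousLinearMap.fst ℂ ℂ ℂ +
        value (MvPolynomial.pderiv 1 f) z.1 z.2 • ContinuousLinearMap.snd ℂ ℂ ℂ) z := by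
  induction f using MvPolynomial.induction_on with
  | C a =>
    refine ((hasStrictFDerivAt_const (𝕜 := ℂ) a z).congr_fderiv
      ?_).congr_of_eventuallyEq (Eventually.of_forall fun w => ?_)
    · ext <;> simp [value]
    · simp [value]
  | add p q hp hq =>
    refine ((hp.add hq).congr_fderiv ?_).congr_of_eventuallyEq (Eventually.of_forall fun w => ?_)
    · ext <;> simp [value]
    · simp [value]
  | mul_X p i hp =>
    fin_cases i
    · refine ((hp.mul (hasStrictFDerivAt_fst (𝕜 := ℂ) (p := z))).congr_fderiv
        ?_).congr_of_eventuallyEq (Eventually.of_forall fun w => ?_)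
      · ext <;> simp [value, MvPolynomial.pderiv_X, Derivation.leibniz]
      · simp [value]
    · refine ((hp.mul (hasStrictFDerivAt_snd (𝕜 := ℂ) (p := z))).congr_fderiv
        ?_).congr_of_eventuallyEq (Eventually.of_forall fun w => ?_)
      · ext <;> simp [value, MvPolynomial.pderiv_X, Derivation.leibniz]
      · simp [value]

theorem contDiff_value : ContDiff ℝ ∞ (fun z : ℂ × ℂ => value f z.1 z.2) := by
  induction f using MvPolynomial.induction_on with
  | C a => simpa [value] using contDiff_const
  | add p q hp hq => simpa [value] using hp.add hq
  | mul_X p i hp =>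
    fin_cases i
    · simpa [value] using hp.mul contDiff_fst
    · simpa [value] using hp.mul contDiff_snd

theorem continuous_value : Continuous (fun z : ℂ × ℂ => value f z.1 z.2) :=
  (contDiff_value f).continuous

/-- Both sides are the derivative of the same function of one variable; uniqueness of derivatives
replaces an algebraic comparison. -/
theorem eval_derivative_fibrePoly (x y : ℂ) :
    (fibrePoly f x).derivative.eval y = value (MvPolynomial.pderiv 1 f) x y := by
  have h1 : HasDerivAt (fun w => value f x w) (value (MvPolynomial.pderiv 1 f) x y) y := by
    have := ((hasStrictFDerivAt_value f (x, y)).hasFDerivAt.comp_hasDerivAt y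
      ((hasDerivAt_const y x).prodMk (hasDerivAt_id y)))
    refine (this.congr_deriv ?_).congr_of_eventuallyEq (Eventually.of_forall fun w => rfl)
    simp
  have h2 := (fibrePoly f x).hasDerivAt y
  simp_rw [eval_fibrePoly] at h2
  exact h2.unique h1

end Value

/-! ### The curve as a covering of the base away from the special values. -/

section Cover

variable (f : MvPolynomial (Fin 2) ℂ)

/-- Points of the curve over a compact set have bounded ordinates. -/
theorem exists_bound_roots {n : ℕ} (hn : ∀ x, (fibrePoly f x).natDegree = n)
    (h0 : ∀ x, fibrePoly f x ≠ 0) {K : Set ℂ} (hK : IsCompact K) :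
    ∃ B : ℝ, ∀ x ∈ K, ∀ y, value f x y = 0 → ‖y‖ ≤ B := by
  have hlc : ∀ x, (fibrePoly f x).coeff n ≠ 0 := fun x => by
    have := h0 x
    rw [← hn x]
    simpa using this
  have hcont : ∀ k, Continuous fun x => (fibrePoly f x).coeff k := fun k =>
    (differentiable_coeff_fibrePoly f k).continuous
  -- Constant degree means that the leading coefficient never vanishes, so the Cauchy bound of the
  -- roots depends continuously on the base point.
  have hc : Continuous fun x => (Polynomial.cauchyBound (fibrePoly f x) : ℝ) := by
    have e : (fun x => (Polynomial.cauchyBound (fibrePoly f x) : ℝ)) = fun x =>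
        (((Finset.range n).sup (fun k => ‖(fibrePoly f x).coeff k‖₊) /
          ‖(fibrePoly f x).coeff n‖₊ + 1 : NNReal) : ℝ) := by
      funext x
      rw [Polynomial.cauchyBound, Polynomial.leadingCoeff, hn x]
    rw [e]
    refine NNReal.continuous_coe.comp (Continuous.add (Continuous.div₀ ?_ ?_ ?_) continuous_const)
    · exact Continuous.finset_sup_apply fun k _ => (hcont k).nnnorm
    · exact (hcont n).nnnorm
    · intro x
      simpa using hlc x
  obtain ⟨B, hB⟩ := hK.bddAbove_image hc.continuousOn
  refine ⟨B, fun x hx y hy => ?_⟩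
  have hroot : (fibrePoly f x).IsRoot y := by rwa [Polynomial.IsRoot, eval_fibrePoly]
  have h1 := hroot.norm_lt_cauchyBound (h0 x)
  have h2 := hB ⟨x, hx, rfl⟩
  have h3 : ‖y‖ < (Polynomial.cauchyBound (fibrePoly f x) : ℝ) := by exact_mod_cast h1
  dsimp only at h2
  linarith

/-- Away from special points, the curve is locally the graph of a holomorphic function. -/
theorem exists_local_graph {x₀ y₀ : ℂ} (h : value f x₀ y₀ = 0)
    (h' : value (MvPolynomial.pderiv 1 f) x₀ y₀ ≠ 0) :
    ∃ ψ : ℂ → ℂ, DifferentiableAt ℂ ψ x₀ ∧ Tendsto ψ (𝓝 x₀) (𝓝 y₀) ∧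
      (∀ᶠ z : ℂ × ℂ in 𝓝 (x₀, y₀), value f z.1 z.2 = 0 ↔ ψ z.1 = z.2) ∧
      ∀ᶠ x in 𝓝 x₀, value f x (ψ x) = 0 := by
  have hs := hasStrictFDerivAt_value f (x₀, y₀)
  have hi : ((value (MvPolynomial.pderiv 0 f) x₀ y₀ • ContinuousLinearMap.fst ℂ ℂ ℂ +
        value (MvPolynomial.pderiv 1 f) x₀ y₀ • ContinuousLinearMap.snd ℂ ℂ ℂ) ∘L
        .inr ℂ ℂ ℂ).IsInvertible := by
    refine ⟨ContinuousLinearEquiv.unitsEquivAut ℂ (Units.mk0 _ h'), ?_⟩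
    ext
    simp
  refine ⟨hs.implicitFunctionOfProdDomain hi,
    (hs.hasStrictFDerivAt_implicitFunctionOfProdDomain hi).hasFDerivAt.differentiableAt,
    hs.tendsto_implicitFunctionOfProdDomain hi, ?_, ?_⟩
  · filter_upwards [hs.eventually_apply_eq_iff_implicitFunctionOfProdDomain hi] with z hz
    rw [← hz]
    simp [h]
  · filter_upwards [hs.eventually_apply_implicitFunctionOfProdDomain hi] with z hz
    rw [hz]
    simp [h]

/-- The projection of the curve to the base is a covering away from the special values. -/
theorem isCoveringMapOn_curve {n : ℕ} (hn : ∀ x, (fibrePoly f x).natDegree = n)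
    (h0 : ∀ x, fibrePoly f x ≠ 0) :
    IsCoveringMapOn (fun e : {z : ℂ × ℂ // value f z.1 z.2 = 0} => e.1.1) (specialValues f)ᶜ := by
  have hcont : Continuous (fun e : {z : ℂ × ℂ // value f z.1 z.2 = 0} => e.1.1) := by fun_prop
  -- Roots stay bounded over compact sets, so the projection is proper and hence closed. A closed
  -- local homeomorphism with finite fibres is a covering.
  have hclosed : IsClosedMap (fun e : {z : ℂ × ℂ // value f z.1 z.2 = 0} => e.1.1) := by
    refine (isProperMap_iff_isCompact_preimage.2 ⟨hcont, fun K hK => ?_⟩).isClosedMap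
    obtain ⟨B, hB⟩ := exists_bound_roots f hn h0 hK
    rw [Subtype.isCompact_iff]
    have hC : IsCompact ((K ×ˢ closedBall (0 : ℂ) B) ∩ {z | value f z.1 z.2 = 0}) :=
      (hK.prod (isCompact_closedBall _ _)).inter_right
        (isClosed_eq (continuous_value f) continuous_const)
    convert! hC using 1
    ext z
    constructor
    · rintro ⟨e, he, rfl⟩
      exact ⟨⟨he, mem_closedBall_zero_iff.2 (hB _ he _ e.2)⟩, e.2⟩
    · rintro ⟨⟨h1, h2⟩, h3⟩
      exact ⟨⟨z, h3⟩, h1, rfl⟩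
  refine hclosed.isCoveringMapOn_of_isLocalHomeomorphOn (fun x _ => ?_) ?_
  · have hfin : {y | value f x y = 0}.Finite := by
      refine ((fibrePoly f x).roots.toFinset.finite_toSet).subset fun y hy => ?_
      simp only [Finset.mem_coe, Multiset.mem_toFinset]
      rw [Polynomial.mem_roots (h0 x), Polynomial.IsRoot, eval_fibrePoly]
      exact hy
    refine Finite.of_finite_image (f := fun e => e.1.2) (hfin.subset ?_) ?_
    · rintro y ⟨e, he, rfl⟩
      have h1 : e.1.1 = x := he
      simpa [← h1] using e.2
    · rintro e he e' he' h
      exact Subtype.ext (Prod.ext (he.trans (Eq.symm he')) h)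
  · -- local homeomorphism
    have key : ∀ e : {z : ℂ × ℂ // value f z.1 z.2 = 0}, e.1.1 ∉ specialValues f →
        ∃ U : Set {z : ℂ × ℂ // value f z.1 z.2 = 0}, IsOpen U ∧ e ∈ U ∧
          InjOn (fun e : {z : ℂ × ℂ // value f z.1 z.2 = 0} => e.1.1) U ∧
          ∀ a ∈ U, 𝓝 a.1.1 ≤ map (fun e : {z : ℂ × ℂ // value f z.1 z.2 = 0} => e.1.1) (𝓝 a) := by
      -- The local graph at `e` gives injectivity on a neighbourhood; openness at each nearby point
      -- `a` uses the local graph through `a` itself.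
      intro e he
      have hd : ∀ᶠ z in 𝓝 e.1, value (MvPolynomial.pderiv 1 f) z.1 z.2 ≠ 0 :=
        (continuous_value _).continuousAt.eventually_ne fun h => he ⟨e.1.2, e.2, h⟩
      obtain ⟨ψ, -, -, hψ, -⟩ := exists_local_graph f e.2 hd.self_of_nhds
      obtain ⟨N, hN, hNo, heN⟩ := _root_.eventually_nhds_iff.1 (hψ.and hd)
      refine ⟨Subtype.val ⁻¹' N, hNo.preimage continuous_subtype_val, heN, ?_, ?_⟩
      · intro a ha b hb hab
        have h1 := (hN _ ha).1.1 a.2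
        have h2 := (hN _ hb).1.1 b.2
        have hab' : a.1.1 = b.1.1 := hab
        exact Subtype.ext (Prod.ext hab' (by rw [← h1, ← h2, hab']))
      · intro a ha S hS
        obtain ⟨χ, -, hχt, -, hχ⟩ := exists_local_graph f a.2 (hN _ ha).2
        rw [mem_map, nhds_subtype_eq_comap, mem_comap] at hS
        obtain ⟨W, hW, hWS⟩ := hS
        have h1 : Tendsto (fun x => (x, χ x)) (𝓝 a.1.1) (𝓝 (a.1.1, a.1.2)) :=
          tendsto_id.prodMk_nhds hχt
        filter_upwards [h1 hW, hχ] with x hx1 hx2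
        exact @hWS ⟨(x, χ x), hx2⟩ hx1
    refine (isLocalHomeomorphOn_iff_isOpenEmbedding_restrict _).2 fun e he => ?_
    obtain ⟨U, hUo, heU, hinj, hopen⟩ := key e he
    have hemb : IsOpenEmbedding (U.domRestrict
        (fun e : {z : ℂ × ℂ // value f z.1 z.2 = 0} => e.1.1)) := by
      refine IsOpenEmbedding.of_continuous_injective_isOpenMap (hcont.comp continuous_subtype_val)
        (injOn_iff_injective.1 hinj) (isOpenMap_iff_nhds_le.2 fun a => ?_)
      have h1 := hopen a.1 a.2
      have h2 : map (U.domRestrict (fun e : {z : ℂ × ℂ // value f z.1 z.2 = 0} => e.1.1)) (𝓝 a)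
          = map (fun e : {z : ℂ × ℂ // value f z.1 z.2 = 0} => e.1.1) (𝓝 a.1) := by
        rw [show U.domRestrict (fun e : {z : ℂ × ℂ // value f z.1 z.2 = 0} => e.1.1)
          = (fun e : {z : ℂ × ℂ // value f z.1 z.2 = 0} => e.1.1) ∘ Subtype.val from rfl,
          ← Filter.map_map, map_nhds_subtype_coe_eq_nhds a.2 (hUo.mem_nhds a.2)]
      rw [h2]
      exact h1
    exact ⟨U, hUo.mem_nhds heU, hemb⟩

end Cover
end PlaneCurve

namespace PlaneCurve

open Filter Topology Metric Set

/-! ### Factorization over a non-special value. -/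

section Roots

variable {f : MvPolynomial (Fin 2) ℂ} {n : ℕ}

theorem nodup_roots_fibrePoly (h0 : ∀ x, fibrePoly f x ≠ 0) {x : ℂ} (hx : x ∉ specialValues f) :
    (fibrePoly f x).roots.Nodup := by
  rw [Multiset.nodup_iff_count_le_one]
  intro y
  rw [Polynomial.count_roots]
  by_contra! hcon
  obtain ⟨h1, h2⟩ := (Polynomial.one_lt_rootMultiplicity_iff_isRoot (h0 x)).1 hcon
  rw [Polynomial.IsRoot, eval_fibrePoly] at h1
  rw [Polynomial.IsRoot, eval_derivative_fibrePoly] at h2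
  exact hx ⟨y, h1, h2⟩

theorem exists_roots_fibrePoly (hn : ∀ x, (fibrePoly f x).natDegree = n)
    (h0 : ∀ x, fibrePoly f x ≠ 0) {x : ℂ} (hx : x ∉ specialValues f) :
    ∃ y : Fin n → ℂ, Function.Injective y ∧ ∀ j, value f x (y j) = 0 := by
  classical
  have hcard : (fibrePoly f x).roots.toFinset.card = n := by
    rw [Multiset.toFinset_card_of_nodup (nodup_roots_fibrePoly h0 hx), ← hn x]
    exact (Polynomial.splits_iff_card_roots.1 (IsAlgClosed.splits _))
  let e := (Finset.equivFinOfCardEq hcard).symm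
  refine ⟨fun j => e j, fun i j hij => e.injective (Subtype.ext hij), fun j => ?_⟩
  have h1 := (e j).2
  rw [Multiset.mem_toFinset, Polynomial.mem_roots (h0 x), Polynomial.IsRoot, eval_fibrePoly] at h1
  exact h1

/-- Distinct roots, as many as the degree, exhaust the multiset of roots. -/
theorem value_eq_prod (hn : ∀ x, (fibrePoly f x).natDegree = n) (h0 : ∀ x, fibrePoly f x ≠ 0)
    {x : ℂ} {y : Fin n → ℂ} (hy : Function.Injective y)
    (hroot : ∀ j, value f x (y j) = 0) (w : ℂ) :
    value f x w = (fibrePoly f x).coeff n * ∏ j, (w - y j) := by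
  classical
  have hle : Finset.univ.val.map y ≤ (fibrePoly f x).roots := by
    rw [Multiset.le_iff_subset (Finset.univ.nodup.map hy)]
    intro a ha
    obtain ⟨j, -, rfl⟩ := Multiset.mem_map.1 ha
    rw [Polynomial.mem_roots (h0 x), Polynomial.IsRoot, eval_fibrePoly]
    exact hroot j
  have hcard : Multiset.card (fibrePoly f x).roots = (fibrePoly f x).natDegree :=
    Polynomial.splits_iff_card_roots.1 (IsAlgClosed.splits _)
  have heq : Finset.univ.val.map y = (fibrePoly f x).roots := by
    refine Multiset.eq_of_le_of_card_le hle ?_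
    rw [hcard, hn x]
    simp
  have h1 := Polynomial.C_leadingCoeff_mul_prod_multiset_X_sub_C hcard
  have hlc : (fibrePoly f x).leadingCoeff = (fibrePoly f x).coeff n := by
    rw [Polynomial.leadingCoeff, hn]
  rw [← eval_fibrePoly, ← hlc]
  conv_lhs => rw [← h1, ← heq]
  rw [Multiset.map_map, show (Finset.univ.val.map ((fun a => Polynomial.X - Polynomial.C a) ∘ y)).prod
    = ∏ j, (Polynomial.X - Polynomial.C (y j)) from rfl, Polynomial.eval_mul, Polynomial.eval_prod]
  simp

end Roots

/-! ### Puiseux parametrization of all roots near a special value. -/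

section Puiseux

open Complex UpperHalfPlane Function.Periodic

variable (f : MvPolynomial (Fin 2) ℂ) {n : ℕ}

/-- Near a special value, the roots of the fibre polynomial are holomorphic functions of a root of
the parameter. -/
theorem exists_puiseux (hn : ∀ x, (fibrePoly f x).natDegree = n) (h0 : ∀ x, fibrePoly f x ≠ 0)
    {p : ℂ} {ρ : ℝ} (hρ : 0 < ρ) (hp : ∀ x, x ≠ p → ‖x - p‖ < ρ → x ∉ specialValues f) :
    ∃ (M : ℕ) (Y : Fin n → ℂ → ℂ), 0 < M ∧ (∀ j, AnalyticAt ℂ (Y j) 0) ∧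
      (∀ᶠ t in 𝓝 (0 : ℂ), ∀ w, value f (p + ρ * t ^ M) w
        = (fibrePoly f (p + ρ * t ^ M)).coeff n * ∏ j, (w - Y j t)) ∧
      ∀ᶠ t in 𝓝[≠] (0 : ℂ), Function.Injective fun j => Y j t := by
  classical
  -- the base map
  let β : ℂ → ℂ := fun z => p + ρ * qParam 1 z
  have hβc : Continuous β := by
    have := (Function.Periodic.continuous_qParam (h := 1))
    fun_prop
  have hβd : Differentiable ℂ β := by
    have := (Function.Periodic.differentiable_qParam (h := 1))
    fun_prop
  have hβ1 : ∀ z, β (z + 1) = β z := by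
    intro z
    simp only [β, Function.Periodic.qParam]
    congr 2
    rw [show 2 * Real.pi * Complex.I * (z + 1) / (1 : ℝ) = 2 * Real.pi * Complex.I * z / (1 : ℝ) + 2 * Real.pi * Complex.I by
      push_cast; ring, Complex.exp_periodic]
  have hβρ : ∀ z : ℂ, 0 < z.im → β z ≠ p ∧ ‖β z - p‖ < ρ := by
    intro z hz
    constructor
    · simp [β, hρ.ne', Function.Periodic.qParam_ne_zero]
    · simp only [β, add_sub_cancel_left, norm_mul, norm_real, Real.norm_of_nonneg hρ.le]
      have := Function.Periodic.norm_qParam_lt_one (h := 1) one_pos hz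
      nlinarith
  have hβs : ∀ z : ℂ, 0 < z.im → β z ∉ specialValues f := fun z hz =>
    hp _ (hβρ z hz).1 (hβρ z hz).2
  have cov := isCoveringMapOn_curve f hn h0
  let b : C(ℍ, ℂ) := ⟨fun z => β z, hβc.comp UpperHalfPlane.continuous_coe⟩
  -- lifts
  have hlift : ∀ (z₀ : ℍ) (w : ℂ), value f (β z₀) w = 0 → ∃ Y : ℍ → ℂ, Continuous Y ∧ Y z₀ = w ∧
      ∀ z : ℍ, value f (β z) (Y z) = 0 := by
    intro z₀ w hw
    obtain ⟨F, ⟨hF1, hF2⟩, -⟩ := cov.existsUnique_continuousMap_lifts b (a₀ := z₀)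
      (e₀ := ⟨(β z₀, w), hw⟩) rfl (fun z => hβs z z.2)
    refine ⟨fun z => (F z).1.2, by fun_prop, by simp [hF1], fun z => ?_⟩
    have h1 := (F z).2
    have h2 : (F z).1.1 = β z := congrFun hF2 z
    rwa [h2] at h1
  have huniq : ∀ (Y Y' : ℍ → ℂ), Continuous Y → Continuous Y' →
      (∀ z : ℍ, value f (β z) (Y z) = 0) → (∀ z : ℍ, value f (β z) (Y' z) = 0) →
      ∀ z₀, Y z₀ = Y' z₀ → Y = Y' := by
    intro Y Y' hY hY' hr hr' z₀ h
    have hu := cov.existsUnique_continuousMap_lifts b (a₀ := z₀)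
      (e₀ := ⟨(β z₀, Y z₀), hr z₀⟩) rfl (fun z => hβs z z.2)
    have hb : Continuous fun z : ℍ => β z := b.continuous
    have h3 := hu.unique (y₁ := ⟨fun z => ⟨(β z, Y z), hr z⟩, by fun_prop⟩)
      (y₂ := ⟨fun z => ⟨(β z, Y' z), hr' z⟩, by fun_prop⟩) ⟨rfl, rfl⟩
      ⟨by simp [h], rfl⟩
    funext z
    have h4 := congrArg (fun F : C(ℍ, {z : ℂ × ℂ // value f z.1 z.2 = 0}) => (F z).1.2) h3
    exact h4
  obtain ⟨y₀, hy₀i, hy₀r⟩ := exists_roots_fibrePoly hn h0 (hβs UpperHalfPlane.I UpperHalfPlane.I.2)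
  choose Y hYc hY0 hYr using fun j => hlift UpperHalfPlane.I (y₀ j) (hy₀r j)
  have hYi : ∀ z, Function.Injective fun j => Y j z := by
    intro z j k hjk
    have := huniq _ _ (hYc j) (hYc k) (hYr j) (hYr k) z hjk
    apply hy₀i
    rw [← hY0 j, ← hY0 k, this]
  -- monodromy
  let sh : ℍ → ℍ := fun z => ⟨z + 1, by simpa using z.2⟩
  have hsh : Continuous sh := by
    refine UpperHalfPlane.isEmbedding_coe.continuous_iff.2 ?_
    exact UpperHalfPlane.continuous_coe.add continuous_const
  -- The translation `sh` is one turn around `p`. A branch followed along it is again a continuous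
  -- choice of roots, so it equals the branch with which it agrees at `UpperHalfPlane.I`.
  have hmono : ∀ j, ∃ k, ∀ z, Y j (sh z) = Y k z := by
    intro j
    have hrs : ∀ z : ℍ, value f (β z) (Y j (sh z)) = 0 := by
      intro z
      rw [← hβ1 z]
      exact hYr j (sh z)
    have h1 := hrs UpperHalfPlane.I
    rw [value_eq_prod hn h0 hy₀i hy₀r, mul_eq_zero, Finset.prod_eq_zero_iff] at h1
    rcases h1 with h1 | ⟨k, -, hk⟩
    · refine absurd h1 ?_
      rw [← hn (β UpperHalfPlane.I), Polynomial.coeff_natDegree]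
      simpa using h0 _
    · refine ⟨k, fun z => ?_⟩
      have := huniq _ _ ((hYc j).comp hsh) (hYc k) hrs (hYr k) UpperHalfPlane.I
        (by rw [hY0]; exact sub_eq_zero.1 hk)
      exact congrFun this z
  choose σ hσ using hmono
  have hσi : Function.Injective σ := by
    intro j k hjk
    refine hYi (sh UpperHalfPlane.I) ?_
    show Y j _ = Y k _
    rw [hσ, hσ, hjk]
  let s : Equiv.Perm (Fin n) := Equiv.ofBijective σ (Finite.injective_iff_bijective.1 hσi)
  have hsm : ∀ (m : ℕ) j z, Y j (sh^[m] z) = Y ((s ^ m) j) z := by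
    intro m
    induction m with
    | zero => simp
    | succ m ih =>
      intro j z
      rw [Function.iterate_succ_apply, ih, pow_succ', Equiv.Perm.mul_apply, hσ]
      rfl
  -- After `M` turns every branch returns to itself, so a single `M`-th root of the parameter serves
  -- all branches at once.
  set M := orderOf s with hM
  have hM0 : 0 < M := orderOf_pos s
  have hper : ∀ j z, Y j (sh^[M] z) = Y j z := by
    intro j z
    rw [hsm, hM, pow_orderOf_eq_one, Equiv.Perm.one_apply]
  have hshm : ∀ (m : ℕ) (z : ℍ), ((sh^[m] z : ℍ) : ℂ) = z + m := by
    intro m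
    induction m with
    | zero => simp
    | succ m ih =>
      intro z
      rw [Function.iterate_succ_apply, ih]
      simp only [sh]
      push_cast
      ring
  -- extension to the plane
  let Ye : Fin n → ℂ → ℂ := fun j z => if h : 0 < z.im then Y j ⟨z, h⟩ else 0
  have hYe : ∀ j (z : ℍ), Ye j z = Y j z := fun j z => by
    simp only [Ye]
    rw [dif_pos z.2]
  have hYep : ∀ j, Function.Periodic (Ye j) ((M : ℝ) : ℂ) := by
    intro j z
    by_cases hz : 0 < z.im
    · have h1 : z + ((M : ℝ) : ℂ) = ((sh^[M] ⟨z, hz⟩ : ℍ) : ℂ) := by rw [hshm]; simp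
      rw [h1, hYe, hper]
      exact (hYe j ⟨z, hz⟩).symm
    · have h1 : ¬ 0 < (z + ((M : ℝ) : ℂ)).im := by simpa using hz
      simp only [Ye]
      rw [dif_neg hz, dif_neg h1]
  -- Near `z` the branch is the holomorphic local graph composed with `β`; continuity ensures that
  -- it stays on this graph.
  have hYed : ∀ j (z : ℂ), 0 < z.im → DifferentiableAt ℂ (Ye j) z := by
    intro j z hz
    have hr := hYr j ⟨z, hz⟩
    have hr' : value (MvPolynomial.pderiv 1 f) (β z) (Y j ⟨z, hz⟩) ≠ 0 :=
      fun h => hβs z hz ⟨_, hr, h⟩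
    obtain ⟨ψ, hψd, -, hψ, -⟩ := exists_local_graph f hr hr'
    have hc : ContinuousAt (Ye j) z := by
      have h1 : ContinuousAt (Ye j ∘ UpperHalfPlane.coe) ⟨z, hz⟩ := by
        have : Ye j ∘ UpperHalfPlane.coe = Y j := funext fun w => hYe j w
        rw [this]
        exact (hYc j).continuousAt
      exact (UpperHalfPlane.isOpenEmbedding_coe.continuousAt_iff).1 h1
    have h2 : Tendsto (fun w => (β w, Ye j w)) (𝓝 z) (𝓝 (β z, Y j ⟨z, hz⟩)) := by
      refine hβc.continuousAt.tendsto.prodMk_nhds ?_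
      have := hc.tendsto
      rwa [show Ye j z = Y j ⟨z, hz⟩ from hYe j ⟨z, hz⟩] at this
    refine (hψd.comp z hβd.differentiableAt).congr_of_eventuallyEq ?_
    have hopen : ∀ᶠ w : ℂ in 𝓝 z, 0 < w.im :=
      Complex.continuous_im.continuousAt.eventually (lt_mem_nhds hz)
    filter_upwards [h2.eventually hψ, hopen] with w hw1 hw2
    refine ((hw1.1 ?_)).symm
    have := hYr j ⟨w, hw2⟩
    rwa [← hYe] at this
  have hMr : (0 : ℝ) < (M : ℝ) := by exact_mod_cast hM0
  have him : ∀ᶠ z : ℂ in comap Complex.im atTop, 0 < z.im :=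
    tendsto_comap.eventually (eventually_gt_atTop 0)
  have hYebd : ∀ j, BoundedAtFilter (comap Complex.im atTop) (Ye j) := by
    intro j
    obtain ⟨B, hB⟩ := exists_bound_roots f hn h0 (isCompact_closedBall p ρ)
    refine Asymptotics.IsBigO.of_bound B ?_
    filter_upwards [him] with z hz
    have h1 := hB (β z) (by rw [mem_closedBall, dist_eq_norm]; exact (hβρ z hz).2.le) _ (hYr j ⟨z, hz⟩)
    rw [← hYe] at h1
    simpa using h1
  have hYeh : ∀ j, ∀ᶠ z in comap Complex.im atTop, DifferentiableAt ℂ (Ye j) z := fun j => by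
    filter_upwards [him] with z hz using hYed j z hz
  -- A bounded periodic holomorphic function on the half-plane descends to the punctured disc, and
  -- its singularity at the origin is removable.
  let y : Fin n → ℂ → ℂ := fun j => cuspFunction M (Ye j)
  have hya : ∀ j, AnalyticAt ℂ (y j) 0 := by
    intro j
    have h1 := eventually_differentiableAt_cuspFunction_nhds_ne_zero hMr (hYep j) (hYeh j)
    have h2 := differentiableAt_cuspFunction_zero hMr (hYep j) (hYeh j) (hYebd j)
    rw [Complex.analyticAt_iff_eventually_differentiableAt]
    rw [eventually_nhdsWithin_iff] at h1
    filter_upwards [h1] with q hq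
    by_cases h : q = 0
    · rw [h]; exact h2
    · exact hq h
  have hpt : ∀ᶠ t : ℂ in 𝓝[≠] 0, ∃ z : ℍ, p + ρ * t ^ M = β z ∧ ∀ j, y j t = Y j z := by
    have h1 : ∀ᶠ t : ℂ in 𝓝[≠] 0, 0 < (invQParam M t).im := (invQParam_tendsto hMr).eventually him
    filter_upwards [h1, self_mem_nhdsWithin] with t ht ht0
    refine ⟨⟨_, ht⟩, ?_, fun j => ?_⟩
    · have h2 := qParam_right_inv hMr.ne' ht0
      have h3 : qParam 1 (invQParam M t) = t ^ M := by
        conv_rhs => rw [← h2]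
        simp only [Function.Periodic.qParam]
        rw [← Complex.exp_nat_mul]
        congr 1
        have : (M : ℂ) ≠ 0 := by exact_mod_cast hM0.ne'
        push_cast
        field_simp
      simp only [β]
      rw [← h3]
    · rw [← hYe]
      exact cuspFunction_eq_of_nonzero _ _ ht0
  refine ⟨M, y, hM0, hya, ?_, ?_⟩
  · have h1 : ∀ᶠ t : ℂ in 𝓝[≠] 0, ∀ w, value f (p + ρ * t ^ M) w
        = (fibrePoly f (p + ρ * t ^ M)).coeff n * ∏ j, (w - y j t) := by
      filter_upwards [hpt] with t ⟨z, hz, hyz⟩ w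
      simp_rw [hz, hyz]
      exact value_eq_prod hn h0 (hYi z) (fun j => hYr j z) w
    -- At `t = 0` roots may coincide, so the factorization is obtained by continuity from `t ≠ 0`.
    have hat0 : ∀ w, value f (p + ρ * 0 ^ M) w
        = (fibrePoly f (p + ρ * 0 ^ M)).coeff n * ∏ j, (w - y j 0) := by
      intro w
      have hc1 : ContinuousAt (fun t : ℂ => value f (p + ρ * t ^ M) w) 0 :=
        ((continuous_value f).comp (by fun_prop : Continuous fun t : ℂ =>
          (p + ρ * t ^ M, w))).continuousAt
      have hc2 : ContinuousAt (fun t : ℂ => (fibrePoly f (p + ρ * t ^ M)).coeff n *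
          ∏ j, (w - y j t)) 0 := by
        refine ContinuousAt.mul ?_ ?_
        · exact ((differentiable_coeff_fibrePoly f n).continuous.comp
            (by fun_prop : Continuous fun t : ℂ => p + ρ * t ^ M)).continuousAt
        · exact tendsto_finsetProd _ fun j _ => (continuousAt_const.sub (hya j).continuousAt).tendsto
      refine tendsto_nhds_unique (hc1.tendsto.mono_left nhdsWithin_le_nhds)
        ((hc2.tendsto.mono_left (nhdsWithin_le_nhds (s := {0}ᶜ))).congr' ?_)
      filter_upwards [h1] with t ht
      exact (ht w).symm
    rw [eventually_nhdsWithin_iff] at h1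
    filter_upwards [h1] with t ht
    by_cases h : t = 0
    · rw [h]; exact hat0
    · exact ht h
  · filter_upwards [hpt] with t ⟨z, hz, hyz⟩
    have : (fun j => y j t) = fun j => Y j z := funext hyz
    rw [this]
    exact hYi z

end Puiseux
end PlaneCurve

namespace PlaneCurve

open Filter Topology Metric Set

/-! ### Logarithmic derivatives near a point where branches meet. -/

section Asymptotics

/-- Writing `D = t ^ e * u` with `u 0 ≠ 0`, the logarithmic derivative satisfies `t D' / D = e + t
u' / u`, and the last term vanishes in the limit. -/
theorem _root_.AnalyticAt.exists_order {D : ℂ → ℂ} (hD : AnalyticAt ℂ D 0)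
    (hne : ∀ᶠ t in 𝓝[≠] (0 : ℂ), D t ≠ 0) :
    ∃ (e : ℕ) (u : ℂ → ℂ), AnalyticAt ℂ u 0 ∧ u 0 ≠ 0 ∧ (∀ᶠ t in 𝓝 0, D t = t ^ e * u t) ∧
      Tendsto (fun t => t * deriv D t / D t) (𝓝[≠] 0) (𝓝 e) := by
  have h1 : ¬ ∀ᶠ t in 𝓝 (0 : ℂ), D t = 0 := by
    intro h
    obtain ⟨t, ht1, ht2⟩ := (hne.and (h.filter_mono nhdsWithin_le_nhds)).exists
    exact ht1 ht2
  obtain ⟨e, u, hu, hu0, hDu⟩ := hD.exists_eventuallyEq_pow_smul_nonzero_iff.2 h1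
  simp only [sub_zero, smul_eq_mul] at hDu
  refine ⟨e, u, hu, hu0, hDu, ?_⟩
  have hlim : Tendsto (fun t => (e : ℂ) + t * deriv u t / u t) (𝓝[≠] 0) (𝓝 e) := by
    have : ContinuousAt (fun t => (e : ℂ) + t * deriv u t / u t) 0 := by
      have := hu.deriv.continuousAt
      have := hu.continuousAt
      fun_prop (disch := assumption)
    have h2 := this.tendsto
    simp only [zero_mul, zero_div, add_zero] at h2
    exact h2.mono_left nhdsWithin_le_nhds
  refine hlim.congr' ?_
  have hud : ∀ᶠ t in 𝓝[≠] (0 : ℂ), DifferentiableAt ℂ u t :=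
    (hu.eventually_analyticAt.mono fun t h => h.differentiableAt).filter_mono nhdsWithin_le_nhds
  have hun : ∀ᶠ t in 𝓝[≠] (0 : ℂ), u t ≠ 0 :=
    (hu.continuousAt.eventually_ne hu0).filter_mono nhdsWithin_le_nhds
  filter_upwards [hDu.eventually_nhds.filter_mono nhdsWithin_le_nhds, hud, hun,
    self_mem_nhdsWithin] with t ht1 ht2 ht3 ht4
  have ht4' : t ≠ 0 := ht4
  have h3 : deriv D t = (e * t ^ (e - 1)) * u t + t ^ e * deriv u t := by
    rw [EventuallyEq.deriv_eq ht1]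
    exact ((hasDerivAt_pow e t).mul ht2.hasDerivAt).deriv
  rw [h3, ht1.self_of_nhds]
  -- The exponent `e - 1` is truncated, so order zero is treated apart.
  rcases e with _ | e
  · simp
  · simp only [Nat.add_sub_cancel, pow_succ]
    field_simp

theorem tendsto_div_of_order_lt {D D' : ℂ → ℂ} {e e' : ℕ} {u u' : ℂ → ℂ} (hu : AnalyticAt ℂ u 0)
    (hu' : AnalyticAt ℂ u' 0) (h0 : u 0 ≠ 0) (hD : ∀ᶠ t in 𝓝 0, D t = t ^ e * u t)
    (hD' : ∀ᶠ t in 𝓝 0, D' t = t ^ e' * u' t) (hlt : e < e') :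
    Tendsto (fun t => D' t / D t) (𝓝[≠] 0) (𝓝 0) := by
  have hlim : Tendsto (fun t => t ^ (e' - e) * u' t / u t) (𝓝[≠] 0) (𝓝 0) := by
    have : ContinuousAt (fun t => t ^ (e' - e) * u' t / u t) 0 := by
      have := hu.continuousAt
      have := hu'.continuousAt
      fun_prop (disch := assumption)
    have h2 := this.tendsto
    rw [zero_pow (by omega), zero_mul, zero_div] at h2
    exact h2.mono_left nhdsWithin_le_nhds
  refine hlim.congr' ?_
  filter_upwards [hD.filter_mono nhdsWithin_le_nhds, hD'.filter_mono nhdsWithin_le_nhds,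
    self_mem_nhdsWithin] with t h1 h2 h3
  have h3' : t ≠ 0 := h3
  rw [h1, h2]
  have : t ^ e' = t ^ e * t ^ (e' - e) := by rw [← pow_add]; congr 1; omega
  rw [this]
  field_simp

/-- If the sum of the reciprocals of `w - Y j t` stays bounded while `w` approaches a common value
of the roots, then its weighted version is asymptotic to a positive integer. -/
theorem exists_tendsto_logDeriv {n : ℕ} {Y : Fin n → ℂ → ℂ} (hY : ∀ j, AnalyticAt ℂ (Y j) 0)
    (hinj : ∀ᶠ t in 𝓝[≠] (0 : ℂ), Function.Injective fun j => Y j t) {q : ℂ}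
    {U : Ultrafilter (ℂ × ℂ)} (hU1 : Tendsto Prod.fst (U : Filter (ℂ × ℂ)) (𝓝[≠] 0))
    (hU2 : Tendsto Prod.snd (U : Filter (ℂ × ℂ)) (𝓝 q)) (hne : ∀ᶠ z : ℂ × ℂ in U, ∀ j, z.2 - Y j z.1 ≠ 0)
    (hq : ∃ j, Y j 0 = q) {K : ℝ} (hK : ∀ᶠ z : ℂ × ℂ in U, ‖∑ j, 1 / (z.2 - Y j z.1)‖ ≤ K) :
    ∃ E : ℕ, 0 < E ∧
      Tendsto (fun z : ℂ × ℂ => ∑ j, -(z.1 * deriv (Y j) z.1) / (z.2 - Y j z.1)) U (𝓝 E) := by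
  classical
  obtain ⟨j₀, hj₀⟩ := hq
  have hU0 : Tendsto Prod.fst (U : Filter (ℂ × ℂ)) (𝓝 0) := hU1.mono_right nhdsWithin_le_nhds
  have hYU : ∀ j, Tendsto (fun z : ℂ × ℂ => Y j z.1) U (𝓝 (Y j 0)) := fun j =>
    (hY j).continuousAt.tendsto.comp hU0
  -- the nearest root
  obtain ⟨i, hi⟩ : ∃ i, ∀ᶠ z : ℂ × ℂ in U, ∀ k, ‖z.2 - Y i z.1‖ ≤ ‖z.2 - Y k z.1‖ := by
    rw [← Ultrafilter.eventually_exists_iff]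
    refine Eventually.of_forall fun z => ?_
    obtain ⟨i, -, h⟩ := Finset.exists_min_image Finset.univ (fun k => ‖z.2 - Y k z.1‖) ⟨j₀, by simp⟩
    exact ⟨i, fun k => h k (by simp)⟩
  have hd : Tendsto (fun z : ℂ × ℂ => z.2 - Y i z.1) U (𝓝 0) := by
    rw [tendsto_zero_iff_norm_tendsto_zero]
    have h1 : Tendsto (fun z : ℂ × ℂ => ‖z.2 - Y j₀ z.1‖) U (𝓝 0) := by
      have := (hU2.sub (hYU j₀)).norm
      simpa [hj₀] using this
    exact squeeze_zero' (Eventually.of_forall fun _ => norm_nonneg _) (hi.mono fun z h => h j₀) h1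
  -- As `Y i` is the nearest branch, all `Q j` lie in the unit disc and have limits `c j` along the
  -- ultrafilter.
  let Q : Fin n → ℂ × ℂ → ℂ := fun j z => (z.2 - Y i z.1) / (z.2 - Y j z.1)
  have hQ : ∀ j, ∃ c : ℂ, Tendsto (Q j) U (𝓝 c) := by
    intro j
    have h1 : closedBall (0 : ℂ) 1 ∈ U.map (Q j) := by
      have : ∀ᶠ z : ℂ × ℂ in U, Q j z ∈ closedBall (0 : ℂ) 1 := by
        filter_upwards [hi, hne] with z h1 h2
        rw [mem_closedBall_zero_iff, norm_div]
        exact div_le_one_of_le₀ (h1 j) (norm_nonneg _)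
      exact this
    obtain ⟨c, -, hc⟩ := (isCompact_closedBall (0 : ℂ) 1).ultrafilter_le_nhds' _ h1
    exact ⟨c, hc⟩
  choose c hc using hQ
  have hci : c i = 1 := by
    refine tendsto_nhds_unique (hc i) (tendsto_const_nhds.congr' ?_)
    filter_upwards [hne] with z h
    simp [Q, div_self (h i)]
  -- The sum of the `Q j` is `z.2 - Y i z.1`, which tends to zero, times the sum of reciprocals,
  -- which is bounded.
  have hcsum : ∑ j, c j = 0 := by
    have h1 : Tendsto (fun z => ∑ j, Q j z) U (𝓝 (∑ j, c j)) := tendsto_finsetSum _ fun j _ => hc j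
    have h2 : Tendsto (fun z : ℂ × ℂ => (z.2 - Y i z.1) * ∑ j, 1 / (z.2 - Y j z.1)) U (𝓝 0) :=
      hd.zero_mul_isBoundedUnder_le ⟨K, by simpa using hK⟩
    refine tendsto_nhds_unique h1 (h2.congr fun z => ?_)
    rw [Finset.mul_sum]
    refine Finset.sum_congr rfl fun j _ => ?_
    simp [Q, div_eq_mul_inv]
  -- orders of contact
  have hD : ∀ j, AnalyticAt ℂ (fun t => Y i t - Y j t) 0 := fun j => (hY i).sub (hY j)
  have hord : ∀ j, ∃ (e : ℕ) (u : ℂ → ℂ), j ≠ i → AnalyticAt ℂ u 0 ∧ u 0 ≠ 0 ∧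
      (∀ᶠ t in 𝓝 0, Y i t - Y j t = t ^ e * u t) ∧
      Tendsto (fun t => t * deriv (fun t => Y i t - Y j t) t / (Y i t - Y j t)) (𝓝[≠] 0) (𝓝 e) := by
    intro j
    by_cases hj : j = i
    · exact ⟨0, 0, fun h => absurd hj h⟩
    · have h1 : ∀ᶠ t in 𝓝[≠] (0 : ℂ), Y i t - Y j t ≠ 0 := by
        filter_upwards [hinj] with t ht h
        exact hj (ht (sub_eq_zero.1 h).symm)
      obtain ⟨e, u, h2⟩ := (hD j).exists_order h1
      exact ⟨e, u, fun _ => h2⟩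
  choose e u hord using hord
  have hDne : ∀ j, j ≠ i → ∀ᶠ z : ℂ × ℂ in U, Y i z.1 - Y j z.1 ≠ 0 := by
    intro j hj
    filter_upwards [hU1.eventually hinj] with z hz h
    exact hj (hz (sub_eq_zero.1 h).symm)
  have h1Q : ∀ j, ∀ᶠ z : ℂ × ℂ in U, (Y i z.1 - Y j z.1) / (z.2 - Y j z.1) = 1 - Q j z := by
    intro j
    filter_upwards [hne] with z hz
    have := hz j
    simp only [Q]
    field_simp
    ring
  have hratio : ∀ j, c j ≠ 0 →
      Tendsto (fun z : ℂ × ℂ => (Y i z.1 - Y j z.1) / (z.2 - Y i z.1)) U (𝓝 ((1 - c j) / c j)) := by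
    intro j hj
    refine ((tendsto_const_nhds.sub (hc j)).div (hc j) hj).congr' ?_
    filter_upwards [hne, h1Q j] with z hz hz'
    rw [Pi.div_apply, ← hz']
    have := hz j
    have := hz i
    simp only [Q]
    field_simp
  have hne1 : ∀ j, c j ≠ 1 → j ≠ i := fun j hj h => hj (h ▸ hci)
  -- For `c j` different from 0 and 1, `Y i - Y j` is comparable to `z.2 - Y i z.1`, by `hratio`.
  -- All these differences are therefore comparable to each other and have the same order of
  -- vanishing.
  have hle : ∀ j k, c j ≠ 0 → c j ≠ 1 → c k ≠ 0 → c k ≠ 1 → e k ≤ e j := by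
    intro j k hj0 hj1 hk0 hk1
    by_contra! hlt
    obtain ⟨hu1, hu2, hu3, -⟩ := hord j (hne1 j hj1)
    obtain ⟨hu1', hu2', hu3', -⟩ := hord k (hne1 k hk1)
    have h1 := (tendsto_div_of_order_lt hu1 hu1' hu2 hu3 hu3' hlt).comp hU1
    have h2 := (hratio k hk0).div (hratio j hj0) (div_ne_zero (sub_ne_zero.2 hj1.symm) hj0)
    have h3 := tendsto_nhds_unique h2 (h1.congr' (by
      filter_upwards [hne] with z hz
      have := hz i
      simp only [Function.comp_apply, Pi.div_apply]
      rw [div_div_div_cancel_right₀ this]))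
    exact div_ne_zero (div_ne_zero (sub_ne_zero.2 hk1.symm) hk0)
      (div_ne_zero (sub_ne_zero.2 hj1.symm) hj0) h3
  -- Otherwise every `c j` is 0 or 1, and `c i = 1` makes the vanishing sum a positive integer.
  obtain ⟨j₂, hj20, hj21⟩ : ∃ j, c j ≠ 0 ∧ c j ≠ 1 := by
    by_contra! hcon
    have h1 : ∀ j, c j = ((if c j = 0 then 0 else 1 : ℕ) : ℂ) := by
      intro j
      by_cases h : c j = 0
      · simp [h]
      · simp [hcon j h]
    have h2 : ((∑ j, (if c j = 0 then 0 else 1 : ℕ) : ℕ) : ℂ) = 0 := by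
      rw [Nat.cast_sum]
      exact (Finset.sum_congr rfl fun j _ => (h1 j).symm).trans hcsum
    have h3 : (∑ j, (if c j = 0 then 0 else 1 : ℕ)) = 0 := by exact_mod_cast h2
    have h4 := (Finset.sum_eq_zero_iff.1 h3) i (Finset.mem_univ _)
    simp [hci] at h4
  -- Being comparable to `z.2 - Y i z.1`, the difference `Y i - Y j₂` tends to zero, so these two
  -- branches meet at `t = 0`.
  have he1 : 1 ≤ e j₂ := by
    by_contra! hcon
    have h0 : e j₂ = 0 := by omega
    obtain ⟨hu1, hu2, hu3, -⟩ := hord j₂ (hne1 j₂ hj21)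
    have h1 : Tendsto (fun z : ℂ × ℂ => Y i z.1 - Y j₂ z.1) U (𝓝 0) := by
      have := (hratio j₂ hj20).mul hd
      rw [mul_zero] at this
      refine this.congr' ?_
      filter_upwards [hne] with z hz
      exact div_mul_cancel₀ _ (hz i)
    have h2 : Tendsto (fun z : ℂ × ℂ => u j₂ z.1) U (𝓝 0) := by
      refine h1.congr' ?_
      filter_upwards [hU0.eventually hu3] with z hz
      rw [hz, h0, pow_zero, one_mul]
    exact hu2 (tendsto_nhds_unique (hu1.continuousAt.tendsto.comp hU0) h2)
  -- the limit
  have hlim : Tendsto (fun z : ℂ × ℂ => ∑ j, -(z.1 * deriv (Y j) z.1) / (z.2 - Y j z.1)) U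
      (𝓝 (∑ j, (e j : ℂ) * (1 - c j))) := by
    have h1 : ∀ j, Tendsto (fun z : ℂ × ℂ =>
        z.1 * deriv (fun t => Y i t - Y j t) z.1 / (z.2 - Y j z.1)) U
        (𝓝 ((e j : ℂ) * (1 - c j))) := by
      intro j
      by_cases hj : j = i
      · subst hj
        simp [hci]
      · refine (((hord j hj).2.2.2.comp hU1).mul (tendsto_const_nhds.sub (hc j))).congr' ?_
        filter_upwards [h1Q j, hDne j hj, hne] with z hz1 hz2 hz3
        rw [← hz1]
        have := hz3 j
        simp only [Function.comp_apply]
        field_simp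
    -- Bounded reciprocals make this contribution of `Y i` negligible, so each derivative `Y j'` may
    -- be replaced by `Y j' - Y i'`, whose size is governed by the order of contact.
    have h2 : Tendsto (fun z : ℂ × ℂ => (z.1 * deriv (Y i) z.1) * ∑ j, 1 / (z.2 - Y j z.1)) U
        (𝓝 0) := by
      refine Tendsto.zero_mul_isBoundedUnder_le ?_ ⟨K, by simpa using hK⟩
      have h3 : ContinuousAt (fun t => t * deriv (Y i) t) 0 := by
        have := (hY i).deriv.continuousAt
        fun_prop
      have := h3.tendsto.comp hU0
      rwa [zero_mul] at this
    have h3 := (tendsto_finsetSum Finset.univ fun j _ => h1 j).sub h2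
    rw [sub_zero] at h3
    refine h3.congr' ?_
    have hdiff : ∀ᶠ z : ℂ × ℂ in U, ∀ j, DifferentiableAt ℂ (Y j) z.1 := by
      rw [eventually_all]
      intro j
      exact hU0.eventually ((hY j).eventually_analyticAt.mono fun t h => h.differentiableAt)
    filter_upwards [hne, hdiff] with z hz hz'
    rw [Finset.mul_sum, ← Finset.sum_sub_distrib]
    refine Finset.sum_congr rfl fun j _ => ?_
    rw [deriv_fun_sub (hz' i) (hz' j)]
    have := hz j
    field_simp
    ring
  -- The limit is `∑ e j * (1 - c j)`. When `c j ≠ 0`, the order `e j` may be replaced by the common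
  -- order `e j₂`, since for `c j = 1` the term vanishes anyway. As the `c j` add up to zero, the
  -- terms `e j₂ * c j` cancel and a natural number remains; the index `i` contributes `e j₂ ≥ 1`.
  refine ⟨∑ j, (if c j = 0 then e j else e j₂), ?_, ?_⟩
  · refine Finset.sum_pos' (fun _ _ => Nat.zero_le _) ⟨i, Finset.mem_univ _, ?_⟩
    simp only [hci, one_ne_zero, if_false]
    omega
  · convert hlim using 2
    have h1 : ∀ j, (e j : ℂ) * (1 - c j)
        = ((if c j = 0 then e j else e j₂ : ℕ) : ℂ) - (e j₂ : ℂ) * c j := by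
      intro j
      by_cases h0 : c j = 0
      · simp [h0]
      · by_cases h1 : c j = 1
        · simp [h1]
        · have : e j = e j₂ := le_antisymm (hle _ _ hj20 hj21 h0 h1) (hle _ _ h0 h1 hj20 hj21)
          rw [if_neg h0, this]
          ring
    rw [Finset.sum_congr rfl fun j _ => h1 j, Finset.sum_sub_distrib, ← Finset.mul_sum, hcsum]
    push_cast
    simp

end Asymptotics

/-! ### Radial growth of the modulus of `f` near a special point. -/

section Radial

variable {f : MvPolynomial (Fin 2) ℂ} {n : ℕ}

/-- Near a special point, where the derivative along the fibre is controlled by the function, the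
logarithm of the modulus of the function increases in the radial direction of the base. -/
theorem exists_radial_increase (hn : ∀ x, (fibrePoly f x).natDegree = n)
    (h0 : ∀ x, fibrePoly f x ≠ 0) {p q : ℂ} (hq : value f p q = 0) {ρ : ℝ} (hρ : 0 < ρ)
    (hp : ∀ x, x ≠ p → ‖x - p‖ < ρ → x ∉ specialValues f) (K : ℝ) :
    ∃ r > 0, ∀ x y, ‖x - p‖ < r → ‖y - q‖ < r → x ≠ p → value f x y ≠ 0 →
      ‖value (MvPolynomial.pderiv 1 f) x y‖ ≤ K * ‖value f x y‖ →
      K * ‖x - p‖ < ((x - p) * value (MvPolynomial.pderiv 0 f) x y / value f x y).re := by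
  obtain ⟨M, Y, hM, hY, hprod, hinj⟩ := exists_puiseux f hn h0 hρ hp
  have hρc : (ρ : ℂ) ≠ 0 := by exact_mod_cast hρ.ne'
  let A : ℂ → ℂ := fun t => (fibrePoly f (p + ρ * t ^ M)).coeff n
  have hAd : Differentiable ℂ A :=
    (differentiable_coeff_fibrePoly f n).comp (by fun_prop : Differentiable ℂ fun t : ℂ => p + ρ * t ^ M)
  have hA0 : ∀ t, A t ≠ 0 := by
    intro t
    simp only [A]
    rw [← hn (p + ρ * t ^ M), Polynomial.coeff_natDegree]
    simpa using h0 _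
  have hpM : p + ρ * (0 : ℂ) ^ M = p := by rw [zero_pow hM.ne']; ring
  have hq0 : ∃ j, Y j 0 = q := by
    have h1 := hprod.self_of_nhds q
    rw [hpM, hq] at h1
    have h2 := (mul_eq_zero.1 h1.symm).resolve_left (by simpa [A, hpM] using hA0 0)
    obtain ⟨j, -, hj⟩ := Finset.prod_eq_zero_iff.1 h2
    exact ⟨j, (sub_eq_zero.1 hj).symm⟩
  have key : ∀ᶠ z : ℂ × ℂ in 𝓝[≠] 0 ×ˢ 𝓝 q, value f (p + ρ * z.1 ^ M) z.2 ≠ 0 →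
      ‖value (MvPolynomial.pderiv 1 f) (p + ρ * z.1 ^ M) z.2‖
        ≤ K * ‖value f (p + ρ * z.1 ^ M) z.2‖ →
      K * ‖ρ * z.1 ^ M‖ < ((ρ * z.1 ^ M) * value (MvPolynomial.pderiv 0 f) (p + ρ * z.1 ^ M) z.2 /
        value f (p + ρ * z.1 ^ M) z.2).re := by
    -- If the inequality fails arbitrarily close to the point, an ultrafilter lives on the failures.
    -- Along it, subsequences need not be chosen.
    by_contra hcon
    rw [Filter.not_eventually, Filter.frequently_iff_neBot] at hcon
    obtain ⟨U, hU⟩ := @Ultrafilter.exists_le _ _ hcon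
    have hUle : (U : Filter (ℂ × ℂ)) ≤ 𝓝[≠] (0 : ℂ) ×ˢ 𝓝 q := hU.trans inf_le_left
    have hUbad := le_principal_iff.1 (hU.trans inf_le_right)
    have hU1 : Tendsto Prod.fst (U : Filter (ℂ × ℂ)) (𝓝[≠] 0) := tendsto_fst.mono_left hUle
    have hU2 : Tendsto Prod.snd (U : Filter (ℂ × ℂ)) (𝓝 q) := tendsto_snd.mono_left hUle
    have hU0 : Tendsto Prod.fst (U : Filter (ℂ × ℂ)) (𝓝 0) := hU1.mono_right nhdsWithin_le_nhds
    have hval : ∀ᶠ z : ℂ × ℂ in U, ∀ᶠ t in 𝓝 z.1, ∀ w,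
        value f (p + ρ * t ^ M) w = A t * ∏ j, (w - Y j t) :=
      hU0.eventually hprod.eventually_nhds
    have hbad : ∀ᶠ z : ℂ × ℂ in U, value f (p + ρ * z.1 ^ M) z.2 ≠ 0 ∧
        ‖value (MvPolynomial.pderiv 1 f) (p + ρ * z.1 ^ M) z.2‖
          ≤ K * ‖value f (p + ρ * z.1 ^ M) z.2‖ ∧
        ((ρ * z.1 ^ M) * value (MvPolynomial.pderiv 0 f) (p + ρ * z.1 ^ M) z.2 /
          value f (p + ρ * z.1 ^ M) z.2).re ≤ K * ‖ρ * z.1 ^ M‖ := by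
      filter_upwards [hUbad] with z hz
      push Not at hz
      exact hz
    have hne : ∀ᶠ z : ℂ × ℂ in U, ∀ j, z.2 - Y j z.1 ≠ 0 := by
      filter_upwards [hval, hbad] with z hz hz' j hj
      apply hz'.1
      rw [hz.self_of_nhds, Finset.prod_eq_zero (Finset.mem_univ j) hj, mul_zero]
    have hdiff : ∀ᶠ z : ℂ × ℂ in U, ∀ j, DifferentiableAt ℂ (Y j) z.1 := by
      rw [eventually_all]
      intro j
      exact hU0.eventually ((hY j).eventually_analyticAt.mono fun t h => h.differentiableAt)
    have hfy : ∀ᶠ z : ℂ × ℂ in U, ∑ j, 1 / (z.2 - Y j z.1)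
        = value (MvPolynomial.pderiv 1 f) (p + ρ * z.1 ^ M) z.2 / value f (p + ρ * z.1 ^ M) z.2 := by
      filter_upwards [hval, hne] with z hz hz'
      have h1 : HasDerivAt (fun w => value f (p + ρ * z.1 ^ M) w)
          (value (MvPolynomial.pderiv 1 f) (p + ρ * z.1 ^ M) z.2) z.2 := by
        have h2 := (fibrePoly f (p + ρ * z.1 ^ M)).hasDerivAt z.2
        rw [eval_derivative_fibrePoly] at h2
        exact h2.congr_of_eventuallyEq (Eventually.of_forall fun w => (eval_fibrePoly f _ w).symm)
      have h2 : logDeriv (fun w => value f (p + ρ * z.1 ^ M) w) z.2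
          = ∑ j, 1 / (z.2 - Y j z.1) := by
        have h3 : (fun w => value f (p + ρ * z.1 ^ M) w) = fun w => A z.1 * ∏ j, (w - Y j z.1) :=
          funext fun w => hz.self_of_nhds w
        rw [h3, logDeriv_const_mul _ _ (hA0 _),
          logDeriv_prod (fun j _ => hz' j) (fun j _ => by fun_prop)]
        simp [logDeriv_apply]
      rw [← h2, logDeriv_apply, h1.deriv]
    -- Both sides are `t ∂_t log f`; the factor `M` comes from `t d/dt (ρ t ^ M) = M ρ t ^ M`.
    have hfx : ∀ᶠ z : ℂ × ℂ in U, z.1 * deriv A z.1 / A z.1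
          + ∑ j, -(z.1 * deriv (Y j) z.1) / (z.2 - Y j z.1)
        = M * ((ρ * z.1 ^ M) * value (MvPolynomial.pderiv 0 f) (p + ρ * z.1 ^ M) z.2 /
          value f (p + ρ * z.1 ^ M) z.2) := by
      filter_upwards [hval, hne, hdiff] with z hz hz' hzd
      have h1 : HasDerivAt (fun t => value f (p + ρ * t ^ M) z.2)
          (value (MvPolynomial.pderiv 0 f) (p + ρ * z.1 ^ M) z.2 * (ρ * (M * z.1 ^ (M - 1)))) z.1 := by
        have h3 : HasDerivAt (fun t : ℂ => p + ρ * t ^ M) (ρ * (M * z.1 ^ (M - 1))) z.1 :=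
          ((hasDerivAt_pow M z.1).const_mul _).const_add _
        have h4 := (hasStrictFDerivAt_value f (p + ρ * z.1 ^ M, z.2)).hasFDerivAt.comp_hasDerivAt
          z.1 (h3.prodMk (hasDerivAt_const z.1 z.2))
        refine (h4.congr_deriv ?_).congr_of_eventuallyEq (Eventually.of_forall fun w => rfl)
        simp
      have h2 : logDeriv (fun t => value f (p + ρ * t ^ M) z.2) z.1
          = deriv A z.1 / A z.1 + ∑ j, -deriv (Y j) z.1 / (z.2 - Y j z.1) := by
        have h5 : (fun t => value f (p + ρ * t ^ M) z.2)
            =ᶠ[𝓝 z.1] fun t => A t * ∏ j, (z.2 - Y j t) := by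
          filter_upwards [hz] with t ht using ht z.2
        have h6 : ∀ j, DifferentiableAt ℂ (fun t => z.2 - Y j t) z.1 := fun j =>
          (hzd j).const_sub z.2
        rw [logDeriv_apply, h5.deriv_eq, (hz.self_of_nhds z.2 : value f (p + ρ * z.1 ^ M) z.2 = _)]
        change logDeriv (fun t => A t * ∏ j, (z.2 - Y j t)) z.1 = _
        rw [logDeriv_mul _ (hA0 _)
          (Finset.prod_ne_zero_iff.2 fun j _ => hz' j) (hAd _)
          (DifferentiableAt.fun_finsetProd fun j _ => h6 j),
          logDeriv_prod (fun j _ => hz' j) (fun j _ => h6 j)]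
        simp [logDeriv_apply]
      have h7 : z.1 * deriv A z.1 / A z.1 + ∑ j, -(z.1 * deriv (Y j) z.1) / (z.2 - Y j z.1)
          = z.1 * logDeriv (fun t => value f (p + ρ * t ^ M) z.2) z.1 := by
        rw [h2, mul_add, Finset.mul_sum, mul_div_assoc]
        congr 1
        refine Finset.sum_congr rfl fun j _ => ?_
        ring
      rw [h7, logDeriv_apply, h1.deriv]
      have h8 : z.1 ^ M = z.1 ^ (M - 1) * z.1 := by
        rw [← pow_succ]; congr 1; omega
      rw [h8]
      ring
    have hK' : ∀ᶠ z : ℂ × ℂ in U, ‖∑ j, 1 / (z.2 - Y j z.1)‖ ≤ K := by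
      filter_upwards [hfy, hbad] with z hz hz'
      rw [hz, norm_div]
      exact (div_le_iff₀ (norm_pos_iff.2 hz'.1)).2 hz'.2.1
    obtain ⟨E, hE, hlim⟩ := exists_tendsto_logDeriv hY hinj hU1 hU2 hne hq0 hK'
    have hA1 : Tendsto (fun z : ℂ × ℂ => z.1 * deriv A z.1 / A z.1) U (𝓝 0) := by
      have h3 : ContinuousAt (fun t => t * deriv A t / A t) 0 := by
        have h4 : Continuous (deriv A) := (hAd.contDiff (n := 1)).continuous_deriv le_rfl
        have := hAd.continuous
        have := hA0 0
        exact (continuousAt_id.mul h4.continuousAt).div hAd.continuous.continuousAt this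
      have := h3.tendsto.comp hU0
      rwa [zero_mul, zero_div] at this
    have hlim2 := (hA1.add hlim).congr' hfx
    rw [zero_add] at hlim2
    have hlim3 := (Complex.continuous_re.tendsto _).comp hlim2
    -- The bound on the radial derivative tends to zero together with the distance to `p`, whereas
    -- the derivative, multiplied by `M`, tends to `E > 0`. The failed inequality would give `E ≤
    -- 0`.
    have hlim4 : Tendsto (fun z : ℂ × ℂ => (M : ℝ) * (K * ‖(ρ : ℂ) * z.1 ^ M‖)) U (𝓝 0) := by
      have h3 : Continuous (fun t : ℂ => (M : ℝ) * (K * ‖(ρ : ℂ) * t ^ M‖)) := by fun_prop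
      have := (h3.tendsto 0).comp hU0
      have h4 : (M : ℝ) * (K * ‖(ρ : ℂ) * 0 ^ M‖) = 0 := by simp [hM.ne']
      rwa [h4] at this
    have := le_of_tendsto_of_tendsto hlim3 hlim4 (by
      filter_upwards [hbad] with z hz
      simp only [Function.comp_apply]
      rw [← Complex.ofReal_natCast, Complex.re_ofReal_mul]
      exact mul_le_mul_of_nonneg_left hz.2.2 (by positivity))
    simp only [Complex.natCast_re] at this
    have : (0 : ℝ) < E := by exact_mod_cast hE
    linarith
  rw [eventually_iff_exists_mem] at key
  obtain ⟨S, hS, hkey⟩ := key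
  obtain ⟨S₁, hS₁, S₂, hS₂, hS12⟩ := mem_prod_iff.1 hS
  obtain ⟨r₁, hr₁, hr₁S⟩ := Metric.mem_nhdsWithin_iff.1 hS₁
  obtain ⟨r₂, hr₂, hr₂S⟩ := Metric.mem_nhds_iff.1 hS₂
  refine ⟨min (ρ * r₁ ^ M) r₂, by positivity, fun x y hx hy hxp hf hfy => ?_⟩
  -- Every base point near `p` is reached by a small `t`, because `M`-th roots exist.
  obtain ⟨t, ht⟩ := IsAlgClosed.exists_pow_nat_eq ((x - p) / ρ) hM
  have hx' : x = p + ρ * t ^ M := by rw [ht]; field_simp; ring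
  have ht0 : t ≠ 0 := by
    rintro rfl
    exact hxp (hx'.trans hpM)
  have htr : ‖t‖ < r₁ := by
    have h1 : ‖t‖ ^ M < r₁ ^ M := by
      rw [← norm_pow, ht, norm_div, Complex.norm_real, Real.norm_of_nonneg hρ.le,
        div_lt_iff₀ hρ, mul_comm]
      exact hx.trans_le (min_le_left _ _)
    exact lt_of_pow_lt_pow_left₀ M hr₁.le h1
  have h2 := hkey (t, y) (hS12 ⟨hr₁S ⟨by simpa using htr, ht0⟩, hr₂S (by
    rw [mem_ball, dist_eq_norm]; exact hy.trans_le (min_le_right _ _))⟩)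
  simp only [← hx'] at h2
  have h3 : (ρ : ℂ) * t ^ M = x - p := by rw [hx']; ring
  rw [h3] at h2
  exact h2 hf hfy

end Radial
end PlaneCurve

namespace PlaneCurve
open Filter Topology Metric Set

/-! ### The tube function `g |f|` and its critical points on vertical lines. -/

section Tube

variable {f : MvPolynomial (Fin 2) ℂ} {g : ℂ × ℂ → ℝ}

/-- The function `g |f|` whose sublevel sets are the tubes around the curve. -/
noncomputable def tubeFun (f : MvPolynomial (Fin 2) ℂ) (g : ℂ × ℂ → ℝ) (z : ℂ × ℂ) : ℝ :=
  g z * ‖value f z.1 z.2‖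

theorem continuous_tubeFun (hg : ContDiff ℝ ∞ g) : Continuous (tubeFun f g) :=
  hg.continuous.mul (continuous_value f).norm

theorem hasStrictFDerivAt_tubeFun (hg : ContDiff ℝ ∞ g) {z : ℂ × ℂ}
    (hz : value f z.1 z.2 ≠ 0) :
    HasStrictFDerivAt (tubeFun f g) (fderiv ℝ (tubeFun f g) z) z := by
  have h1 : ContDiffAt ℝ ∞ (tubeFun f g) z :=
    hg.contDiffAt.mul ((contDiff_value f).contDiffAt.norm ℝ hz)
  exact h1.hasStrictFDerivAt (by simp)

theorem fderiv_tubeFun_apply (hg : ContDiff ℝ ∞ g) {z : ℂ × ℂ} (hz : value f z.1 z.2 ≠ 0)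
    (w : ℂ × ℂ) :
    fderiv ℝ (tubeFun f g) z w = ‖value f z.1 z.2‖ * fderiv ℝ g z w
      + g z * (((value (MvPolynomial.pderiv 0 f) z.1 z.2 * w.1
        + value (MvPolynomial.pderiv 1 f) z.1 z.2 * w.2)
          * (starRingEnd ℂ) (value f z.1 z.2)).re / ‖value f z.1 z.2‖) := by
  have h1 := ((hasStrictFDerivAt_value f z).hasFDerivAt.restrictScalars ℝ).norm_sq.sqrt
    (by simpa using hz)
  have h2 : (fun z : ℂ × ℂ => √(‖value f z.1 z.2‖ ^ 2)) = fun z => ‖value f z.1 z.2‖ :=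
    funext fun z => Real.sqrt_sq (norm_nonneg _)
  rw [h2, Real.sqrt_sq (norm_nonneg _)] at h1
  have h3 := (hg.differentiable (by simp) z).hasFDerivAt.mul h1
  have h4 : fderiv ℝ (tubeFun f g) z = _ := h3.fderiv
  rw [h4]
  have h5 : ‖value f z.1 z.2‖ ≠ 0 := norm_ne_zero_iff.2 hz
  simp only [add_apply, smul_apply, ContinuousLinearMap.comp_apply,
    ContinuousLinearMap.coe_restrictScalars', innerSL_apply_apply, Complex.inner, smul_eq_mul,
    ContinuousLinearMap.coe_fst', ContinuousLinearMap.coe_snd', nsmul_eq_mul]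
  push_cast
  field_simp
  ring

theorem fderiv_fibre_tubeFun (hg : ContDiff ℝ ∞ g) {x y : ℂ} (hz : value f x y ≠ 0) (v : ℂ) :
    fderiv ℝ (fun w => g (x, w) * ‖value f x w‖) y v = fderiv ℝ (tubeFun f g) (x, y) (0, v) := by
  have h1 := (hasStrictFDerivAt_tubeFun (z := (x, y)) hg hz).hasFDerivAt.comp y
    ((hasFDerivAt_const x y).prodMk (hasFDerivAt_id y))
  have h2 : fderiv ℝ (fun w => g (x, w) * ‖value f x w‖) y = _ := h1.fderiv
  rw [h2]
  simp

/-- The derivative is tested on `f` times the conjugate of `f_y`. In this direction `|f|` changes at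
rate `|f| |f_y|²`, while `g` changes by at most `‖dg‖ |f| |f_y|`; criticality balances the two
contributions to the product. -/
theorem norm_pderiv_le_of_fibre_critical (hg : ContDiff ℝ ∞ g) (hg0 : ∀ z, 0 < g z) {x y : ℂ}
    (hz : value f x y ≠ 0) (h : fderiv ℝ (fun w => g (x, w) * ‖value f x w‖) y = 0) :
    ‖value (MvPolynomial.pderiv 1 f) x y‖
      ≤ ‖fderiv ℝ g (x, y)‖ / g (x, y) * ‖value f x y‖ := by
  have h1 := fderiv_fibre_tubeFun hg hz
    (value f x y * (starRingEnd ℂ) (value (MvPolynomial.pderiv 1 f) x y))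
  rw [h, fderiv_tubeFun_apply (z := (x, y)) hg hz] at h1
  replace h1 := (zero_apply _).symm.trans h1
  dsimp only at h1
  have hgp := hg0 (x, y)
  generalize value (MvPolynomial.pderiv 0 f) x y = e at h1
  generalize value (MvPolynomial.pderiv 1 f) x y = d at h1 ⊢
  clear h
  generalize value f x y = F at h1 hz ⊢
  have h2 : ((e * 0 + d * (F * (starRingEnd ℂ) d)) * (starRingEnd ℂ) F).re
      = ‖F‖ ^ 2 * ‖d‖ ^ 2 := by
    have : (e * 0 + d * (F * (starRingEnd ℂ) d)) * (starRingEnd ℂ) F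
      = (F * (starRingEnd ℂ) F) * (d * (starRingEnd ℂ) d) := by ring
    rw [this, Complex.mul_conj, Complex.mul_conj, ← Complex.ofReal_mul, Complex.ofReal_re,
      Complex.normSq_eq_norm_sq, Complex.normSq_eq_norm_sq]
  rw [h2] at h1
  have hFp : 0 < ‖F‖ := norm_pos_iff.2 hz
  have h3 : |fderiv ℝ g (x, y) (0, F * (starRingEnd ℂ) d)|
      ≤ ‖fderiv ℝ g (x, y)‖ * (‖F‖ * ‖d‖) := by
    refine ((fderiv ℝ g (x, y)).le_opNorm _).trans (le_of_eq ?_)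
    rw [Prod.norm_def, norm_zero, max_eq_right (norm_nonneg _), norm_mul, RCLike.norm_conj]
  have h4 := (abs_le.1 h3).1
  rw [div_mul_eq_mul_div, le_div_iff₀ hgp]
  rcases (norm_nonneg d).eq_or_lt with h5 | h5
  · rw [← h5, zero_mul]
    positivity
  have h6 : g (x, y) * (‖F‖ ^ 2 * ‖d‖ ^ 2 / ‖F‖) = (‖d‖ * g (x, y)) * (‖F‖ * ‖d‖) := by
    field_simp
  rw [h6] at h1
  have h7 : (‖d‖ * g (x, y)) * (‖F‖ * ‖d‖)
      ≤ (‖fderiv ℝ g (x, y)‖ * ‖F‖) * (‖F‖ * ‖d‖) := by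
    have h8 := mul_le_mul_of_nonneg_left h4 hFp.le
    linarith
  exact le_of_mul_le_mul_right h7 (by positivity)

/-- A vertical line inside the curve would consist of special points, of which each line has at most
one. -/
theorem fibrePoly_ne_zero (hgen : IsGenericProjection f) (x : ℂ) : fibrePoly f x ≠ 0 := by
  intro h
  have h1 : ∀ y, IsSpecialPoint f x y := fun y =>
    ⟨by rw [← eval_fibrePoly, h, Polynomial.eval_zero],
      by rw [← eval_derivative_fibrePoly, h, Polynomial.derivative_zero, Polynomial.eval_zero]⟩
  exact zero_ne_one (hgen.special_unique x 0 1 (h1 0) (h1 1))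

/-- For small levels, a critical point of `g |f|` on a vertical line lies over one of the discs
around the special values, and `g |f|` increases there in the radial direction of the disc. -/
theorem exists_level_bound (hgen : IsGenericProjection f) {N : ℕ} {p : Fin N → ℂ}
    (hX : range p = specialValues f) {r : Fin N → ℝ} (hr : ∀ i, 0 < r i) {D : Set ℂ}
    (hD : IsCompact D) {b : ℂ} {T : ℝ} (hDy : ∀ x ∈ D, ∀ y, value f x y = 0 → y ∈ ball b T)
    (hg : ContDiff ℝ ∞ g) (hg0 : ∀ z, 0 < g z) :
    ∃ ε₀ > (0 : ℝ), ∀ ε ∈ Ioo 0 ε₀, ∀ x ∈ D, ∀ y ∈ closedBall b T,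
      (tubeFun f g (x, y) = ε → fderiv ℝ (fun w => g (x, w) * ‖value f x w‖) y = 0 →
        ∃ j, ‖x - p j‖ < r j ∧ (x ≠ p j → 0 < fderiv ℝ (tubeFun f g) (x, y) (x - p j, 0))) ∧
      (‖y - b‖ = T → ε < tubeFun f g (x, y)) := by
  -- The claim passes to subsets and, with the smaller threshold, to unions. By compactness it only
  -- has to be checked near each point.
  have hind := (hD.prod (isCompact_closedBall b T)).induction_on (p := fun S =>
    ∃ ε₀ > (0 : ℝ), ∀ ε ∈ Ioo 0 ε₀, ∀ z ∈ S,
      (tubeFun f g z = ε → fderiv ℝ (fun w => g (z.1, w) * ‖value f z.1 w‖) z.2 = 0 →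
        ∃ j, ‖z.1 - p j‖ < r j ∧
          (z.1 ≠ p j → 0 < fderiv ℝ (tubeFun f g) z (z.1 - p j, 0))) ∧
      (‖z.2 - b‖ = T → ε < tubeFun f g z)) ⟨1, one_pos, by simp⟩ ?_ ?_ ?_
  · obtain ⟨ε₀, h0, h⟩ := hind
    exact ⟨ε₀, h0, fun ε hε x hx y hy => h ε hε (x, y) ⟨hx, hy⟩⟩
  · rintro S S' hS ⟨ε₀, h0, h⟩
    exact ⟨ε₀, h0, fun ε hε z hz => h ε hε z (hS hz)⟩
  · rintro S S' ⟨ε₀, h0, h⟩ ⟨ε₁, h1, h'⟩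
    refine ⟨min ε₀ ε₁, lt_min h0 h1, fun ε hε z hz => ?_⟩
    rcases hz with hz | hz
    · exact h ε ⟨hε.1, hε.2.trans_le (min_le_left _ _)⟩ z hz
    · exact h' ε ⟨hε.1, hε.2.trans_le (min_le_right _ _)⟩ z hz
  intro z₀ hz₀
  suffices h : ∃ ε₀ > (0 : ℝ), ∀ᶠ z : ℂ × ℂ in 𝓝 z₀, ∀ ε ∈ Ioo 0 ε₀,
      (tubeFun f g z = ε → fderiv ℝ (fun w => g (z.1, w) * ‖value f z.1 w‖) z.2 = 0 →
        ∃ j, ‖z.1 - p j‖ < r j ∧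
          (z.1 ≠ p j → 0 < fderiv ℝ (tubeFun f g) z (z.1 - p j, 0))) ∧
      (‖z.2 - b‖ = T → ε < tubeFun f g z) by
    obtain ⟨ε₀, h0, h⟩ := h
    exact ⟨_, mem_nhdsWithin_of_mem_nhds h, ε₀, h0, fun ε hε z hz => hz ε hε⟩
  have hT := continuous_tubeFun (f := f) hg
  -- Off the curve the tube function is bounded below, so small levels do not occur nearby. At
  -- points of the curve the ordinate is in the open disc, which makes the statement about its
  -- boundary void nearby.
  by_cases hv : value f z₀.1 z₀.2 = 0
  swap
  · have h0 : 0 < tubeFun f g z₀ := mul_pos (hg0 _) (norm_pos_iff.2 hv)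
    refine ⟨tubeFun f g z₀ / 2, by positivity, ?_⟩
    filter_upwards [hT.continuousAt.eventually_const_lt (half_lt_self h0)] with z hz ε hε
    exact ⟨fun h => absurd (h ▸ hz) (not_lt.2 hε.2.le), fun _ => hε.2.trans hz⟩
  have hb : ∀ᶠ z : ℂ × ℂ in 𝓝 z₀, ‖z.2 - b‖ < T := by
    have h1 := hDy z₀.1 hz₀.1 z₀.2 hv
    rw [mem_ball, dist_eq_norm] at h1
    exact (by fun_prop : Continuous fun z : ℂ × ℂ => ‖z.2 - b‖).continuousAt.eventually_lt_const h1
  have hne : ∀ z : ℂ × ℂ, 0 < tubeFun f g z → value f z.1 z.2 ≠ 0 := by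
    intro z hz h
    simp [tubeFun, h] at hz
  have hκ : Continuous fun z => ‖fderiv ℝ g z‖ / g z :=
    (hg.continuous_fderiv (by simp)).norm.div₀ hg.continuous fun z => (hg0 z).ne'
  -- At a non-special point of the curve `f_y` stays away from zero while `f` tends to zero, which
  -- contradicts the bound at fibre-critical points.
  by_cases hv' : value (MvPolynomial.pderiv 1 f) z₀.1 z₀.2 = 0
  swap
  · refine ⟨1, one_pos, ?_⟩
    have h1 : ∀ᶠ z : ℂ × ℂ in 𝓝 z₀, ‖fderiv ℝ g z‖ / g z * ‖value f z.1 z.2‖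
        < ‖value (MvPolynomial.pderiv 1 f) z.1 z.2‖ :=
      (hκ.mul (continuous_value f).norm).continuousAt.eventually_lt
        (continuous_value (MvPolynomial.pderiv 1 f)).norm.continuousAt (by simpa [hv] using hv')
    filter_upwards [h1, hb] with z hz1 hz2 ε hε
    refine ⟨fun h hc => absurd hz1 (not_lt.2 ?_), fun h => absurd hz2 h.not_lt⟩
    exact norm_pderiv_le_of_fibre_critical hg hg0 (hne z (h ▸ hε.1)) hc
  obtain ⟨j, hj⟩ : z₀.1 ∈ range p := hX ▸ ⟨z₀.2, hv, hv'⟩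
  obtain ⟨ρ, hρ, hρp⟩ : ∃ ρ > 0, ∀ x, x ≠ p j → ‖x - p j‖ < ρ → x ∉ specialValues f := by
    have h1 : (range p \ {p j})ᶜ ∈ 𝓝 (p j) :=
      ((finite_range p).subset sdiff_subset).isClosed.isOpen_compl.mem_nhds (by simp)
    obtain ⟨ρ, hρ, h⟩ := Metric.mem_nhds_iff.1 h1
    refine ⟨ρ, hρ, fun x hx hx' hxs => h (show x ∈ ball (p j) ρ by
      rwa [mem_ball, dist_eq_norm]) ⟨hX ▸ hxs, hx⟩⟩
  -- This bound for `‖dg‖ / g` near the point enters twice: it controls `f_y` by `f` at critical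
  -- points, and it lets the radial growth of `log |f|` beat the change of `log g`.
  set K := ‖fderiv ℝ g z₀‖ / g z₀ + 1 with hK
  rw [← hj] at hv
  obtain ⟨s, hs, hrad⟩ := exists_radial_increase hgen.natDegree_fibre (fibrePoly_ne_zero hgen)
    hv hρ hρp K
  refine ⟨1, one_pos, ?_⟩
  have h1 : ∀ᶠ z : ℂ × ℂ in 𝓝 z₀, ‖fderiv ℝ g z‖ / g z < K :=
    hκ.continuousAt.eventually_lt_const (by linarith)
  have h2 : ∀ᶠ z : ℂ × ℂ in 𝓝 z₀, ‖z.1 - p j‖ < min s (r j) :=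
    (by fun_prop : Continuous fun z : ℂ × ℂ => ‖z.1 - p j‖).continuousAt.eventually_lt_const
      (by simpa [hj] using ⟨hs, hr j⟩)
  have h3 : ∀ᶠ z : ℂ × ℂ in 𝓝 z₀, ‖z.2 - z₀.2‖ < s :=
    (by fun_prop : Continuous fun z : ℂ × ℂ => ‖z.2 - z₀.2‖).continuousAt.eventually_lt_const
      (by simpa using hs)
  filter_upwards [h1, h2, h3, hb] with z hz1 hz2 hz3 hz4 ε hε
  refine ⟨fun h hc => ⟨j, hz2.trans_le (min_le_right _ _), fun hzp => ?_⟩,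
    fun h => absurd hz4 h.not_lt⟩
  have hz0 := hne z (h ▸ hε.1)
  have hF : 0 < ‖value f z.1 z.2‖ := norm_pos_iff.2 hz0
  have hgz := hg0 z
  have h4 := norm_pderiv_le_of_fibre_critical (x := z.1) (y := z.2) hg hg0 hz0 hc
  have h5 := hrad z.1 z.2 (hz2.trans_le (min_le_left _ _)) hz3 hzp hz0
    (h4.trans (mul_le_mul_of_nonneg_right hz1.le hF.le))
  have h6 : |fderiv ℝ g z (z.1 - p j, 0)| ≤ ‖fderiv ℝ g z‖ * ‖z.1 - p j‖ := by
    refine ((fderiv ℝ g z).le_opNorm _).trans (le_of_eq ?_)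
    simp [Prod.norm_def]
  have h7 : ‖fderiv ℝ g z‖ ≤ g z * K := by
    rw [div_lt_iff₀ hgz] at hz1
    linarith
  rw [fderiv_tubeFun_apply hg hz0]
  have h8 : (value (MvPolynomial.pderiv 0 f) z.1 z.2 * (z.1 - p j)
      + value (MvPolynomial.pderiv 1 f) z.1 z.2 * 0) * (starRingEnd ℂ) (value f z.1 z.2)
      = ((‖value f z.1 z.2‖ ^ 2 : ℝ) : ℂ) *
        ((z.1 - p j) * value (MvPolynomial.pderiv 0 f) z.1 z.2 / value f z.1 z.2) := by
    rw [← Complex.normSq_eq_norm_sq, ← Complex.mul_conj]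
    field_simp
    ring
  rw [h8, Complex.re_ofReal_mul]
  set q := ((z.1 - p j) * value (MvPolynomial.pderiv 0 f) z.1 z.2 / value f z.1 z.2).re
  have h9 : g z * (‖value f z.1 z.2‖ ^ 2 * q / ‖value f z.1 z.2‖)
      = ‖value f z.1 z.2‖ * (g z * q) := by
    field_simp
  rw [h9, ← mul_add]
  refine mul_pos hF ?_
  have h10 := (abs_le.1 h6).1
  have h11 := mul_le_mul_of_nonneg_right h7 (norm_nonneg (z.1 - p j))
  have h12 := mul_lt_mul_of_pos_left h5 hgz
  linarith

end Tube
end PlaneCurve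

namespace PlaneCurve
open Filter Topology Metric Set

/-! ### Metric geometry of regular arcs. -/

section Arcs

variable {γ σ : ℝ → ℂ}

/-- The tangent line approximates the arc to second order, uniformly. -/
theorem exists_second_order_bound (hγ : ContDiff ℝ ∞ γ) :
    ∃ C > 0, ∀ s ∈ Icc (0 : ℝ) 1, ∀ s' ∈ Icc (0 : ℝ) 1,
      ‖γ s' - γ s - (s' - s) • deriv γ s‖ ≤ C * (s' - s) ^ 2 := by
  have hd : ContDiff ℝ ∞ (deriv γ) := (contDiff_infty_iff_deriv.1 hγ).2
  have hdd : Continuous (deriv (deriv γ)) := hd.continuous_deriv (by simp)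
  obtain ⟨C, hC⟩ := (isCompact_Icc (a := (0 : ℝ)) (b := 1)).exists_bound_of_continuousOn
    hdd.continuousOn
  have hlip : ∀ s ∈ Icc (0 : ℝ) 1, ∀ s' ∈ Icc (0 : ℝ) 1,
      ‖deriv γ s' - deriv γ s‖ ≤ C * ‖s' - s‖ := fun s hs s' hs' =>
    (convex_Icc 0 1).norm_image_sub_le_of_norm_deriv_le
      (fun x _ => hd.differentiable (by simp) x) hC hs hs'
  have hC0 : 0 ≤ C := (norm_nonneg _).trans (hC 0 (by simp))
  refine ⟨C + 1, by positivity, fun s hs s' hs' => ?_⟩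
  have h1 : ∀ x ∈ uIcc s s', HasDerivWithinAt (fun t => γ t - t • deriv γ s)
      (deriv γ x - (1 : ℝ) • deriv γ s) (uIcc s s') x := fun x _ =>
    ((hγ.differentiable (by simp) x).hasDerivAt.sub
      ((hasDerivAt_id x).smul_const (deriv γ s))).hasDerivWithinAt
  have h2 : ∀ x ∈ uIcc s s', ‖deriv γ x - (1 : ℝ) • deriv γ s‖ ≤ C * ‖s' - s‖ := by
    intro x hx
    rw [one_smul]
    refine (hlip s hs x (uIcc_subset_Icc hs hs' hx)).trans ?_
    have := abs_sub_left_of_mem_uIcc hx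
    rw [Real.norm_eq_abs, Real.norm_eq_abs]
    gcongr
  have h3 := (convex_uIcc s s').norm_image_sub_le_of_norm_hasDerivWithin_le h1 h2
    left_mem_uIcc right_mem_uIcc
  have h4 : γ s' - s' • deriv γ s - (γ s - s • deriv γ s)
      = γ s' - γ s - (s' - s) • deriv γ s := by
    rw [sub_smul]; abel
  rw [h4, mul_assoc, ← sq, Real.norm_eq_abs, sq_abs] at h3
  nlinarith [sq_nonneg (s' - s)]

theorem isCompact_arc (hγ : ContDiff ℝ ∞ γ) : IsCompact (arc γ) :=
  isCompact_Icc.image hγ.continuous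

theorem arc_nonempty : (arc γ).Nonempty := ⟨γ 0, 0, by simp, rfl⟩

/-- A regular injective arc is bi-Lipschitz. -/
theorem exists_bilipschitz (hγ : ContDiff ℝ ∞ γ) (hreg : ∀ t ∈ Icc (0 : ℝ) 1, deriv γ t ≠ 0)
    (hinj : InjOn γ (Icc 0 1)) :
    ∃ m > 0, ∀ s ∈ Icc (0 : ℝ) 1, ∀ s' ∈ Icc (0 : ℝ) 1, m * |s' - s| ≤ ‖γ s' - γ s‖ := by
  obtain ⟨C, hC, hC2⟩ := exists_second_order_bound hγ
  have hd : Continuous (deriv γ) := hγ.continuous_deriv (by simp)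
  obtain ⟨t₀, ht₀, hmin⟩ := (isCompact_Icc (a := (0 : ℝ)) (b := 1)).exists_isMinOn ⟨0, by simp⟩
    hd.norm.continuousOn
  have hμ : 0 < ‖deriv γ t₀‖ := norm_pos_iff.2 (hreg t₀ ht₀)
  set μ := ‖deriv γ t₀‖ with hμd
  -- Parameters at distance at least `μ / (2 * C)` are handled by compactness and injectivity. For
  -- closer ones the quadratic error is at most half of the linear term.
  let S : Set (ℝ × ℝ) := {z | z.1 ∈ Icc (0 : ℝ) 1 ∧ z.2 ∈ Icc (0 : ℝ) 1 ∧ μ / (2 * C) ≤ |z.2 - z.1|}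
  have hS : IsCompact S := by
    refine ((isCompact_Icc (a := (0 : ℝ)) (b := 1)).prod
      (isCompact_Icc (a := (0 : ℝ)) (b := 1))).of_isClosed_subset ?_ fun z hz => ⟨hz.1, hz.2.1⟩
    exact (isClosed_Icc.preimage continuous_fst).inter
      ((isClosed_Icc.preimage continuous_snd).inter
        (isClosed_le continuous_const (by fun_prop : Continuous fun z : ℝ × ℝ => |z.2 - z.1|)))
  have hγc := hγ.continuous
  obtain ⟨m', hm', hm2⟩ : ∃ m' > 0, ∀ z ∈ S, m' ≤ ‖γ z.2 - γ z.1‖ := by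
    rcases S.eq_empty_or_nonempty with h | h
    · exact ⟨1, one_pos, by simp [h]⟩
    · obtain ⟨z, hz, hzm⟩ := hS.exists_isMinOn h
        (by fun_prop : Continuous fun z : ℝ × ℝ => ‖γ z.2 - γ z.1‖).continuousOn
      refine ⟨_, ?_, hzm⟩
      refine norm_pos_iff.2 (sub_ne_zero.2 fun he => ?_)
      have h1 := hz.2.2
      rw [hinj hz.2.1 hz.1 he, sub_self, abs_zero] at h1
      exact absurd h1 (not_le.2 (by positivity))
  refine ⟨min (μ / 2) m', by positivity, fun s hs s' hs' => ?_⟩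
  rcases le_or_gt (μ / (2 * C)) |s' - s| with h | h
  · refine le_trans ?_ (hm2 (s, s') ⟨hs, hs', h⟩)
    have h1 : |s' - s| ≤ 1 := abs_le.2 ⟨by linarith [hs.2, hs'.1], by linarith [hs.1, hs'.2]⟩
    calc _ ≤ m' * 1 := mul_le_mul (min_le_right _ _) h1 (abs_nonneg _) hm'.le
      _ = m' := mul_one _
  · have h1 := hC2 s hs s' hs'
    have h2 : ‖(s' - s) • deriv γ s‖ ≤ ‖γ s' - γ s‖ + ‖γ s' - γ s - (s' - s) • deriv γ s‖ := by
      have := norm_sub_le (γ s' - γ s) (γ s' - γ s - (s' - s) • deriv γ s)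
      rwa [sub_sub_cancel] at this
    rw [norm_smul, Real.norm_eq_abs] at h2
    have h3 : μ ≤ ‖deriv γ s‖ := hmin hs
    have h4 : C * (s' - s) ^ 2 ≤ μ / 2 * |s' - s| := by
      rw [← sq_abs, sq, ← mul_assoc]
      refine mul_le_mul_of_nonneg_right ?_ (abs_nonneg _)
      rw [lt_div_iff₀ (by positivity)] at h
      linarith
    have h5 := mul_le_mul_of_nonneg_left h3 (abs_nonneg (s' - s))
    have h6 := mul_le_mul_of_nonneg_right (min_le_left (μ / 2) m') (abs_nonneg (s' - s))
    linarith

/-- Two arcs which meet only in their common starting point, where they have different directions,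
separate linearly. -/
theorem exists_linear_separation (hγ : ContDiff ℝ ∞ γ) (hσ : ContDiff ℝ ∞ σ)
    (hγi : InjOn γ (Icc 0 1)) (hσi : InjOn σ (Icc 0 1)) {p₀ : ℂ} (hγ0 : γ 0 = p₀) (hσ0 : σ 0 = p₀)
    (hinter : arc γ ∩ arc σ = {p₀}) (hdir : ¬ SameRay ℝ (deriv γ 0) (deriv σ 0)) :
    ∃ m > 0, ∀ s ∈ Icc (0 : ℝ) 1, ∀ s' ∈ Icc (0 : ℝ) 1, m * (s + s') ≤ ‖γ s - σ s'‖ := by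
  obtain ⟨C, hC, hC2⟩ := exists_second_order_bound hγ
  obtain ⟨C', hC', hC2'⟩ := exists_second_order_bound hσ
  have h01 : (0 : ℝ) ∈ Icc (0 : ℝ) 1 := by simp
  -- The linearized statement: by homogeneity it suffices to take `s + s' = 1`, where the difference
  -- cannot vanish for different directions.
  obtain ⟨μ, hμ, hμ2⟩ : ∃ μ > 0, ∀ s, 0 ≤ s → ∀ s', 0 ≤ s' →
      μ * (s + s') ≤ ‖s • deriv γ 0 - s' • deriv σ 0‖ := by
    obtain ⟨t, ht, hmin⟩ := (isCompact_Icc (a := (0 : ℝ)) (b := 1)).exists_isMinOn ⟨0, by simp⟩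
      (by fun_prop : Continuous fun t : ℝ => ‖t • deriv γ 0 - (1 - t) • deriv σ 0‖).continuousOn
    refine ⟨‖t • deriv γ 0 - (1 - t) • deriv σ 0‖,
      norm_pos_iff.2 (sub_ne_zero.2 fun he => hdir ?_), fun s hs s' hs' => ?_⟩
    · rcases ht.1.eq_or_lt with h | h
      · rw [← h, zero_smul, sub_zero, one_smul] at he
        rw [← he]
        exact SameRay.zero_right _
      rcases ht.2.eq_or_lt with h' | h'
      · rw [h', sub_self, zero_smul, one_smul] at he
        rw [he]
        exact SameRay.zero_left _
      · exact Or.inr (Or.inr ⟨t, 1 - t, h, by linarith, he⟩)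
    · rcases (add_nonneg hs hs').eq_or_lt with h | h
      · rw [← h, mul_zero]
        exact norm_nonneg _
      have h1 := hmin (show s / (s + s') ∈ Icc (0 : ℝ) 1 from
        ⟨by positivity, by rw [div_le_one h]; linarith⟩)
      have h2 : s • deriv γ 0 - s' • deriv σ 0
          = (s + s') • ((s / (s + s')) • deriv γ 0 - (1 - s / (s + s')) • deriv σ 0) := by
        rw [smul_sub, smul_smul, smul_smul]
        congr 2
        · field_simp
        · field_simp; ring
      rw [h2, norm_smul, Real.norm_of_nonneg h.le, mul_comm]
      exact mul_le_mul_of_nonneg_left h1 h.le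
  set η := μ / (2 * (C + C')) with hη
  have hη0 : 0 < η := by positivity
  let S : Set (ℝ × ℝ) := {z | z.1 ∈ Icc (0 : ℝ) 1 ∧ z.2 ∈ Icc (0 : ℝ) 1 ∧ η ≤ z.1 + z.2}
  have hS : IsCompact S := by
    refine ((isCompact_Icc (a := (0 : ℝ)) (b := 1)).prod
      (isCompact_Icc (a := (0 : ℝ)) (b := 1))).of_isClosed_subset ?_ fun z hz => ⟨hz.1, hz.2.1⟩
    exact (isClosed_Icc.preimage continuous_fst).inter
      ((isClosed_Icc.preimage continuous_snd).inter
        (isClosed_le continuous_const (by fun_prop : Continuous fun z : ℝ × ℝ => z.1 + z.2)))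
  have hγc := hγ.continuous
  have hσc := hσ.continuous
  obtain ⟨m', hm', hm2⟩ : ∃ m' > 0, ∀ z ∈ S, m' ≤ ‖γ z.1 - σ z.2‖ := by
    rcases S.eq_empty_or_nonempty with h | h
    · exact ⟨1, one_pos, by simp [h]⟩
    · obtain ⟨z, hz, hzm⟩ := hS.exists_isMinOn h
        (by fun_prop : Continuous fun z : ℝ × ℝ => ‖γ z.1 - σ z.2‖).continuousOn
      refine ⟨_, ?_, hzm⟩
      refine norm_pos_iff.2 (sub_ne_zero.2 fun he => ?_)
      have h1 : γ z.1 ∈ arc γ ∩ arc σ := ⟨⟨z.1, hz.1, rfl⟩, he ▸ ⟨z.2, hz.2.1, rfl⟩⟩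
      rw [hinter, mem_singleton_iff] at h1
      have h2 := hγi hz.1 h01 (h1.trans hγ0.symm)
      have h3 := hσi hz.2.1 h01 ((he.symm.trans h1).trans hσ0.symm)
      have h4 := hz.2.2
      rw [h2, h3, add_zero] at h4
      exact absurd h4 (not_le.2 hη0)
  refine ⟨min (μ / 2) (m' / 2), by positivity, fun s hs s' hs' => ?_⟩
  have hss : 0 ≤ s + s' := add_nonneg hs.1 hs'.1
  rcases le_or_gt η (s + s') with h | h
  · refine le_trans ?_ (hm2 (s, s') ⟨hs, hs', h⟩)
    calc _ ≤ m' / 2 * 2 := mul_le_mul (min_le_right _ _) (by linarith [hs.2, hs'.2]) hss (by positivity)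
      _ = m' := by ring
  · have h1 := hC2 0 h01 s hs
    have h1' := hC2' 0 h01 s' hs'
    rw [sub_zero, hγ0] at h1
    rw [sub_zero, hσ0] at h1'
    have h2 : ‖s • deriv γ 0 - s' • deriv σ 0‖ ≤ ‖γ s - σ s'‖ + ‖γ s - p₀ - s • deriv γ 0‖
        + ‖σ s' - p₀ - s' • deriv σ 0‖ := by
      have h3 : s • deriv γ 0 - s' • deriv σ 0
        = (γ s - σ s') - (γ s - p₀ - s • deriv γ 0) + (σ s' - p₀ - s' • deriv σ 0) := by abel
      rw [h3]
      refine (norm_add_le _ _).trans (add_le_add_left ?_ _)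
      exact norm_sub_le _ _
    have h3 := hμ2 s hs.1 s' hs'.1
    have h4 : C * s ^ 2 + C' * s' ^ 2 ≤ μ / 2 * (s + s') := by
      have h5 : (C + C') * (s + s') ≤ μ / 2 := by
        rw [hη, lt_div_iff₀ (by positivity)] at h
        linarith
      have h6 := mul_le_mul_of_nonneg_right h5 hss
      have h7 := mul_nonneg hs.1 hs'.1
      nlinarith [mul_nonneg hC.le (sq_nonneg s'), mul_nonneg hC'.le (sq_nonneg s),
        mul_nonneg hC.le h7, mul_nonneg hC'.le h7]
    have h6 := mul_le_mul_of_nonneg_right (min_le_left (μ / 2) (m' / 2)) hss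
    linarith

/-- First order condition at a nearest point of an arc. -/
theorem inner_deriv_nonpos_of_nearest (hγ : ContDiff ℝ ∞ γ) {x : ℂ} {s : ℝ}
    (hs : s ∈ Icc (0 : ℝ) 1) (h : dist x (γ s) = infDist x (arc γ)) {s' : ℝ}
    (hs' : s' ∈ Icc (0 : ℝ) 1) : (s' - s) * inner ℝ (x - γ s) (deriv γ s) ≤ 0 := by
  have h1 : IsMinOn (fun t => ‖x - γ t‖ ^ 2) (Icc (0 : ℝ) 1) s := by
    intro t ht
    have h2 : dist x (γ s) ≤ dist x (γ t) := h ▸ infDist_le_dist_of_mem ⟨t, ht, rfl⟩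
    rw [dist_eq_norm, dist_eq_norm] at h2
    exact pow_le_pow_left₀ (norm_nonneg _) h2 2
  have h2 : HasDerivAt (fun t => ‖x - γ t‖ ^ 2) (2 * inner ℝ (x - γ s) (0 - deriv γ s)) s :=
    ((hasDerivAt_const s x).sub (hγ.differentiable (by simp) s).hasDerivAt).norm_sq
  have h3 := h1.localize.hasFDerivWithinAt_nonneg h2.hasFDerivAt.hasFDerivWithinAt
    (sub_mem_posTangentConeAt_of_segment_subset ((convex_Icc (0 : ℝ) 1).segment_subset hs hs'))
  simp only [ContinuousLinearMap.toSpanSingleton_apply, zero_sub, inner_neg_right,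
    smul_eq_mul] at h3
  linarith

theorem exists_nearest (hγ : ContDiff ℝ ∞ γ) (x : ℂ) :
    ∃ s ∈ Icc (0 : ℝ) 1, dist x (γ s) = infDist x (arc γ) := by
  obtain ⟨q, ⟨s, hs, rfl⟩, hq⟩ := (isCompact_arc hγ).exists_infDist_eq_dist arc_nonempty x
  exact ⟨s, hs, hq.symm⟩

/-- Points near an arc have a unique nearest point on it. -/
theorem exists_unique_nearest_of_infDist_lt (hγ : ContDiff ℝ ∞ γ)
    (hreg : ∀ t ∈ Icc (0 : ℝ) 1, deriv γ t ≠ 0) (hinj : InjOn γ (Icc 0 1)) :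
    ∃ δ₀ > 0, ∀ x, infDist x (arc γ) < δ₀ → ∀ q ∈ arc γ, ∀ q' ∈ arc γ,
      dist x q = infDist x (arc γ) → dist x q' = infDist x (arc γ) → q = q' := by
  obtain ⟨C, hC, hC2⟩ := exists_second_order_bound hγ
  obtain ⟨m, hm, hm2⟩ := exists_bilipschitz hγ hreg hinj
  refine ⟨m ^ 2 / (2 * C), by positivity, ?_⟩
  rintro x hx _ ⟨s, hs, rfl⟩ _ ⟨s', hs', rfl⟩ h h'
  by_contra hne
  have hss : s' - s ≠ 0 := fun h0 => hne (by rw [sub_eq_zero.1 h0])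
  have h1 := inner_deriv_nonpos_of_nearest hγ hs h hs'
  have h2 := hC2 s hs s' hs'
  have h3 := hm2 s hs s' hs'
  -- With equal distances this gives `‖γ s' - γ s‖² = 2⟨x - γ s, γ s' - γ s⟩`. The tangential part
  -- is nonpositive since `γ s` is nearest, so the right side is at most `2 * C * (s' - s)²` times
  -- the distance, against `m² (s' - s)²` on the left.
  have h4 : ‖x - γ s'‖ ^ 2 = ‖x - γ s‖ ^ 2 - 2 * inner ℝ (x - γ s) (γ s' - γ s)
      + ‖γ s' - γ s‖ ^ 2 := by
    rw [← norm_sub_sq_real]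
    congr 2
    abel
  rw [← dist_eq_norm, ← dist_eq_norm x, h, h'] at h4
  have h5 : inner ℝ (x - γ s) (γ s' - γ s) = (s' - s) * inner ℝ (x - γ s) (deriv γ s)
      + inner ℝ (x - γ s) (γ s' - γ s - (s' - s) • deriv γ s) := by
    rw [inner_sub_right _ (γ s' - γ s), inner_smul_right]
    ring
  have h6 : inner ℝ (x - γ s) (γ s' - γ s - (s' - s) • deriv γ s)
      ≤ infDist x (arc γ) * (C * (s' - s) ^ 2) := by
    refine (real_inner_le_norm _ _).trans ?_
    rw [← dist_eq_norm x, h]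
    exact mul_le_mul_of_nonneg_left h2 infDist_nonneg
  have h7 : m ^ 2 * (s' - s) ^ 2 ≤ ‖γ s' - γ s‖ ^ 2 := by
    rw [← sq_abs (s' - s), ← mul_pow]
    exact pow_le_pow_left₀ (by positivity) h3 2
  have h8 : 0 < (s' - s) ^ 2 := by positivity
  rw [lt_div_iff₀ (by positivity)] at hx
  nlinarith [mul_lt_mul_of_pos_right hx h8]

end Arcs
end PlaneCurve

namespace PlaneCurve
open Filter Topology Metric Set

/-! ### An arc ending transversely in a circle: normals of tube and circle. -/

section Ends

variable {γ : ℝ → ℂ}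

/-- Where the boundary of the tube around an arc meets a circle in which the arc ends
transversely, the normals of the two are not parallel. -/
theorem exists_not_parallel_of_nearest (hγ : ContDiff ℝ ∞ γ) {c : ℂ} {R : ℝ} (hR : 0 < R)
    (hend : γ 1 ∈ sphere c R) (hne : ∀ t ∈ Ico (0 : ℝ) 1, γ t ∉ sphere c R)
    (htr : inner ℝ (γ 1 - c) (deriv γ 1) ≠ 0) :
    ∃ δ₀ > 0, ∀ x ∈ sphere c R, x ∉ arc γ → infDist x (arc γ) < δ₀ → ∀ q ∈ arc γ,
      dist x q = infDist x (arc γ) → ∀ l : ℝ, x - q ≠ l • (x - c) := by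
  have hd : Continuous (deriv γ) := hγ.continuous_deriv (by simp)
  have hγc := hγ.continuous
  have h1 : ∀ᶠ z : ℂ × ℝ in 𝓝 (γ 1, 1), inner ℝ (z.1 - c) (deriv γ z.2) ≠ 0 :=
    (by fun_prop : Continuous fun z : ℂ × ℝ =>
      inner ℝ (z.1 - c) (deriv γ z.2)).continuousAt.eventually_ne htr
  obtain ⟨η, hη, hη2⟩ := Metric.eventually_nhds_iff.1 h1
  obtain ⟨η', hη', hη2'⟩ := Metric.eventually_nhds_iff.1
    (hγc.continuousAt.eventually (Metric.ball_mem_nhds (γ 1) (half_pos hη)))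
  set ζ := min (min η η') 1 with hζ
  have hζ0 : 0 < ζ := by positivity
  -- Away from its end the arc keeps a distance `d` from the circle, so a point of the circle close
  -- to the arc has its nearest parameters close to 1.
  obtain ⟨d, hd0, hd2⟩ : ∃ d > 0, ∀ t ∈ Icc (0 : ℝ) (1 - ζ), d ≤ |dist (γ t) c - R| := by
    rcases (Icc (0 : ℝ) (1 - ζ)).eq_empty_or_nonempty with h | h
    · exact ⟨1, one_pos, by simp [h]⟩
    · obtain ⟨t, ht, hmin⟩ := isCompact_Icc.exists_isMinOn h
        (by fun_prop : Continuous fun t : ℝ => |dist (γ t) c - R|).continuousOn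
      exact ⟨_, abs_pos.2 (sub_ne_zero.2 (hne t ⟨ht.1, by linarith [ht.2]⟩)), hmin⟩
  refine ⟨min (min d (η / 2)) R, by positivity, ?_⟩
  rintro x hx hxa hxδ _ ⟨s, hs, rfl⟩ hq l hl
  have hdx : dist x (γ s) < min (min d (η / 2)) R := hq ▸ hxδ
  have hs1 : 1 - ζ < s := by
    by_contra hcon
    have h2 := hd2 s ⟨hs.1, not_lt.1 hcon⟩
    have h3 : |dist (γ s) c - R| ≤ dist x (γ s) := by
      rw [← mem_sphere.1 hx, dist_comm x (γ s)]
      exact abs_dist_sub_le _ _ _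
    exact absurd (hdx.trans_le ((min_le_left _ _).trans (min_le_left _ _))) (not_lt.2 (h2.trans h3))
  have hs2 : |s - 1| < ζ := abs_lt.2 ⟨by linarith, by linarith [hs.2]⟩
  have hl0 : l ≠ 0 := by
    rintro rfl
    rw [zero_smul, sub_eq_zero] at hl
    exact hxa (hl ▸ ⟨s, hs, rfl⟩)
  -- If the nearest point is the end, parallelism makes `x` antipodal to it (`l = 2`), at distance
  -- `2 * R`, too far. Otherwise `x - γ s` is orthogonal to the arc, hence so is `x - c`, against
  -- transversality near the end.
  rcases hs.2.eq_or_lt with h | h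
  · subst h
    have h2 : γ 1 - c = (1 - l) • (x - c) := by
      rw [sub_smul, one_smul, ← hl]; abel
    have h3 := congrArg norm h2
    rw [norm_smul, mem_sphere_iff_norm.1 hend, mem_sphere_iff_norm.1 hx, Real.norm_eq_abs] at h3
    have h4 : |1 - l| = 1 := by
      have : R * (|1 - l| - 1) = 0 := by linarith
      linarith [(mul_eq_zero.1 this).resolve_left hR.ne']
    have h5 : l = 2 := by
      rcases eq_or_eq_neg_of_abs_eq h4 with h5 | h5
      · exact absurd (by linarith) hl0
      · linarith
    have h6 := congrArg norm hl
    rw [h5, norm_smul, ← dist_eq_norm, mem_sphere_iff_norm.1 hx, Real.norm_eq_abs] at h6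
    have h7 := hdx.trans_le (min_le_right _ _)
    rw [h6] at h7
    norm_num at h7
    linarith
  · have hs0 : 0 < s := by linarith [min_le_right (min η η') 1]
    have h2 := inner_deriv_nonpos_of_nearest hγ hs hq (s' := 0) (by simp)
    have h3 := inner_deriv_nonpos_of_nearest hγ hs hq (s' := 1) (by simp)
    have h4 : inner ℝ (x - γ s) (deriv γ s) = 0 := by
      refine le_antisymm ?_ ?_
      · by_contra hcon
        have := mul_pos (sub_pos.2 h) (not_le.1 hcon)
        linarith
      · by_contra hcon
        have := mul_neg_of_pos_of_neg hs0 (not_le.1 hcon)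
        linarith
    rw [hl, inner_smul_left] at h4
    have h5 := (mul_eq_zero.1 h4).resolve_left (by simpa using hl0)
    have h6 : dist (γ s) (γ 1) < η / 2 := hη2' (by
      rw [Real.dist_eq]
      exact hs2.trans_le ((min_le_left _ _).trans (min_le_right _ _)))
    refine hη2 (y := (x, s)) ?_ h5
    rw [Prod.dist_eq, max_lt_iff, Real.dist_eq]
    refine ⟨?_, hs2.trans_le ((min_le_left _ _).trans (min_le_left _ _))⟩
    have h7 := hdx.trans_le ((min_le_left _ _).trans (min_le_right _ _))
    linarith [dist_triangle x (γ s) (γ 1)]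

end Ends

/-! ### The interval cut out of a circle by the tube around an arc ending there. -/

section Slit

/-- A minimum over the interval can only sit at the left end. This substitutes for a derivative
test, since distance functions need not be differentiable. -/
theorem lt_of_frequently_left_lt {D : ℝ → ℝ} {a b : ℝ} (hab : a < b) (hD : ContinuousOn D (Icc a b))
    (h : ∀ t ∈ Ioc a b, ∃ᶠ s in 𝓝[<] t, D s < D t) : D a < D b := by
  obtain ⟨t, ht, hmin⟩ := isCompact_Icc.exists_isMinOn ⟨a, left_mem_Icc.2 hab.le⟩ hD
  have key : ∀ t ∈ Ioc a b, ∃ s ∈ Icc a b, D s < D t := by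
    intro t ht
    obtain ⟨s, hs, hs'⟩ := ((h t ht).and_eventually (Ioo_mem_nhdsLT ht.1)).exists
    exact ⟨s, ⟨hs'.1.le, hs'.2.le.trans ht.2⟩, hs⟩
  have hta : t = a := by
    by_contra hne
    obtain ⟨s, hs, hs'⟩ := key t ⟨lt_of_le_of_ne ht.1 (Ne.symm hne), ht.2⟩
    exact absurd hs' (not_lt.2 (hmin hs))
  subst hta
  obtain ⟨s, hs, hs'⟩ := key b (right_mem_Ioc.2 hab)
  exact (show D t ≤ D s from hmin hs).trans_lt hs'

theorem cos_lt_cos_of_abs {x h : ℝ} (h0 : 0 ≤ h) (h1 : h < |x|) (h2 : |x| < 2 * Real.pi - h) :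
    Real.cos x < Real.cos h := by
  rw [← Real.cos_abs x]
  rcases le_or_gt |x| Real.pi with hx | hx
  · exact Real.cos_lt_cos_of_nonneg_of_le_pi h0 hx h1
  · rw [← Real.cos_two_pi_sub]
    exact Real.cos_lt_cos_of_nonneg_of_le_pi h0 (by linarith) (by linarith)

variable {γ : ℝ → ℂ}

theorem inner_mul_I_mul_I (u v : ℂ) : inner ℝ (u * Complex.I) (v * Complex.I) = inner ℝ u v := by
  simp only [Complex.inner, Complex.mul_re, Complex.conj_re, Complex.conj_im, Complex.mul_im,
    Complex.I_re, Complex.I_im]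
  ring

/-- In the plane, orthogonality makes `u` a multiple of `w * I` when `w ≠ 0`, and both sides are
this multiple times `‖w‖² ⟨v, w⟩`. -/
theorem inner_mul_norm_sq_of_orthogonal {u v w : ℂ} (h : inner ℝ u w = 0) :
    inner ℝ u (v * Complex.I) * ‖w‖ ^ 2 = inner ℝ u (w * Complex.I) * inner ℝ v w := by
  simp only [Complex.inner, Complex.mul_re, Complex.conj_re, Complex.conj_im, Complex.mul_im,
    Complex.I_re, Complex.I_im] at h ⊢
  rw [← Complex.normSq_eq_norm_sq, Complex.normSq_apply]
  have h' : w.re * u.re = - (w.im * u.im) := by linarith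
  linear_combination (v.re * w.im - v.im * w.re) * h'

end Slit
end PlaneCurve

namespace PlaneCurve
open Filter Topology Metric Set

section Slit

variable {γ : ℝ → ℂ} {p : ℂ} {r : ℝ}

/-- The squared distance to `p` is minimal at parameter 1, so its one-sided derivative there is
nonpositive; transversality makes it nonzero. -/
theorem inner_deriv_neg_of_outside (hγ : ContDiff ℝ ∞ γ) (hend : γ 1 ∈ sphere p r)
    (hout : ∀ t ∈ Ico (0 : ℝ) 1, r < dist (γ t) p) (htr : inner ℝ (γ 1 - p) (deriv γ 1) ≠ 0) :
    inner ℝ (γ 1 - p) (deriv γ 1) < 0 := by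
  refine lt_of_le_of_ne ?_ htr
  have h1 : IsMinOn (fun t => ‖γ t - p‖ ^ 2) (Icc (0 : ℝ) 1) 1 := by
    intro t ht
    have h2 : dist (γ 1) p ≤ dist (γ t) p := by
      rcases ht.2.eq_or_lt with h | h
      · rw [h]
      · exact (mem_sphere.1 hend).le.trans (hout t ⟨ht.1, h⟩).le
    rw [dist_eq_norm, dist_eq_norm] at h2
    exact pow_le_pow_left₀ (norm_nonneg _) h2 2
  have h2 : HasDerivAt (fun t => ‖γ t - p‖ ^ 2) (2 * inner ℝ (γ 1 - p) (deriv γ 1)) 1 :=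
    ((hγ.differentiable (by simp) 1).hasDerivAt.sub_const p).norm_sq
  have h3 := h1.localize.hasFDerivWithinAt_nonneg h2.hasFDerivAt.hasFDerivWithinAt
    (sub_mem_posTangentConeAt_of_segment_subset
      ((convex_Icc (0 : ℝ) 1).segment_subset (by simp) (by simp : (0 : ℝ) ∈ Icc (0 : ℝ) 1)))
  simp only [ContinuousLinearMap.toSpanSingleton_apply, smul_eq_mul] at h3
  linarith

/-- The chord of angle `θ` has signed length `2 sin (θ / 2)` and is perpendicular to the bisecting
radius. -/
theorem exp_mul_I_sub_one (θ : ℝ) : Complex.exp (θ * Complex.I) - 1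
    = ((2 * Real.sin (θ / 2) : ℝ) : ℂ) * (Complex.exp ((θ / 2 : ℝ) * Complex.I) * Complex.I) := by
  have h1 : Complex.exp (θ * Complex.I) = Complex.exp ((θ / 2 : ℝ) * Complex.I) ^ 2 := by
    rw [← Complex.exp_nat_mul]
    congr 1
    push_cast
    ring
  rw [h1, Complex.exp_mul_I, ← Complex.ofReal_cos, ← Complex.ofReal_sin]
  have h2 : ((Real.cos (θ / 2) : ℝ) : ℂ) ^ 2 + ((Real.sin (θ / 2) : ℝ) : ℂ) ^ 2 = 1 := by
    exact_mod_cast Real.cos_sq_add_sin_sq (θ / 2)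
  push_cast at h2 ⊢
  linear_combination (-Complex.sin (θ / 2) ^ 2) * Complex.I_sq + h2

theorem sq_le_two_mul_mul_sin {θ : ℝ} (h : |θ| ≤ 1) : θ ^ 2 / 4 ≤ θ * Real.sin (θ / 2) := by
  have key : ∀ t : ℝ, 0 ≤ t → t ≤ 1 → t ^ 2 / 4 ≤ t * Real.sin (t / 2) := by
    intro t h0 h1
    have h2 := Real.mul_le_sin (x := t / 2) (by linarith) (by linarith [Real.pi_gt_three])
    have h3 : t / 4 ≤ 2 / Real.pi * (t / 2) := by
      rw [div_mul_div_comm, div_le_div_iff₀ (by norm_num) (by positivity)]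
      nlinarith [Real.pi_le_four]
    have h4 := mul_le_mul_of_nonneg_left (h3.trans h2) h0
    linarith [sq t]
  rcases le_total 0 θ with h0 | h0
  · exact key θ h0 (abs_le.1 h).2
  · have := key (-θ) (by linarith) (by linarith [(abs_le.1 h).1])
    rw [neg_div, Real.sin_neg] at this
    linarith [neg_sq θ]

/-- On a circle in which an arc ends transversely, the distance to the arc increases with the angle
to the end point. -/
theorem exists_angle_sign (hγ : ContDiff ℝ ∞ γ)
    (hreg : ∀ t ∈ Icc (0 : ℝ) 1, deriv γ t ≠ 0) (hinj : InjOn γ (Icc 0 1)) (hr : 0 < r)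
    (hend : γ 1 ∈ sphere p r) (hout : ∀ t ∈ Ico (0 : ℝ) 1, r < dist (γ t) p)
    (htr : inner ℝ (γ 1 - p) (deriv γ 1) ≠ 0) :
    ∃ θm > 0, θm ≤ 1 ∧ ∀ θ : ℝ, θ ≠ 0 → |θ| ≤ θm → ∀ q ∈ arc γ,
      dist (p + (γ 1 - p) * Complex.exp (θ * Complex.I)) q
        = infDist (p + (γ 1 - p) * Complex.exp (θ * Complex.I)) (arc γ) →
      0 < θ * inner ℝ (p + (γ 1 - p) * Complex.exp (θ * Complex.I) - q)
        ((γ 1 - p) * Complex.exp (θ * Complex.I) * Complex.I) := by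
  obtain ⟨C, hC, hC2⟩ := exists_second_order_bound hγ
  obtain ⟨m, hm, hm2⟩ := exists_bilipschitz hγ hreg hinj
  have hd : Continuous (deriv γ) := hγ.continuous_deriv (by simp)
  obtain ⟨M, hM⟩ := (isCompact_Icc (a := (0 : ℝ)) (b := 1)).exists_bound_of_continuousOn
    hd.continuousOn
  have hM0 : 0 ≤ M := (norm_nonneg _).trans (hM 0 (by simp))
  have hneg := inner_deriv_neg_of_outside hγ hend hout htr
  set e := γ 1 - p with he
  have hen : ‖e‖ = r := mem_sphere_iff_norm.1 hend
  set κ := -inner ℝ e (deriv γ 1) / 2 with hκ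
  have hκ0 : 0 < κ := by linarith
  have h1 : ∀ᶠ z : ℝ × ℝ in 𝓝 (0, 1),
      inner ℝ (e * Complex.exp (z.1 * Complex.I)) (deriv γ z.2) < -κ := by
    refine (by fun_prop : Continuous fun z : ℝ × ℝ =>
      inner ℝ (e * Complex.exp (z.1 * Complex.I)) (deriv γ z.2)).continuousAt.eventually_lt_const ?_
    simp only [Complex.ofReal_zero, zero_mul, Complex.exp_zero, mul_one]
    linarith
  obtain ⟨η, hη, hη2⟩ := Metric.eventually_nhds_iff.1 h1
  have hη3 : ∀ θ s : ℝ, |θ| < η → |s - 1| < η →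
      inner ℝ (e * Complex.exp (θ * Complex.I)) (deriv γ s) < -κ := fun θ s h h' =>
    hη2 (y := (θ, s)) (by rw [Prod.dist_eq, max_lt_iff, Real.dist_eq, Real.dist_eq]; simpa using ⟨h, h'⟩)
  set G := C * M * (2 * r / m) ^ 2 with hG
  have hG0 : 0 ≤ G := by positivity
  -- The bounds keep the angle in the range where transversality persists, force the nearest
  -- parameter within `min η 1` of 1, and make the error `|θ| * G * θ²` smaller than the main term
  -- of order `κ * θ²`.
  refine ⟨min (min 1 (η / 2)) (min (min η 1 * m / (4 * r)) (κ / (4 * (G + 1)))), by positivity,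
    (min_le_left _ _).trans (min_le_left _ _), ?_⟩
  rintro θ hθ0 hθ _ ⟨s, hs, rfl⟩ hq
  have hθ1 : |θ| ≤ 1 := hθ.trans ((min_le_left _ _).trans (min_le_left _ _))
  have hθη : |θ| < η := by
    have := hθ.trans ((min_le_left _ _).trans (min_le_right _ _))
    linarith
  have hθm : |θ| * (2 * r) < min η 1 * m := by
    have := hθ.trans ((min_le_right _ _).trans (min_le_left _ _))
    rw [le_div_iff₀ (by positivity)] at this
    have h0 := abs_pos.2 hθ0
    nlinarith [mul_pos h0 hr]
  have hθG : |θ| * G < κ / 2 := by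
    have := hθ.trans ((min_le_right _ _).trans (min_le_right _ _))
    rw [le_div_iff₀ (by positivity)] at this
    have h0 := abs_pos.2 hθ0
    nlinarith
  set a := p + e * Complex.exp (θ * Complex.I) with ha
  have haγ : a - γ 1 = ((2 * Real.sin (θ / 2) : ℝ) : ℂ) *
      (e * Complex.exp ((θ / 2 : ℝ) * Complex.I) * Complex.I) := by
    have h2 := exp_mul_I_sub_one θ
    have h3 : a - γ 1 = e * (Complex.exp (θ * Complex.I) - 1) := by
      rw [ha, he]; ring
    rw [h3, h2]
    ring
  have hsin := sq_le_two_mul_mul_sin hθ1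
  rcases hs.2.eq_or_lt with h | h
  · subst h
    have h2 : inner ℝ (a - γ 1) (e * Complex.exp (θ * Complex.I) * Complex.I) = r ^ 2 * Real.sin θ := by
      have h3 : a - γ 1 = e * (Complex.exp (θ * Complex.I) - 1) := by
        rw [ha, he]; ring
      rw [h3, ← hen, ← Complex.normSq_eq_norm_sq, Complex.normSq_apply, Complex.exp_mul_I,
        ← Complex.ofReal_cos, ← Complex.ofReal_sin]
      simp only [Complex.inner, Complex.mul_re, Complex.conj_re, Complex.conj_im, Complex.mul_im,
        Complex.I_re, Complex.I_im, Complex.add_re, Complex.add_im, Complex.sub_re, Complex.sub_im,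
        Complex.ofReal_re, Complex.ofReal_im, Complex.one_re, Complex.one_im]
      have h5 := Real.cos_sq_add_sin_sq θ
      ring
    rw [h2]
    have h3 : 0 < θ * Real.sin θ := by
      rcases lt_or_gt_of_ne hθ0 with h0 | h0
      · refine mul_pos_of_neg_of_neg h0 (Real.sin_neg_of_neg_of_neg_pi_lt h0 ?_)
        linarith [(abs_le.1 hθ1).1, Real.pi_gt_three]
      · refine mul_pos h0 (Real.sin_pos_of_pos_of_lt_pi h0 ?_)
        linarith [(abs_le.1 hθ1).2, Real.pi_gt_three]
    have : 0 < r ^ 2 * (θ * Real.sin θ) := by positivity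
    linarith
  have hchord : ‖a - γ 1‖ ≤ r * |θ| := by
    rw [haγ, norm_mul, norm_mul, norm_mul, hen, Complex.norm_exp_ofReal_mul_I, Complex.norm_I,
      Complex.norm_real, Real.norm_eq_abs, abs_mul, abs_two]
    have := Real.abs_sin_le_abs (x := θ / 2)
    rw [abs_div, abs_two] at this
    nlinarith
  -- The nearest point is no farther from `a` than `γ 1` is, so its distance from `γ 1` is at most
  -- twice the chord.
  have hsm : m * (1 - s) ≤ |θ| * (2 * r) := by
    have h2 := hm2 s hs 1 (by simp)
    rw [abs_of_pos (sub_pos.2 h)] at h2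
    have h3 : dist a (γ s) ≤ dist a (γ 1) := hq ▸ infDist_le_dist_of_mem ⟨1, by simp, rfl⟩
    rw [dist_eq_norm, dist_eq_norm] at h3
    have h4 : ‖γ 1 - γ s‖ ≤ ‖a - γ s‖ + ‖a - γ 1‖ := by
      have := norm_sub_le (a - γ s) (a - γ 1)
      rwa [sub_sub_sub_cancel_left] at this
    linarith
  have hs1 : 1 - s < min η 1 := by
    refine lt_of_mul_lt_mul_left (a := m) ?_ hm.le
    linarith
  have hs0 : 0 < s := by linarith [min_le_right η 1]
  have hsη : |s - 1| < η := by
    rw [abs_sub_comm, abs_of_pos (sub_pos.2 h)]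
    exact hs1.trans_le (min_le_left _ _)
  set w := deriv γ s with hw
  have hw0 : 0 < ‖w‖ := norm_pos_iff.2 (hreg s hs)
  have horth : inner ℝ (a - γ s) w = 0 := by
    have h2 := inner_deriv_nonpos_of_nearest hγ hs hq (s' := 0) (by simp)
    have h3 := inner_deriv_nonpos_of_nearest hγ hs hq (s' := 1) (by simp)
    refine le_antisymm ?_ ?_
    · by_contra hcon
      have := mul_pos (sub_pos.2 h) (not_le.1 hcon)
      linarith
    · by_contra hcon
      have := mul_neg_of_pos_of_neg hs0 (not_le.1 hcon)
      linarith
  have hν := hη3 θ s hθη hsη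
  have hmid := hη3 (θ / 2) s (by rw [abs_div, abs_two]; linarith [abs_nonneg θ]) hsη
  have key := inner_mul_norm_sq_of_orthogonal (v := e * Complex.exp (θ * Complex.I)) horth
  -- Expand `a - γ s` as the chord to `γ 1`, a second order error, and a multiple of `w`. Against `w
  -- * I` the last drops out, and the chord gives `2 sin (θ / 2)` times a negative number, because
  -- the arc runs inwards at its end.
  have h2 : θ * inner ℝ (a - γ s) (w * Complex.I) < 0 := by
    have h3 : a - γ s = (a - γ 1) + (γ 1 - γ s - (1 - s) • w) + (1 - s) • w := by abel
    have h4 : inner ℝ w (w * Complex.I) = 0 := by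
      simp only [Complex.inner, Complex.mul_re, Complex.conj_re, Complex.conj_im, Complex.mul_im,
        Complex.I_re, Complex.I_im]
      ring
    have h5 : inner ℝ (a - γ 1) (w * Complex.I)
        = 2 * Real.sin (θ / 2) * inner ℝ (e * Complex.exp ((θ / 2 : ℝ) * Complex.I)) w := by
      rw [haγ, ← Complex.real_smul, inner_smul_left, inner_mul_I_mul_I]
      simp
    have h6 : |inner ℝ (γ 1 - γ s - (1 - s) • w) (w * Complex.I)| ≤ C * (1 - s) ^ 2 * M := by
      refine (abs_real_inner_le_norm _ _).trans ?_
      rw [norm_mul, Complex.norm_I, mul_one]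
      exact mul_le_mul (hC2 s hs 1 (by simp)) (hM s hs) (norm_nonneg _) (by positivity)
    have h7 : C * (1 - s) ^ 2 * M ≤ G * θ ^ 2 := by
      have h8 : (1 - s) ≤ 2 * r / m * |θ| := by
        rw [div_mul_eq_mul_div, le_div_iff₀ hm]; linarith
      have h9 := pow_le_pow_left₀ (sub_pos.2 h).le h8 2
      rw [mul_pow, sq_abs] at h9
      have h10 := mul_le_mul_of_nonneg_left h9 (mul_nonneg hC.le hM0)
      rw [hG]
      linarith
    rw [h3, inner_add_left, inner_add_left, inner_smul_left, h4, mul_zero, add_zero, h5, mul_add]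
    have h8 : θ * inner ℝ (γ 1 - γ s - (1 - s) • w) (w * Complex.I) ≤ |θ| * (G * θ ^ 2) := by
      refine (le_abs_self _).trans ?_
      rw [abs_mul]
      exact mul_le_mul_of_nonneg_left (h6.trans h7) (abs_nonneg _)
    have hθ2 : 0 < θ ^ 2 := by positivity
    have h9 : |θ| * (G * θ ^ 2) < κ / 2 * θ ^ 2 := by
      rw [← mul_assoc]
      exact mul_lt_mul_of_pos_right hθG hθ2
    have h10 : θ * (2 * Real.sin (θ / 2) * inner ℝ (e * Complex.exp ((θ / 2 : ℝ) * Complex.I)) w)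
        ≤ -κ * (θ ^ 2 / 2) := by
      have h11 := mul_le_mul_of_nonneg_right hmid.le
        (show 0 ≤ 2 * (θ * Real.sin (θ / 2)) by linarith [sq_nonneg θ])
      nlinarith
    linarith
  have h3 := mul_pos_of_neg_of_neg h2 (lt_trans hν (by linarith))
  have h4 : 0 < (θ * inner ℝ (a - γ s) (e * Complex.exp (θ * Complex.I) * Complex.I)) * ‖w‖ ^ 2 := by
    rw [mul_assoc, key, ← mul_assoc]
    exact h3
  exact pos_of_mul_pos_left h4 (by positivity)

end Slit
end PlaneCurve

namespace PlaneCurve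
open Filter Topology Metric Set

section Slit

variable {γ : ℝ → ℂ} {p : ℂ} {r : ℝ}

theorem eventually_left_lt_of_hasDerivAt_pos {F : ℝ → ℝ} {d t : ℝ} (h : HasDerivAt F d t)
    (hd : 0 < d) : ∀ᶠ s in 𝓝[<] t, F s < F t := by
  have h1 := ((hasDerivAt_iff_tendsto_slope.1 h).mono_left
    (nhdsWithin_mono t fun s (hs : s < t) => hs.ne)).eventually_const_lt hd
  filter_upwards [h1, self_mem_nhdsWithin] with s hs hst
  rw [slope_def_field] at hs
  have h2 : s - t < 0 := sub_neg.2 hst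
  have h3 : F s - F t < 0 := by
    by_contra hcon
    exact absurd hs (not_lt.2 (div_nonpos_of_nonneg_of_nonpos (not_lt.1 hcon) h2.le))
  linarith

/-- At an end of the slit, with `w` pointing to its midpoint and half-width `h`, this identifies
`cos h • (a - p) - r • w` with `sin h` times the tangent of the circle, up to the sign of the side.
-/
theorem cos_smul_sub_rotate (e : ℂ) (x h : ℝ) :
    Real.cos h • (e * Complex.exp (x * Complex.I)) - e * Complex.exp ((x - h : ℝ) * Complex.I)
      = Real.sin h • (e * Complex.exp (x * Complex.I) * Complex.I) := by
  have h1 : Complex.exp ((x - h : ℝ) * Complex.I)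
      = Complex.exp (x * Complex.I) * Complex.exp ((-h : ℝ) * Complex.I) := by
    rw [← Complex.exp_add]
    congr 1
    push_cast
    ring
  rw [h1, Complex.exp_mul_I (-h : ℝ), ← Complex.ofReal_cos, ← Complex.ofReal_sin, Real.cos_neg,
    Real.sin_neg, Complex.real_smul, Complex.real_smul]
  push_cast
  ring

theorem inner_rotate (e : ℂ) (x y : ℝ) :
    inner ℝ (e * Complex.exp (x * Complex.I)) (e * Complex.exp (y * Complex.I))
      = ‖e‖ ^ 2 * Real.cos (x - y) := by
  rw [← Complex.normSq_eq_norm_sq, Complex.normSq_apply, Complex.exp_mul_I, Complex.exp_mul_I,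
    ← Complex.ofReal_cos, ← Complex.ofReal_sin, ← Complex.ofReal_cos, ← Complex.ofReal_sin,
    Real.cos_sub]
  simp only [Complex.inner, Complex.mul_re, Complex.conj_re, Complex.conj_im, Complex.mul_im,
    Complex.I_re, Complex.I_im, Complex.add_re, Complex.add_im, Complex.ofReal_re,
    Complex.ofReal_im]
  ring

theorem exists_rotate_eq {e z : ℂ} (he : e ≠ 0) (h : ‖z‖ = ‖e‖) :
    ∃ θ : ℝ, |θ| ≤ Real.pi ∧ z = e * Complex.exp (θ * Complex.I) := by
  refine ⟨Complex.arg (z / e), Complex.abs_arg_le_pi _, ?_⟩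
  have h1 := Complex.norm_mul_exp_arg_mul_I (z / e)
  rw [norm_div, h, div_self (norm_ne_zero_iff.2 he), Complex.ofReal_one, one_mul] at h1
  rw [h1]
  field_simp

/-- The tube around an arc which ends transversely in a circle cuts an interval out of the circle;
at the end points of the interval, the distance to the arc increases along the circle. -/
theorem exists_slit (hγ : ContDiff ℝ ∞ γ)
    (hreg : ∀ t ∈ Icc (0 : ℝ) 1, deriv γ t ≠ 0) (hinj : InjOn γ (Icc 0 1)) (hr : 0 < r)
    (hend : γ 1 ∈ sphere p r) (hout : ∀ t ∈ Ico (0 : ℝ) 1, r < dist (γ t) p)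
    (htr : inner ℝ (γ 1 - p) (deriv γ 1) ≠ 0) :
    ∃ δ₀ > 0, ∀ δ ∈ Ioo 0 δ₀, ∃ (w : ℂ) (c : ℝ), ‖w‖ = 1 ∧ 0 < c ∧ c < 1 ∧ ∀ a ∈ sphere p r,
      (r * c < inner ℝ (a - p) w ∧ infDist a (arc γ) < δ) ∨
      (inner ℝ (a - p) w = r * c ∧ infDist a (arc γ) = δ ∧
        ∀ q ∈ arc γ, dist a q = infDist a (arc γ) →
          0 < inner ℝ (a - q) (c • (a - p) - r • w)) ∨
      (inner ℝ (a - p) w < r * c ∧ δ < infDist a (arc γ)) := by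
  obtain ⟨θm, hθm, hθm1, hsign⟩ := exists_angle_sign hγ hreg hinj hr hend hout htr
  set e := γ 1 - p with he
  have hen : ‖e‖ = r := mem_sphere_iff_norm.1 hend
  have he0 : e ≠ 0 := norm_pos_iff.1 (hen ▸ hr)
  have hrc : (r : ℂ) ≠ 0 := by exact_mod_cast hr.ne'
  let P : ℝ → ℂ := fun θ => p + e * Complex.exp (θ * Complex.I)
  let D : ℝ → ℝ := fun θ => infDist (P θ) (arc γ)
  have hP : Continuous P := by fun_prop
  have hD : Continuous D := (continuous_infDist_pt _).comp hP
  have hPs : ∀ θ, dist (P θ) p = r := fun θ => by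
    simp only [P, dist_eq_norm, add_sub_cancel_left, norm_mul, hen,
      Complex.norm_exp_ofReal_mul_I, mul_one]
  have hpi := Real.pi_gt_three
  have hDpos : ∀ θ, θ ≠ 0 → |θ| ≤ Real.pi → 0 < D θ := by
    intro θ h0 h1
    refine ((isCompact_arc hγ).isClosed.notMem_iff_infDist_pos arc_nonempty).1 ?_
    rintro ⟨t, ht, hteq⟩
    rcases ht.2.eq_or_lt with h | h
    · subst h
      have h2 : e * (Complex.exp (θ * Complex.I) - 1) = 0 := by
        have : γ 1 = p + e * Complex.exp (θ * Complex.I) := hteq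
        linear_combination he - this
      have h3 := congrArg norm ((mul_eq_zero.1 h2).resolve_left he0)
      rw [exp_mul_I_sub_one, norm_mul, norm_mul, Complex.norm_exp_ofReal_mul_I, Complex.norm_I,
        mul_one, mul_one, norm_zero, Complex.norm_real, norm_eq_zero] at h3
      have h4 := (mul_eq_zero.1 h3).resolve_left two_ne_zero
      have h5 := (Real.sin_eq_zero_iff_of_lt_of_lt (by linarith [(abs_le.1 h1).1])
        (by linarith [(abs_le.1 h1).2])).1 h4
      exact h0 (by linarith)
    · have := hout t ⟨ht.1, h⟩
      rw [hteq, hPs] at this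
      exact lt_irrefl _ this
  have hD0 : D 0 = 0 := by
    refine infDist_zero_of_mem ⟨1, by simp, ?_⟩
    simp [P, he]
  -- At each angle the distance to the arc is compared with the distance to one nearest point `q`,
  -- which dominates it, agrees with it there, and is differentiable with derivative of known sign.
  have hmono : ∀ ε : ℝ, |ε| = 1 → ∀ a b, 0 ≤ a → a < b → b ≤ θm → D (ε * a) < D (ε * b) := by
    intro ε hε a b ha hab hb
    refine lt_of_frequently_left_lt (D := fun t => D (ε * t)) hab
      (by fun_prop : Continuous fun t => D (ε * t)).continuousOn fun t ht => ?_
    have ht0 : 0 < t := ha.trans_lt ht.1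
    have hε0 : ε ≠ 0 := by rintro rfl; simp at hε
    obtain ⟨q, hq, hqd⟩ := (isCompact_arc hγ).exists_infDist_eq_dist arc_nonempty (P (ε * t))
    have h1 := hsign (ε * t) (by positivity)
      (by rw [abs_mul, hε, one_mul, abs_of_pos ht0]; exact ht.2.trans hb) q hq hqd.symm
    have h2 : HasDerivAt (fun t : ℝ => ‖P (ε * t) - q‖ ^ 2)
        (2 * inner ℝ (P (ε * t) - q)
          (e * (Complex.exp (((ε * t : ℝ) : ℂ) * Complex.I) * (((ε * 1 : ℝ) : ℂ) * Complex.I)))) t := by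
      refine HasDerivAt.norm_sq ((((HasDerivAt.cexp ?_).const_mul e).const_add p).sub_const q)
      exact (((hasDerivAt_id t).const_mul ε).ofReal_comp).mul_const Complex.I
    have h3 : e * (Complex.exp (((ε * t : ℝ) : ℂ) * Complex.I) * (((ε * 1 : ℝ) : ℂ) * Complex.I))
        = ε • (e * Complex.exp (((ε * t : ℝ) : ℂ) * Complex.I) * Complex.I) := by
      rw [Complex.real_smul, mul_one]; ring
    rw [h3, inner_smul_right] at h2
    have h4 : 0 < 2 * (ε * inner ℝ (P (ε * t) - q)
        (e * Complex.exp (((ε * t : ℝ) : ℂ) * Complex.I) * Complex.I)) := by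
      have h5 : 0 < t * (ε * inner ℝ (P (ε * t) - q)
        (e * Complex.exp (((ε * t : ℝ) : ℂ) * Complex.I) * Complex.I)) := by
        refine h1.trans_eq ?_
        ring
      have := pos_of_mul_pos_right h5 ht0.le
      linarith
    refine Eventually.frequently ((eventually_left_lt_of_hasDerivAt_pos h2 h4).mono fun s hs => ?_)
    calc D (ε * s) ≤ dist (P (ε * s)) q := infDist_le_dist_of_mem hq
      _ < dist (P (ε * t)) q := by
        rw [dist_eq_norm, dist_eq_norm]
        exact lt_of_pow_lt_pow_left₀ 2 (norm_nonneg _) hs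
      _ = D (ε * t) := hqd.symm
  obtain ⟨δ₀, hδ₀, hfar⟩ : ∃ δ₀ > 0, ∀ θ, θm ≤ |θ| → |θ| ≤ Real.pi → δ₀ ≤ D θ := by
    have hcomp : IsCompact {θ : ℝ | θm ≤ |θ| ∧ |θ| ≤ Real.pi} := by
      refine (isCompact_Icc (a := -Real.pi) (b := Real.pi)).of_isClosed_subset
        ((isClosed_le continuous_const continuous_abs).inter
          (isClosed_le continuous_abs continuous_const)) fun θ hθ => abs_le.1 hθ.2
    obtain ⟨t, ht, hmin⟩ := hcomp.exists_isMinOn ⟨θm, by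
      rw [mem_ofPred_eq, abs_of_pos hθm]
      exact ⟨le_rfl, by linarith⟩⟩ hD.continuousOn
    exact ⟨D t, hDpos t (abs_pos.1 (hθm.trans_le ht.1)) ht.2, fun θ h h' => hmin ⟨h, h'⟩⟩
  refine ⟨δ₀, hδ₀, fun δ hδ => ?_⟩
  -- On either side of the end point the level `δ` is crossed exactly once: monotonicity up to `θm`,
  -- and distance at least `δ₀` beyond.
  have hcross : ∀ ε : ℝ, |ε| = 1 → ∃ t ∈ Ioo 0 θm, D (ε * t) = δ ∧
      (∀ s, 0 ≤ s → s < t → D (ε * s) < δ) ∧ ∀ s, t < s → s ≤ Real.pi → δ < D (ε * s) := by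
    intro ε hε
    have hεm : |ε * θm| = θm := by rw [abs_mul, hε, one_mul, abs_of_pos hθm]
    obtain ⟨t, ht, hteq⟩ := intermediate_value_Ioo hθm.le
      (by fun_prop : Continuous fun t => D (ε * t)).continuousOn
      (show δ ∈ Ioo (D (ε * 0)) (D (ε * θm)) by
        rw [mul_zero, hD0]
        exact ⟨hδ.1, hδ.2.trans_le (hfar _ hεm.ge (by rw [hεm]; linarith))⟩)
    refine ⟨t, ht, hteq, fun s h0 h => hteq ▸ hmono ε hε s t h0 h ht.2.le, fun s h h' => ?_⟩
    rcases le_or_gt s θm with hs | hs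
    · exact hteq ▸ hmono ε hε t s ht.1.le h hs
    · have : |ε * s| = s := by
        rw [abs_mul, hε, one_mul, abs_of_pos (hθm.trans hs)]
      exact hδ.2.trans_le (hfar _ (by rw [this]; exact hs.le) (by rw [this]; exact h'))
  obtain ⟨θ₂, hθ₂, hθ₂eq, hθ₂lt, hθ₂gt⟩ := hcross 1 (by simp)
  obtain ⟨θ₁, hθ₁, hθ₁eq, hθ₁lt, hθ₁gt⟩ := hcross (-1) (by simp)
  -- The slit is the interval of angles from `-θ₁` to `θ₂`, in general not symmetric about the end
  -- of the arc. The direction `w` is its midpoint `μ`, and the constant `c` is the cosine of its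
  -- half-width.
  set h := (θ₁ + θ₂) / 2 with hh
  set μ := (θ₂ - θ₁) / 2 with hμ
  have hh0 : 0 < h := by linarith [hθ₁.1, hθ₂.1]
  have hh1 : h < 1 := by linarith [hθ₁.2, hθ₂.2]
  have hsin : 0 < Real.sin h := Real.sin_pos_of_pos_of_lt_pi hh0 (by linarith)
  have hcos : 0 < Real.cos h := Real.cos_pos_of_mem_Ioo ⟨by linarith, by linarith⟩
  have hrw : r • (e / r * Complex.exp (μ * Complex.I)) = e * Complex.exp (μ * Complex.I) := by
    rw [Complex.real_smul]
    field_simp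
  refine ⟨e / r * Complex.exp (μ * Complex.I), Real.cos h, ?_, hcos, ?_, fun a ha => ?_⟩
  · rw [norm_mul, norm_div, hen, Complex.norm_exp_ofReal_mul_I, Complex.norm_real,
      Real.norm_of_nonneg hr.le, div_self hr.ne', mul_one]
  · rw [← Real.cos_zero]
    exact Real.cos_lt_cos_of_nonneg_of_le_pi le_rfl (by linarith) hh0
  obtain ⟨θ, hθ, haθ⟩ := exists_rotate_eq he0 ((mem_sphere_iff_norm.1 ha).trans hen.symm)
  have haP : a = P θ := by
    simp only [P, ← haθ]; ring
  have hin : inner ℝ (a - p) (e / r * Complex.exp (μ * Complex.I)) = r * Real.cos (θ - μ) := by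
    have h1 := inner_rotate e θ μ
    rw [← hrw, inner_smul_right, hen, ← haθ] at h1
    have h2 : r * inner ℝ (a - p) (e / r * Complex.exp (μ * Complex.I))
      = r * (r * Real.cos (θ - μ)) := by rw [h1]; ring
    exact mul_left_cancel₀ hr.ne' h2
  have hbig : h < |θ - μ| → inner ℝ (a - p) (e / r * Complex.exp (μ * Complex.I)) < r * Real.cos h := by
    intro h1
    rw [hin]
    refine mul_lt_mul_of_pos_left (cos_lt_cos_of_abs hh0.le h1 ?_) hr
    have h2 : |θ - μ| ≤ |θ| + |μ| := abs_sub _ _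
    have h3 : |μ| < 1 := abs_lt.2 ⟨by linarith [hθ₁.1, hθ₂.1, hθ₁.2, hθ₂.2],
      by linarith [hθ₁.1, hθ₂.1, hθ₁.2, hθ₂.2]⟩
    linarith
  have hDa : infDist a (arc γ) = D θ := by rw [haP]
  rw [hDa]
  have hθ' := abs_le.1 hθ
  rcases lt_trichotomy θ (-θ₁) with h1 | h1 | h1
  · refine Or.inr (Or.inr ⟨hbig ?_, ?_⟩)
    · rw [lt_abs]; right; linarith
    · have := hθ₁gt (-θ) (by linarith) (by linarith)
      rwa [neg_one_mul, neg_neg] at this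
  · refine Or.inr (Or.inl ⟨?_, ?_, fun q hq hqd => ?_⟩)
    · have h2 : θ - μ = -h := by linarith
      rw [hin, h2, Real.cos_neg]
    · rw [h1, ← hθ₁eq, neg_one_mul]
    · have h2 := hsign θ (by linarith [hθ₁.1]) (by rw [h1, abs_neg, abs_of_pos hθ₁.1]; exact hθ₁.2.le)
        q hq (by rw [haP] at hqd; exact hqd.trans (by rw [← hDa, haP]))
      have h3 := cos_smul_sub_rotate e θ (-h)
      have h4 : θ - -h = μ := by linarith
      rw [Real.cos_neg, Real.sin_neg, h4, ← hrw, ← haθ] at h3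
      rw [h3, inner_smul_right]
      rw [← haθ, add_sub_cancel] at h2
      have h5 : θ < 0 := by linarith [hθ₁.1]
      have h6 := (mul_pos_iff.1 h2).resolve_left fun hc => absurd hc.1 (not_lt.2 h5.le)
      nlinarith [h6.2]
  rcases lt_trichotomy θ θ₂ with h1' | h1' | h1'
  · refine Or.inl ⟨?_, ?_⟩
    · rw [hin]
      refine mul_lt_mul_of_pos_left ?_ hr
      rw [← Real.cos_abs (θ - μ)]
      exact Real.cos_lt_cos_of_nonneg_of_le_pi (abs_nonneg _) (by linarith)
        (abs_lt.2 ⟨by linarith, by linarith⟩)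
    · rcases le_total 0 θ with h0 | h0
      · have := hθ₂lt θ h0 h1'
        rwa [one_mul] at this
      · have := hθ₁lt (-θ) (by linarith) (by linarith)
        rwa [neg_one_mul, neg_neg] at this
  · refine Or.inr (Or.inl ⟨?_, ?_, fun q hq hqd => ?_⟩)
    · have h2 : θ - μ = h := by linarith
      rw [hin, h2]
    · rw [h1', ← hθ₂eq, one_mul]
    · have h2 := hsign θ (by linarith [hθ₂.1]) (by rw [h1', abs_of_pos hθ₂.1]; exact hθ₂.2.le)
        q hq (by rw [haP] at hqd; exact hqd.trans (by rw [← hDa, haP]))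
      have h3 := cos_smul_sub_rotate e θ h
      have h4 : θ - h = μ := by linarith
      rw [h4, ← hrw, ← haθ] at h3
      rw [h3, inner_smul_right]
      rw [← haθ, add_sub_cancel] at h2
      have h5 : 0 < θ := by linarith [hθ₂.1]
      exact mul_pos hsin (pos_of_mul_pos_right h2 h5.le)
  · refine Or.inr (Or.inr ⟨hbig ?_, ?_⟩)
    · rw [lt_abs]; left; linarith
    · have := hθ₂gt θ h1' (by linarith)
      rwa [one_mul] at this

end Slit
end PlaneCurve

namespace PlaneCurve
open Filter Topology Metric Set

/-! ### Inward vectors for sets glued along a hypersurface. -/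

section Glue

variable {E : Type*} [NormedAddCommGroup E] [NormedSpace ℝ E]

theorem IncreasesAlong.max {H₁ H₂ : E → ℝ} {x w : E} (h₁ : IncreasesAlong H₁ x w)
    (h₂ : IncreasesAlong H₂ x w) : IncreasesAlong (fun z => max (H₁ z) (H₂ z)) x w := by
  obtain ⟨η₁, hη₁, c₁, hc₁, H₁⟩ := h₁
  obtain ⟨η₂, hη₂, c₂, hc₂, H₂⟩ := h₂
  refine ⟨Min.min η₁ η₂, lt_min hη₁ hη₂, Min.min c₁ c₂, lt_min hc₁ hc₂,
    fun y hyx u hu t ht htη => ?_⟩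
  rw [← max_add_add_right]
  refine max_le_max ?_ ?_
  · have := H₁ y (hyx.trans_le (min_le_left _ _)) u (hu.trans_le (min_le_left _ _)) t ht
      (htη.trans_le (min_le_left _ _))
    have := mul_le_mul_of_nonneg_right (min_le_left c₁ c₂) ht.le
    linarith
  · have := H₂ y (hyx.trans_le (min_le_right _ _)) u (hu.trans_le (min_le_right _ _)) t ht
      (htη.trans_le (min_le_right _ _))
    have := mul_le_mul_of_nonneg_right (min_le_right c₁ c₂) ht.le
    linarith

/-- A vector pointing into two sets which agree on a separating hypersurface points into the set
which is glued from one part of each. -/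
theorem PointsInto.glue {X Y : Set E} {x w : E} (hX : PointsInto X x w) (hY : PointsInto Y x w)
    {h : E → ℝ} (hc : Continuous h) (heq : ∀ᶠ y in 𝓝 x, h y = 0 → (y ∈ X ↔ y ∈ Y)) :
    PointsInto {y | (h y ≤ 0 ∧ y ∈ X) ∨ (0 ≤ h y ∧ y ∈ Y)} x w := by
  obtain ⟨η₁, hη₁, H₁⟩ := hX
  obtain ⟨η₂, hη₂, H₂⟩ := hY
  obtain ⟨η₃, hη₃, H₃⟩ := Metric.eventually_nhds_iff.1 heq
  have hη : 0 < Min.min (Min.min η₁ η₂) η₃ := by positivity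
  have l1 : Min.min (Min.min η₁ η₂) η₃ ≤ η₁ := (min_le_left _ _).trans (min_le_left _ _)
  have l2 : Min.min (Min.min η₁ η₂) η₃ ≤ η₂ := (min_le_left _ _).trans (min_le_right _ _)
  have l3 : Min.min (Min.min η₁ η₂) η₃ ≤ η₃ := min_le_right _ _
  obtain ⟨η', hη', hle, hnear⟩ := exists_pos_forall_add_smul_near hη w
  -- A step that changes sides meets `h = 0`, by the intermediate value theorem; there the sets
  -- agree, so the rest of the step continues in the other set. The statement is symmetric and is
  -- used for `h` and `-h`.
  have key : ∀ (X Y : Set E) (h : E → ℝ), Continuous h →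
      (∀ y, ‖y - x‖ < Min.min (Min.min η₁ η₂) η₃ → h y = 0 → y ∈ X → y ∈ Y) →
      (∀ y ∈ X, ‖y - x‖ < Min.min (Min.min η₁ η₂) η₃ → ∀ u : E,
        ‖u - w‖ < Min.min (Min.min η₁ η₂) η₃ →
        ∀ t : ℝ, 0 < t → t < Min.min (Min.min η₁ η₂) η₃ → y + t • u ∈ X) →
      (∀ y ∈ Y, ‖y - x‖ < Min.min (Min.min η₁ η₂) η₃ → ∀ u : E,
        ‖u - w‖ < Min.min (Min.min η₁ η₂) η₃ →
        ∀ t : ℝ, 0 < t → t < Min.min (Min.min η₁ η₂) η₃ → y + t • u ∈ Y) →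
      ∀ y ∈ X, h y ≤ 0 → ‖y - x‖ < η' → ∀ u : E, ‖u - w‖ < η' → ∀ t : ℝ, 0 < t → t < η' →
        (h (y + t • u) ≤ 0 ∧ y + t • u ∈ X) ∨ (0 ≤ h (y + t • u) ∧ y + t • u ∈ Y) := by
    intro X Y h hc heq HX HY y hy hy0 hyx u hu t ht htη
    have hyη : ‖y - x‖ < Min.min (Min.min η₁ η₂) η₃ := by linarith
    have huη : ‖u - w‖ < Min.min (Min.min η₁ η₂) η₃ := by linarith
    rcases le_or_gt (h (y + t • u)) 0 with h0 | h0
    · exact Or.inl ⟨h0, HX y hy hyη u huη t ht (by linarith)⟩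
    · refine Or.inr ⟨h0.le, ?_⟩
      have hcont : Continuous fun s : ℝ => h (y + s • u) := by fun_prop
      obtain ⟨s, hs, hs0⟩ := intermediate_value_Ico ht.le hcont.continuousOn
        (show (0 : ℝ) ∈ Ico (h (y + (0 : ℝ) • u)) (h (y + t • u)) by
          rw [zero_smul, add_zero]; exact ⟨hy0, h0⟩)
      have hsη : ‖y + s • u - x‖ < Min.min (Min.min η₁ η₂) η₃ := by
        rcases hs.1.eq_or_lt with h1 | h1
        · rw [← h1, zero_smul, add_zero]; exact hyη
        · exact hnear x y u hyx hu s h1 (hs.2.trans htη)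
      have hsX : y + s • u ∈ X := by
        rcases hs.1.eq_or_lt with h1 | h1
        · rw [← h1, zero_smul, add_zero]; exact hy
        · exact HX y hy hyη u huη s h1 (by linarith [hs.2])
      have := HY _ (heq _ hsη hs0 hsX) hsη u huη (t - s) (by linarith [hs.2]) (by linarith [hs.1])
      rwa [add_assoc, ← add_smul, add_sub_cancel] at this
  have HX : ∀ y ∈ X, ‖y - x‖ < Min.min (Min.min η₁ η₂) η₃ → ∀ u : E,
      ‖u - w‖ < Min.min (Min.min η₁ η₂) η₃ →
      ∀ t : ℝ, 0 < t → t < Min.min (Min.min η₁ η₂) η₃ → y + t • u ∈ X :=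
    fun y hy hyx u hu t ht htη => H₁ y hy (by linarith) u (by linarith) t ht (by linarith)
  have HY : ∀ y ∈ Y, ‖y - x‖ < Min.min (Min.min η₁ η₂) η₃ → ∀ u : E,
      ‖u - w‖ < Min.min (Min.min η₁ η₂) η₃ →
      ∀ t : ℝ, 0 < t → t < Min.min (Min.min η₁ η₂) η₃ → y + t • u ∈ Y :=
    fun y hy hyx u hu t ht htη => H₂ y hy (by linarith) u (by linarith) t ht (by linarith)
  have heq' : ∀ y, ‖y - x‖ < Min.min (Min.min η₁ η₂) η₃ → h y = 0 → (y ∈ X ↔ y ∈ Y) :=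
    fun y hy => H₃ (by rw [dist_eq_norm]; linarith)
  refine ⟨η', hη', fun y hy hyx u hu t ht htη => ?_⟩
  rcases hy with ⟨h0, hy⟩ | ⟨h0, hy⟩
  · exact key X Y h hc (fun y h1 h2 => (heq' y h1 h2).1) HX HY y hy h0 hyx u hu t ht htη
  · have := key Y X (fun y => -h y) hc.neg (fun y h1 h2 => (heq' y h1 (neg_eq_zero.1 h2)).2)
      HY HX y hy (neg_nonpos.2 h0) hyx u hu t ht htη
    rw [neg_nonpos, neg_nonneg] at this
    exact this.symm

end Glue

/-! ### A function which lets a slit disc be absorbed into its exterior. -/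

section SlitDisc

variable {F : Type*} [NormedAddCommGroup F] [InnerProductSpace ℝ F]

theorem increasesAlong_norm_sub_sq {k : ℝ} (a : ℝ) {p x u : F} (h : 0 < k * inner ℝ (x - p) u) :
    IncreasesAlong (fun z => k * ‖z - p‖ ^ 2 + a) x u := by
  have h1 : HasStrictFDerivAt (fun z : F => k * ‖z - p‖ ^ 2 + a)
      (k • ((2 • innerSL ℝ (x - p)).comp (ContinuousLinearMap.id ℝ F))) x :=
    (((hasStrictFDerivAt_norm_sq (x - p)).comp x
      ((hasStrictFDerivAt_id x).sub_const p)).const_mul k).add_const a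
  refine h1.increasesAlong ?_
  simp only [smul_apply, ContinuousLinearMap.comp_id, innerSL_apply_apply, nsmul_eq_mul,
    smul_eq_mul]
  push_cast
  linarith

/-- The function `c |x - p| - ⟨x - p, w⟩`, which is nonnegative outside of the open cone of
directions `x - p` which make a small angle with `w`. -/
noncomputable def slitFun (p w : F) (c : ℝ) (x : F) : ℝ := c * ‖x - p‖ - inner ℝ (x - p) w

theorem continuous_slitFun (p w : F) (c : ℝ) : Continuous (slitFun p w c) := by
  unfold slitFun
  fun_prop

/-- The hypothesis is the derivative of `slitFun` along `u`, multiplied by `‖x - p‖`. -/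
theorem increasesAlong_slitFun {p w x u : F} {c : ℝ} (hx : x ≠ p)
    (h : 0 < c * inner ℝ (x - p) u - ‖x - p‖ * inner ℝ u w) :
    IncreasesAlong (slitFun p w c) x u := by
  have hx0 : 0 < ‖x - p‖ := norm_pos_iff.2 (sub_ne_zero.2 hx)
  have h0 := ((hasStrictFDerivAt_norm_sq (x - p)).comp x
      ((hasStrictFDerivAt_id x).sub_const p)).sqrt (by simpa using sub_ne_zero.2 hx)
  simp only [id, Real.sqrt_sq (norm_nonneg _)] at h0
  have h1 := (h0.const_mul c).sub
    (((innerSL ℝ w).hasStrictFDerivAt (x := x - p)).comp x ((hasStrictFDerivAt_id x).sub_const p))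
  refine (h1.increasesAlong ?_).congr (Eventually.of_forall fun z => ?_)
  · simp only [_root_.sub_apply, smul_apply, ContinuousLinearMap.comp_id, innerSL_apply_apply,
      nsmul_eq_mul, smul_eq_mul]
    have h3 : c * (1 / (2 * ‖x - p‖) * ((2 : ℕ) * inner ℝ (x - p) u)) - inner ℝ w u
      = (c * inner ℝ (x - p) u - ‖x - p‖ * inner ℝ u w) / ‖x - p‖ := by
      rw [real_inner_comm w u]
      push_cast
      field_simp
    rw [h3]
    positivity
  · simp only [slitFun, innerSL_apply_apply, real_inner_comm w, id]
    rfl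

/-- A function which vanishes on the sphere of radius `r` around `p`, is positive outside and very
negative inside, and which increases along `-w` on the ball of radius `r'` and along the radial
direction outside of the cone around `w` between the two spheres. -/
theorem exists_slit_disc_function (p : F) {w : F} (hw : ‖w‖ = 1) {c : ℝ} (hc0 : 0 < c) (hc1 : c < 1)
    {r r' : ℝ} (hr' : 0 < r') (hr : r' < r) {K : ℝ} (hK : 0 < K) :
    ∃ Ψ : F → ℝ, Continuous Ψ ∧ (∀ x, r < ‖x - p‖ → 0 < Ψ x) ∧ (∀ x, ‖x - p‖ = r → Ψ x = 0) ∧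
      (∀ x, ‖x - p‖ ≤ r → Ψ x ≤ -K * (r - ‖x - p‖)) ∧
      (∀ x, ‖x - p‖ ≤ r' → IncreasesAlong Ψ x (-w)) ∧
      (∀ x, r' < ‖x - p‖ → inner ℝ (x - p) w ≤ ‖x - p‖ * c → IncreasesAlong Ψ x (x - p)) ∧
      (∀ x u, ‖x - p‖ = r → 0 < inner ℝ (x - p) u → IncreasesAlong Ψ x u) := by
  have hr0 : 0 < r := hr'.trans hr
  -- In the plane, `o` is where the tangents to the small circle at its intersections with the cone
  -- meet. Radial vectors outside the cone and beyond the small circle therefore lead away from `o`,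
  -- and so does `-w` on the small disc.
  set o := p + (r' / c) • w with ho
  have hxo : ∀ x, x - o = (x - p) - (r' / c) • w := fun x => by rw [ho]; abel
  -- `L` pushes the term centred at `o` below `-K * r` on the large ball. The weight `l` makes the
  -- other term fall at rate at least `K` inside the sphere, and below the first one on the small
  -- ball.
  set L := (r + r' / c) ^ 2 + K * r with hL
  have hL0 : 0 < L := by positivity
  have hrr : 0 < r ^ 2 - r' ^ 2 := by nlinarith
  set l := K / r + L / (r ^ 2 - r' ^ 2) + 1 with hl
  have hl0 : 0 < l := by positivity
  have hfirst : ∀ x, ‖x - p‖ ≤ r → ‖x - o‖ ^ 2 - L ≤ -K * r := by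
    intro x hx
    have h1 : ‖x - o‖ ≤ r + r' / c := by
      rw [hxo]
      refine (norm_sub_le _ _).trans (add_le_add hx ?_)
      rw [norm_smul, hw, mul_one, Real.norm_of_nonneg (by positivity)]
    have h2 := pow_le_pow_left₀ (norm_nonneg _) h1 2
    linarith
  have hc1' : Continuous fun x : F => ‖x - o‖ ^ 2 - L := by fun_prop
  have hc2' : Continuous fun x : F => l * (‖x - p‖ ^ 2 - r ^ 2) := by fun_prop
  refine ⟨fun x => max (‖x - o‖ ^ 2 - L) (l * (‖x - p‖ ^ 2 - r ^ 2)), by fun_prop, ?_, ?_, ?_, ?_,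
    ?_, ?_⟩
  · intro x hx
    refine lt_max_of_lt_right (mul_pos hl0 ?_)
    nlinarith [norm_nonneg (x - p)]
  · intro x hx
    have h1 := hfirst x hx.le
    have h2 : l * (‖x - p‖ ^ 2 - r ^ 2) = 0 := by rw [hx]; ring
    simp only [h2]
    refine max_eq_right (h1.trans ?_)
    have := mul_pos hK hr0
    linarith
  · intro x hx
    refine max_le ((hfirst x hx).trans ?_) ?_
    · nlinarith [norm_nonneg (x - p)]
    · have h1 : K ≤ l * r := by
        have h2 : K / r * r = K := by field_simp
        have h3 : 0 ≤ (L / (r ^ 2 - r' ^ 2) + 1) * r := by positivity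
        have h4 : l * r = K / r * r + (L / (r ^ 2 - r' ^ 2) + 1) * r := by rw [hl]; ring
        linarith
      have h2 : 0 ≤ r - ‖x - p‖ := sub_nonneg.2 hx
      have h3 := mul_le_mul_of_nonneg_right h1 h2
      have h4 := mul_nonneg (mul_nonneg hl0.le (norm_nonneg (x - p))) h2
      nlinarith
  · intro x hx
    have h1 : l * (‖x - p‖ ^ 2 - r ^ 2) < ‖x - o‖ ^ 2 - L := by
      have h2 := pow_le_pow_left₀ (norm_nonneg _) hx 2
      have h3 : L < l * (r ^ 2 - r' ^ 2) := by
        have h4 : L / (r ^ 2 - r' ^ 2) * (r ^ 2 - r' ^ 2) = L := by field_simp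
        have h5 : 0 < (K / r + 1) * (r ^ 2 - r' ^ 2) := by positivity
        have h6 : l * (r ^ 2 - r' ^ 2) = (K / r + 1) * (r ^ 2 - r' ^ 2)
          + L / (r ^ 2 - r' ^ 2) * (r ^ 2 - r' ^ 2) := by rw [hl]; ring
        linarith
      have h4 := mul_le_mul_of_nonneg_left h2 hl0.le
      nlinarith [sq_nonneg ‖x - o‖]
    refine (increasesAlong_norm_sub_sq (k := 1) (p := o) (-L) ?_).congr ?_
    · rw [one_mul, hxo, inner_neg_right, inner_sub_left, inner_smul_left, real_inner_self_eq_norm_sq,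
        hw]
      have h2 := (real_inner_le_norm (x - p) w).trans (by rw [hw, mul_one])
      have h3 : r' < r' / c := by rw [lt_div_iff₀ hc0]; nlinarith
      simp only [conj_trivial, one_pow, mul_one]
      linarith
    · filter_upwards [hc2'.continuousAt.eventually_lt hc1'.continuousAt h1] with y hy
      rw [max_eq_left hy.le]
      ring
  · intro x hx hxw
    have hx0 : 0 < ‖x - p‖ := hr'.trans hx
    refine ((increasesAlong_norm_sub_sq (k := 1) (p := o) (-L) ?_).max
      (increasesAlong_norm_sub_sq (k := l) (p := p) (-(l * r ^ 2)) ?_)).congr ?_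
    · rw [one_mul, hxo, inner_sub_left, inner_smul_left, real_inner_self_eq_norm_sq,
        real_inner_comm (x - p) w]
      simp only [conj_trivial]
      have h1 : r' / c * inner ℝ (x - p) w ≤ r' / c * (‖x - p‖ * c) :=
        mul_le_mul_of_nonneg_left hxw (by positivity)
      have h2 : r' / c * (‖x - p‖ * c) = r' * ‖x - p‖ := by field_simp
      nlinarith
    · rw [real_inner_self_eq_norm_sq]
      positivity
    · filter_upwards with y
      congr 1 <;> ring
  · intro x u hx hu
    have h1 : ‖x - o‖ ^ 2 - L < l * (‖x - p‖ ^ 2 - r ^ 2) := by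
      have h2 : l * (‖x - p‖ ^ 2 - r ^ 2) = 0 := by rw [hx]; ring
      rw [h2]
      have := hfirst x hx.le
      have := mul_pos hK hr0
      linarith
    refine (increasesAlong_norm_sub_sq (k := l) (p := p) (-(l * r ^ 2)) (mul_pos hl0 hu)).congr ?_
    filter_upwards [hc1'.continuousAt.eventually_lt hc2'.continuousAt h1] with y hy
    rw [max_eq_right hy.le]
    ring

theorem closure_ball_diff_closedBall (p : F) {r r' : ℝ} (hr' : 0 < r') (hr : r' < r) :
    closure (ball p r \ closedBall p r') = {x | r' ≤ ‖x - p‖ ∧ ‖x - p‖ ≤ r} := by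
  refine Subset.antisymm (closure_minimal (fun x hx => ?_) ?_) fun x hx => ?_
  · rw [Set.mem_sdiff, mem_ball, mem_closedBall, dist_eq_norm, not_le] at hx
    exact ⟨hx.2.le, hx.1.le⟩
  · exact (isClosed_le continuous_const (by fun_prop : Continuous fun x : F => ‖x - p‖)).inter
      (isClosed_le (by fun_prop : Continuous fun x : F => ‖x - p‖) continuous_const)
  · have hx0 : 0 < ‖x - p‖ := hr'.trans_le hx.1
    -- Points of the closed shell are approached from the open one by moving them radially towards
    -- the sphere of mean radius.
    set m := (r + r') / 2 with hm
    let θ : ℝ → F := fun t => x + t • ((m / ‖x - p‖ - 1) • (x - p))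
    have hθ : Tendsto θ (𝓝[Ioo 0 1] 0) (𝓝 x) := by
      have h1 : Continuous θ := by fun_prop
      have h2 := h1.tendsto 0
      simp only [θ, zero_smul, add_zero] at h2
      exact h2.mono_left nhdsWithin_le_nhds
    have : (𝓝[Ioo (0 : ℝ) 1] 0).NeBot := by
      rw [nhdsWithin_Ioo_eq_nhdsGT one_pos]
      infer_instance
    refine mem_closure_of_tendsto hθ ?_
    filter_upwards [self_mem_nhdsWithin] with t ht
    have h1 : θ t - p = (1 + t * (m / ‖x - p‖ - 1)) • (x - p) := by
      simp only [θ]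
      rw [add_smul, one_smul, mul_smul]
      abel
    have h2 : ‖θ t - p‖ = (1 - t) * ‖x - p‖ + t * m := by
      have h3 : 1 + t * (m / ‖x - p‖ - 1) = (1 - t) + t * (m / ‖x - p‖) := by ring
      have h4 : 0 ≤ (1 - t) + t * (m / ‖x - p‖) :=
        add_nonneg (by linarith [ht.2]) (mul_nonneg ht.1.le (div_nonneg (by linarith) hx0.le))
      rw [h1, h3, norm_smul, Real.norm_of_nonneg h4]
      field_simp
    rw [Set.mem_sdiff, mem_ball, mem_closedBall, dist_eq_norm, not_le, h2]
    have h3 := mul_pos ht.1 (sub_pos.2 hr)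
    have h4 : 0 ≤ 1 - t := by linarith [ht.2]
    have h5 := mul_le_mul_of_nonneg_left hx.1 h4
    have h6 := mul_le_mul_of_nonneg_left hx.2 h4
    constructor <;> nlinarith

end SlitDisc

/-- `slitFun` is positively homogeneous about `p`, so its sign on a radial segment is decided at the
end on the circle, where the hypothesis compares the cone with the tube. -/
theorem mem_regionA_iff {p : ℂ} {r r' : ℝ} (hr' : 0 < r') (hr : r' < r) {s : Set ℂ}
    (hs : s.Nonempty) {δ : ℝ} {w : ℂ} {c : ℝ}
    (h : ∀ a ∈ sphere p r, δ ≤ infDist a s ↔ 0 ≤ slitFun p w c a) {x : ℂ} :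
    x ∈ regionA p r r' s δ ↔ r' ≤ ‖x - p‖ ∧ ‖x - p‖ ≤ r ∧ 0 ≤ slitFun p w c x := by
  simp only [regionA, mem_iUnion, closure_ball_diff_closedBall p hr' hr]
  constructor
  · rintro ⟨a, ⟨ha, haδ⟩, hxa, hx⟩
    refine ⟨hx.1, hx.2, ?_⟩
    rw [mem_thickening_iff_infDist_lt hs, not_lt, h a ha] at haδ
    obtain ⟨t, ht, rfl⟩ := (segment_eq_image' ℝ p a ▸ hxa : x ∈ _)
    simp only [slitFun, add_sub_cancel_left, norm_smul, Real.norm_of_nonneg ht.1,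
      inner_smul_left] at haδ ⊢
    have := mul_nonneg ht.1 haδ
    simp only [conj_trivial]
    linarith
  · rintro ⟨h1, h2, h3⟩
    have hx0 : 0 < ‖x - p‖ := hr'.trans_le h1
    have hr0 : 0 < r := hr'.trans hr
    refine ⟨p + (r / ‖x - p‖) • (x - p), ⟨?_, ?_⟩, ?_, h1, h2⟩
    · rw [mem_sphere_iff_norm, add_sub_cancel_left, norm_smul, Real.norm_of_nonneg (by positivity)]
      field_simp
    · rw [mem_thickening_iff_infDist_lt hs, not_lt, h]
      · simp only [slitFun, add_sub_cancel_left, norm_smul, inner_smul_left, conj_trivial,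
          Real.norm_of_nonneg (show 0 ≤ r / ‖x - p‖ by positivity)] at h3 ⊢
        have := mul_nonneg (show 0 ≤ r / ‖x - p‖ by positivity) h3
        linarith
      · rw [mem_sphere_iff_norm, add_sub_cancel_left, norm_smul,
          Real.norm_of_nonneg (by positivity)]
        field_simp
    · rw [segment_eq_image']
      refine ⟨‖x - p‖ / r, ⟨by positivity, by rw [div_le_one hr0]; exact h2⟩, ?_⟩
      simp only [add_sub_cancel_left, smul_smul]
      have : ‖x - p‖ / r * (r / ‖x - p‖) = 1 := by field_simp
      rw [this, one_smul]
      abel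

end PlaneCurve

namespace PlaneCurve
open Filter Topology Metric Set

/-! ### Corners of the base away from the absorbed disc. -/

section ArcSystem

theorem eventually_lt_infDist {S K : Set ℂ} (hS : IsCompact S) (hK : IsCompact K)
    (hne : K.Nonempty) (hd : Disjoint S K) :
    ∀ᶠ δ in 𝓝[>] (0 : ℝ), ∀ x ∈ S, δ < infDist x K := by
  rcases S.eq_empty_or_nonempty with h | h
  · simp [h]
  obtain ⟨x, hx, hmin⟩ := hS.exists_isMinOn h (continuous_infDist_pt K).continuousOn
  have h0 : 0 < infDist x K :=
    (hK.isClosed.notMem_iff_infDist_pos hne).1 (disjoint_left.1 hd hx)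
  filter_upwards [Ioo_mem_nhdsGT h0] with δ hδ y hy
  exact hδ.2.trans_le (hmin hy)

variable {γ σ : ℝ → ℂ} {p₀ : ℂ}

/-- A point at small distance `δ` from two arcs with different directions at their common starting
point is near that point, and moving away from the starting point moves it away from the arcs. -/
theorem eventually_two_tubes (hγ : ContDiff ℝ ∞ γ) (hσ : ContDiff ℝ ∞ σ)
    (hγi : InjOn γ (Icc 0 1)) (hσi : InjOn σ (Icc 0 1)) (hγ0 : γ 0 = p₀) (hσ0 : σ 0 = p₀)
    (hinter : arc γ ∩ arc σ = {p₀}) (hdir : ¬ SameRay ℝ (deriv γ 0) (deriv σ 0)) {ρ : ℝ}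
    (hρ : 0 < ρ) :
    ∀ᶠ δ in 𝓝[>] (0 : ℝ), ∀ x, infDist x (arc γ) = δ → infDist x (arc σ) = δ →
      ‖x - p₀‖ < ρ ∧ ∀ q ∈ arc γ, dist x q = δ → 0 < inner ℝ (x - q) (x - p₀) := by
  obtain ⟨m, hm, hm2⟩ := exists_linear_separation hγ hσ hγi hσi hγ0 hσ0 hinter hdir
  obtain ⟨C, hC, hC2⟩ := exists_second_order_bound hγ
  obtain ⟨η, hη, hη2⟩ := Metric.eventually_nhds_iff.1
    (hγ.continuous.continuousAt.eventually (Metric.ball_mem_nhds (γ 0) (half_pos hρ)))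
  have hpos : 0 < min (min (m * η / 2) (ρ / 2)) (m ^ 2 / (4 * C)) := by positivity
  filter_upwards [Ioo_mem_nhdsGT hpos] with δ hδ x hx hx'
  have hδ1 : δ < m * η / 2 := hδ.2.trans_le ((min_le_left _ _).trans (min_le_left _ _))
  have hδ2 : δ < ρ / 2 := hδ.2.trans_le ((min_le_left _ _).trans (min_le_right _ _))
  have hδ3 : δ < m ^ 2 / (4 * C) := hδ.2.trans_le (min_le_right _ _)
  obtain ⟨s', hs', hxs'⟩ := exists_nearest hσ x
  -- A point at distance `δ` from both arcs has nearest points at mutual distance at most `2 * δ`;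
  -- linear separation then bounds the parameters by a multiple of `δ`.
  have hsmall : ∀ s ∈ Icc (0 : ℝ) 1, dist x (γ s) = δ → m * s ≤ 2 * δ := by
    intro s hs hxs
    have h1 := hm2 s hs s' hs'
    have h2 : ‖γ s - σ s'‖ ≤ 2 * δ := by
      rw [← dist_eq_norm]
      refine (dist_triangle_left _ _ x).trans ?_
      rw [hxs, hxs', hx']
      linarith
    have h3 := mul_nonneg hm.le hs'.1
    linarith
  refine ⟨?_, ?_⟩
  · obtain ⟨s, hs, hxs⟩ := exists_nearest hγ x
    rw [hx] at hxs
    have h1 := hsmall s hs hxs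
    have h2 : dist (γ s) (γ 0) < ρ / 2 := hη2 (by
      rw [Real.dist_eq, sub_zero, abs_of_nonneg hs.1]
      refine lt_of_mul_lt_mul_left (a := m) ?_ hm.le
      linarith)
    rw [← dist_eq_norm, ← hγ0]
    linarith [dist_triangle x (γ s) (γ 0)]
  · rintro _ ⟨s, hs, rfl⟩ hxs
    have h1 := hsmall s hs hxs
    have h2 := inner_deriv_nonpos_of_nearest hγ hs (hxs.trans hx.symm) (s' := 0) (by simp)
    have h3 := hC2 s hs 0 (by simp)
    -- Taylor expansion back to `p₀`: the leading term is `δ²`, the first order term has the right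
    -- sign at a nearest point, and the remainder is at most `δ * C * s²`, which is less than `δ²`.
    have h4 : inner ℝ (x - γ s) (x - p₀) = ‖x - γ s‖ ^ 2
        - ((0 - s) * inner ℝ (x - γ s) (deriv γ s)
          + inner ℝ (x - γ s) (γ 0 - γ s - (0 - s) • deriv γ s)) := by
      rw [← hγ0, inner_sub_right _ (γ 0 - γ s), inner_smul_right, add_sub_cancel,
        ← real_inner_self_eq_norm_sq, ← inner_sub_right]
      congr 1
      abel
    have h5 : inner ℝ (x - γ s) (γ 0 - γ s - (0 - s) • deriv γ s) ≤ δ * (C * s ^ 2) := by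
      refine (real_inner_le_norm _ _).trans ?_
      rw [← dist_eq_norm x, hxs]
      refine mul_le_mul_of_nonneg_left (h3.trans_eq ?_) hδ.1.le
      ring
    have h6 : (m * s) ^ 2 ≤ (2 * δ) ^ 2 := pow_le_pow_left₀ (mul_nonneg hm.le hs.1) h1 2
    have h7 : C * s ^ 2 < δ := by
      rw [lt_div_iff₀ (by positivity)] at hδ3
      have h8 : m ^ 2 * (C * s ^ 2) < m ^ 2 * δ := by
        have h9 := mul_le_mul_of_nonneg_left h6 hC.le
        have h10 := mul_lt_mul_of_pos_left hδ3 hδ.1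
        nlinarith
      exact lt_of_mul_lt_mul_left h8 (by positivity)
    rw [h4, ← dist_eq_norm, hxs]
    have := mul_lt_mul_of_pos_left h7 hδ.1
    nlinarith

variable {N : ℕ} {p : Fin N → ℂ} {r : Fin N → ℝ} {c : ℂ} {R : ℝ} {γ : Fin (N + 1) → ℝ → ℂ}

namespace IsArcSystem

theorem start_mem_ball (hΓ : IsArcSystem p r c R p₀ γ) : p₀ ∈ ball c R :=
  hΓ.arc₀_subset ⟨0, by simp, hΓ.start 0⟩

theorem radius_pos' (hΓ : IsArcSystem p r c R p₀ γ) : 0 < R :=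
  pos_of_mem_ball hΓ.start_mem_ball

theorem start_notMem (hΓ : IsArcSystem p r c R p₀ γ) (j : Fin N) : p₀ ∉ closedBall (p j) (r j) :=
  disjoint_left.1 (hΓ.arc₀_disjoint j) ⟨0, by simp, hΓ.start 0⟩

theorem lt_dist_of_lt_one (hΓ : IsArcSystem p r c R p₀ γ) (j : Fin N) {t : ℝ}
    (ht : t ∈ Ico (0 : ℝ) 1) : r j < dist (γ j.succ t) (p j) := by
  by_contra hcon
  have h1 : γ j.succ t ∈ arc (γ j.succ) ∩ closedBall (p j) (r j) :=
    ⟨⟨t, ⟨ht.1, ht.2.le⟩, rfl⟩, not_lt.1 hcon⟩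
  rw [hΓ.arc_inter_disc j] at h1
  exact ht.2.ne (hΓ.injOn _ ⟨ht.1, ht.2.le⟩ (by simp) h1)

theorem disjoint_closedBall (hΓ : IsArcSystem p r c R p₀ γ) {k : Fin (N + 1)} {j : Fin N}
    (h : k ≠ j.succ) : Disjoint (closedBall (p j) (r j)) (arc (γ k)) := by
  induction k using Fin.cases with
  | zero => exact (hΓ.arc₀_disjoint j).symm
  | succ i => exact (hΓ.arc_disjoint i j fun hij => h (by rw [hij])).symm

/-- For thin tubes, at every point of the complement of the tubes and discs there is a vector
which points to the inner side of all boundary parts through this point. -/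
theorem eventually_exists_inward (hΓ : IsArcSystem p r c R p₀ γ) :
    ∀ᶠ δ in 𝓝[>] (0 : ℝ), ∀ x, ‖x - c‖ ≤ R → (∀ k, δ ≤ infDist x (arc (γ k))) →
      (∀ j, r j ≤ ‖x - p j‖) → ∃ u : ℂ, (‖x - c‖ = R → inner ℝ (x - c) u < 0) ∧
        (∀ j, ‖x - p j‖ = r j → 0 < inner ℝ (x - p j) u) ∧
        ∀ k, infDist x (arc (γ k)) = δ → ∀ q ∈ arc (γ k), dist x q = δ →
          0 < inner ℝ (x - q) u := by
  have hR := hΓ.radius_pos'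
  obtain ⟨ρ, hρ, hρ1, hρ2⟩ : ∃ ρ > 0, (∀ x, ‖x - p₀‖ < ρ → ‖x - c‖ ≠ R) ∧
      ∀ x, ‖x - p₀‖ < ρ → ∀ j, ‖x - p j‖ ≠ r j := by
    have h1 : ∀ᶠ x in 𝓝 p₀, ‖x - c‖ ≠ R := by
      have h2 := mem_ball.1 hΓ.start_mem_ball
      rw [dist_eq_norm] at h2
      exact (by fun_prop : Continuous fun x : ℂ => ‖x - c‖).continuousAt.eventually_ne h2.ne
    have h2 : ∀ᶠ x in 𝓝 p₀, ∀ j, ‖x - p j‖ ≠ r j := by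
      rw [eventually_all]
      intro j
      have h2 := hΓ.start_notMem j
      rw [mem_closedBall, dist_eq_norm, not_le] at h2
      exact (by fun_prop : Continuous fun x : ℂ => ‖x - p j‖).continuousAt.eventually_ne h2.ne'
    obtain ⟨ρ, hρ, h⟩ := Metric.eventually_nhds_iff.1 (h1.and h2)
    exact ⟨ρ, hρ, fun x hx => (h (by rwa [dist_eq_norm])).1,
      fun x hx => (h (by rwa [dist_eq_norm])).2⟩
  have e1 : ∀ᶠ δ in 𝓝[>] (0 : ℝ), ∀ k l, k ≠ l → ∀ x, infDist x (arc (γ k)) = δ →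
      infDist x (arc (γ l)) = δ →
      ‖x - p₀‖ < ρ ∧ ∀ q ∈ arc (γ k), dist x q = δ → 0 < inner ℝ (x - q) (x - p₀) := by
    simp only [eventually_all]
    intro k l hkl
    exact eventually_two_tubes (hΓ.smooth k) (hΓ.smooth l) (hΓ.injOn k) (hΓ.injOn l) (hΓ.start k)
      (hΓ.start l) (hΓ.inter k l hkl) (hΓ.directions k l hkl) hρ
  have e2 : ∀ᶠ δ in 𝓝[>] (0 : ℝ), ∀ k, ∀ x, infDist x (arc (γ k)) = δ → ∀ q ∈ arc (γ k),
      ∀ q' ∈ arc (γ k), dist x q = δ → dist x q' = δ → q = q' := by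
    rw [eventually_all]
    intro k
    obtain ⟨δ₀, hδ₀, h⟩ := exists_unique_nearest_of_infDist_lt (hΓ.smooth k) (hΓ.regular k)
      (hΓ.injOn k)
    filter_upwards [Ioo_mem_nhdsGT hδ₀] with δ hδ x hx q hq q' hq' hxq hxq'
    exact h x (hx ▸ hδ.2) q hq q' hq' (hxq.trans hx.symm) (hxq'.trans hx.symm)
  have e3 : ∀ᶠ δ in 𝓝[>] (0 : ℝ), ∀ x ∈ sphere c R, x ∉ arc (γ 0) →
      infDist x (arc (γ 0)) = δ → ∀ q ∈ arc (γ 0), dist x q = δ → ∀ l : ℝ, x - q ≠ l • (x - c) := by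
    obtain ⟨δ₀, hδ₀, h⟩ := exists_not_parallel_of_nearest (hΓ.smooth 0) hR hΓ.arc₀_end
      (fun t ht hts => (mem_ball.1 (hΓ.arc₀_subset ⟨t, ht, rfl⟩)).ne hts) hΓ.arc₀_transverse
    filter_upwards [Ioo_mem_nhdsGT hδ₀] with δ hδ x hx hxa hxδ q hq hxq
    exact h x hx hxa (hxδ ▸ hδ.2) q hq (hxq.trans hxδ.symm)
  have e4 : ∀ᶠ δ in 𝓝[>] (0 : ℝ), ∀ j : Fin N, ∀ x ∈ sphere (p j) (r j), x ∉ arc (γ j.succ) →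
      infDist x (arc (γ j.succ)) = δ → ∀ q ∈ arc (γ j.succ), dist x q = δ →
        ∀ l : ℝ, x - q ≠ l • (x - p j) := by
    rw [eventually_all]
    intro j
    obtain ⟨δ₀, hδ₀, h⟩ := exists_not_parallel_of_nearest (hΓ.smooth j.succ) (hΓ.radius_pos j)
      (hΓ.arc_end j) (fun t ht hts => (hΓ.lt_dist_of_lt_one j ht).ne' hts) (hΓ.arc_transverse j)
    filter_upwards [Ioo_mem_nhdsGT hδ₀] with δ hδ x hx hxa hxδ q hq hxq
    exact h x hx hxa (hxδ ▸ hδ.2) q hq (hxq.trans hxδ.symm)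
  have e5 : ∀ᶠ δ in 𝓝[>] (0 : ℝ), ∀ i : Fin N, ∀ x ∈ sphere c R,
      δ < infDist x (arc (γ i.succ)) := by
    rw [eventually_all]
    intro i
    refine eventually_lt_infDist (isCompact_sphere c R) (isCompact_arc (hΓ.smooth _)) arc_nonempty ?_
    rw [disjoint_left]
    exact fun x hx hx' => (mem_ball.1 (hΓ.arc_subset i hx')).ne hx
  have e6 : ∀ᶠ δ in 𝓝[>] (0 : ℝ), ∀ k, ∀ j : Fin N, k ≠ j.succ → ∀ x ∈ closedBall (p j) (r j),
      δ < infDist x (arc (γ k)) := by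
    simp only [eventually_all]
    intro k j hkj
    exact eventually_lt_infDist (isCompact_closedBall _ _) (isCompact_arc (hΓ.smooth _))
      arc_nonempty (hΓ.disjoint_closedBall hkj)
  filter_upwards [e1, e2, e3, e4, e5, e6, self_mem_nhdsWithin] with δ h1 h2 h3 h4 h5 h6 hδ x hxc
    hxk hxj
  replace hδ : 0 < δ := hδ
  have hdisc : ∀ j, ‖x - p j‖ = r j → ‖x - c‖ < R ∧ ∀ l, ‖x - p l‖ = r l → l = j := by
    intro j hj
    have hmem : ∀ l, ‖x - p l‖ = r l → x ∈ closedBall (p l) (r l) := fun l hl => by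
      rw [mem_closedBall, dist_eq_norm, hl]
    refine ⟨?_, fun l hl => ?_⟩
    · have := hΓ.discs_subset j (hmem j hj)
      rwa [mem_ball, dist_eq_norm] at this
    · by_contra hlj
      exact disjoint_left.1 (hΓ.discs_disjoint l j hlj) (hmem l hl) (hmem j hj)
  -- Two tubes meet only near `p₀`, away from all circles, and there the vector `x - p₀` serves
  -- every tube through the point.
  by_cases htwo : ∃ k l, k ≠ l ∧ infDist x (arc (γ k)) = δ ∧ infDist x (arc (γ l)) = δ
  · obtain ⟨k, l, hkl, hk, hl⟩ := htwo
    have hnear := (h1 k l hkl x hk hl).1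
    refine ⟨x - p₀, fun h => absurd h (hρ1 x hnear), fun j h => absurd h (hρ2 x hnear j), ?_⟩
    intro k' hk' q hq hxq
    by_cases hkk : k' = k
    · subst hkk
      exact (h1 k' l hkl x hk' hl).2 q hq hxq
    · exact (h1 k' k hkk x hk' hk).2 q hq hxq
  have hone : ∀ k l, infDist x (arc (γ k)) = δ → infDist x (arc (γ l)) = δ → k = l := by
    intro k l hk hl
    by_contra hkl
    exact htwo ⟨k, l, hkl, hk, hl⟩
  have hnotmem : ∀ k, x ∉ arc (γ k) := fun k hk => by
    have := hxk k
    rw [infDist_zero_of_mem hk] at this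
    exact absurd hδ (not_lt.2 this)
  by_cases htube : ∃ k, infDist x (arc (γ k)) = δ
  swap
  · have htube' : ∀ k, infDist x (arc (γ k)) ≠ δ := fun k hk => htube ⟨k, hk⟩
    by_cases hout : ‖x - c‖ = R
    · refine ⟨-(x - c), fun _ => ?_, fun j hj => absurd hout (hdisc j hj).1.ne,
        fun k hk => absurd hk (htube' k)⟩
      rw [inner_neg_right, real_inner_self_eq_norm_sq, hout]
      nlinarith
    by_cases hj : ∃ j, ‖x - p j‖ = r j
    · obtain ⟨j, hj⟩ := hj
      refine ⟨x - p j, fun h => absurd h hout, fun l hl => ?_, fun k hk => absurd hk (htube' k)⟩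
      rw [(hdisc j hj).2 l hl, real_inner_self_eq_norm_sq, hj]
      have := hΓ.radius_pos j
      positivity
    · exact ⟨0, fun h => absurd h hout, fun j hj' => absurd ⟨j, hj'⟩ hj,
        fun k hk => absurd hk (htube' k)⟩
  obtain ⟨k, hk⟩ := htube
  obtain ⟨q, hq, hqd⟩ := (isCompact_arc (hΓ.smooth k)).exists_infDist_eq_dist arc_nonempty x
  rw [hk] at hqd
  have hxq : ‖x - q‖ = δ := by rw [← dist_eq_norm, ← hqd]
  have huniq : ∀ u : ℂ, 0 < inner ℝ (x - q) u → ∀ k', infDist x (arc (γ k')) = δ →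
      ∀ q' ∈ arc (γ k'), dist x q' = δ → 0 < inner ℝ (x - q') u := by
    intro u hu k' hk' q' hq' hxq'
    obtain rfl := hone k' k hk' hk
    rwa [h2 k' x hk' q' hq' q hq hxq' hqd.symm]
  by_cases hout : ‖x - c‖ = R
  · have hk0 : k = 0 := by
      induction k using Fin.cases with
      | zero => rfl
      | succ i =>
        exact absurd hk (h5 i x (by rw [mem_sphere, dist_eq_norm, hout])).ne'
    subst hk0
    have hnp := h3 x (by rw [mem_sphere, dist_eq_norm, hout]) (hnotmem 0) hk q hq hqd.symm
    have hlt : inner ℝ (x - q) (x - c) < δ * R := by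
      rw [← hxq, ← hout, inner_lt_norm_mul_iff_real, hout]
      intro he
      refine hnp (‖x - q‖ / R) ?_
      rw [div_eq_inv_mul, mul_smul, ← he, smul_smul, inv_mul_cancel₀ hR.ne', one_smul]
    -- As `‖x - q‖ = δ` and `‖x - c‖ = R`, this is a positive multiple of the sum of the two unit
    -- inward normals. It is inward for both faces because the normals are not opposite, which is
    -- strictness in Cauchy–Schwarz.
    refine ⟨R • (x - q) - δ • (x - c), fun _ => ?_, fun j hj => absurd hout (hdisc j hj).1.ne,
      huniq _ ?_⟩
    · rw [inner_sub_right, inner_smul_right, inner_smul_right, real_inner_self_eq_norm_sq, hout,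
        real_inner_comm]
      nlinarith
    · rw [inner_sub_right, inner_smul_right, inner_smul_right, real_inner_self_eq_norm_sq, hxq]
      nlinarith
  by_cases hj : ∃ j, ‖x - p j‖ = r j
  · obtain ⟨j, hj⟩ := hj
    have hrj := hΓ.radius_pos j
    have hxs : x ∈ sphere (p j) (r j) := by rw [mem_sphere, dist_eq_norm, hj]
    have hkj : k = j.succ := by
      by_contra hkj
      exact absurd hk (h6 k j hkj x (sphere_subset_closedBall hxs)).ne'
    subst hkj
    have hnp := h4 j x hxs (hnotmem _) hk q hq hqd.symm
    have hlt : inner ℝ (x - q) (-(x - p j)) < δ * r j := by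
      rw [← hxq, ← hj, ← norm_neg (x - p j), inner_lt_norm_mul_iff_real, norm_neg, hj]
      intro he
      refine hnp (-(‖x - q‖ / r j)) ?_
      rw [neg_smul, ← smul_neg, div_eq_inv_mul, mul_smul, ← he, smul_smul,
        inv_mul_cancel₀ hrj.ne', one_smul]
    rw [inner_neg_right] at hlt
    refine ⟨r j • (x - q) + δ • (x - p j), fun h => absurd h hout, fun l hl => ?_, huniq _ ?_⟩
    · rw [(hdisc j hj).2 l hl, inner_add_right, inner_smul_right, inner_smul_right,
        real_inner_self_eq_norm_sq, hj, real_inner_comm]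
      nlinarith
    · rw [inner_add_right, inner_smul_right, inner_smul_right, real_inner_self_eq_norm_sq, hxq]
      nlinarith
  · refine ⟨x - q, fun h => absurd h hout, fun j hj' => absurd ⟨j, hj'⟩ hj, huniq _ ?_⟩
    rw [real_inner_self_eq_norm_sq, hxq]
    positivity

end IsArcSystem
end ArcSystem
end PlaneCurve

namespace PlaneCurve
open Filter Topology Metric Set

/-! ### The base: a defining function and inward vectors at all points. -/

section BaseModel

theorem mem_base_iff {N : ℕ} {p : Fin N → ℂ} {r : Fin N → ℝ} {c : ℂ} {R : ℝ}
    {γ : Fin (N + 1) → ℝ → ℂ} {δ : ℝ} {x : ℂ} :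
    x ∈ closedBall c R \ graphNbhd p r γ δ ↔
      ‖x - c‖ ≤ R ∧ (∀ k, δ ≤ infDist x (arc (γ k))) ∧ ∀ j, r j ≤ ‖x - p j‖ := by
  simp only [Set.mem_sdiff, graphNbhd, mem_union, mem_iUnion, not_or, not_exists, mem_closedBall,
    dist_eq_norm, mem_ball, not_lt, mem_thickening_iff_infDist_lt arc_nonempty]

/-- The functions on the base whose common nonnegativity set is the complement of the tubes
and discs; the one belonging to the disc `i` is replaced by `Ψ`. -/
noncomputable def baseConstraint {N : ℕ} (p : Fin N → ℂ) (r : Fin N → ℝ) (c : ℂ) (R : ℝ)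
    (γ : Fin (N + 1) → ℝ → ℂ) (δ : ℝ) (i : Fin N) (Ψ : ℂ → ℝ) :
    Option (Fin (N + 1) ⊕ Fin N) → ℂ → ℝ
  | none => fun z => (-1) * ‖z - c‖ ^ 2 + R ^ 2
  | some (Sum.inl k) => fun z => infDist z (arc (γ k)) - δ
  | some (Sum.inr j) => if j = i then Ψ else fun z => 1 * ‖z - p j‖ ^ 2 + -(r j ^ 2)

theorem continuous_baseConstraint {N : ℕ} {p : Fin N → ℂ} {r : Fin N → ℝ} {c : ℂ} {R : ℝ}
    {γ : Fin (N + 1) → ℝ → ℂ} {δ : ℝ} {i : Fin N} {Ψ : ℂ → ℝ} (hΨ : Continuous Ψ)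
    (o : Option (Fin (N + 1) ⊕ Fin N)) : Continuous (baseConstraint p r c R γ δ i Ψ o) := by
  rcases o with _ | k | j
  · simp only [baseConstraint]
    fun_prop
  · exact (continuous_infDist_pt _).sub continuous_const
  · simp only [baseConstraint]
    split_ifs
    · exact hΨ
    · fun_prop

variable {N : ℕ} {p : Fin N → ℂ} {r : Fin N → ℝ} {c : ℂ} {R : ℝ} {p₀ : ℂ}
  {γ : Fin (N + 1) → ℝ → ℂ}

/-- The base of the second piece carries a function whose nonnegativity set is the base of the
first piece, together with vectors which point into the base and increase the function. -/
theorem IsArcSystem.eventually_base_model (hΓ : IsArcSystem p r c R p₀ γ) :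
    ∀ᶠ δ in 𝓝[>] (0 : ℝ), ∀ (i : Fin N) (r' : ℝ), 0 < r' → r' < r i →
      ∃ H : ℂ → ℝ, Continuous H ∧ (∀ x, x ∈ closedBall c R \ graphNbhd p r γ δ ↔ 0 ≤ H x) ∧
        IsClosed (closedBall c R \ graphNbhd p r γ δ ∪
          (regionA (p i) (r i) r' (arc (γ i.succ)) δ ∪ closedBall (p i) r')) ∧
        ∀ x ∈ closedBall c R \ graphNbhd p r γ δ ∪
          (regionA (p i) (r i) r' (arc (γ i.succ)) δ ∪ closedBall (p i) r'),
          (∃ u, PointsInto (closedBall c R \ graphNbhd p r γ δ ∪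
            (regionA (p i) (r i) r' (arc (γ i.succ)) δ ∪ closedBall (p i) r')) x u ∧
            (H x ≤ 0 → IncreasesAlong H x u)) ∧
          (r' < ‖x - p i‖ → ‖x - p i‖ < r i → ∀ η > 0, ∃ u, ‖u - (x - p i)‖ < η ∧
            PointsInto (closedBall c R \ graphNbhd p r γ δ ∪
              (regionA (p i) (r i) r' (arc (γ i.succ)) δ ∪ closedBall (p i) r')) x u ∧
            IncreasesAlong H x u) := by
  have e1 : ∀ᶠ δ in 𝓝[>] (0 : ℝ), ∀ i : Fin N, ∃ (w : ℂ) (cβ : ℝ), ‖w‖ = 1 ∧ 0 < cβ ∧ cβ < 1 ∧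
      ∀ a ∈ sphere (p i) (r i),
        (r i * cβ < inner ℝ (a - p i) w ∧ infDist a (arc (γ i.succ)) < δ) ∨
        (inner ℝ (a - p i) w = r i * cβ ∧ infDist a (arc (γ i.succ)) = δ ∧
          ∀ q ∈ arc (γ i.succ), dist a q = infDist a (arc (γ i.succ)) →
            0 < inner ℝ (a - q) (cβ • (a - p i) - r i • w)) ∨
        (inner ℝ (a - p i) w < r i * cβ ∧ δ < infDist a (arc (γ i.succ))) := by
    rw [eventually_all]
    intro i
    obtain ⟨δ₀, hδ₀, h⟩ := exists_slit (hΓ.smooth i.succ) (hΓ.regular _) (hΓ.injOn _)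
      (hΓ.radius_pos i) (hΓ.arc_end i) (fun t ht => hΓ.lt_dist_of_lt_one i ht) (hΓ.arc_transverse i)
    filter_upwards [Ioo_mem_nhdsGT hδ₀] with δ hδ
    exact h δ hδ
  have e2 : ∀ᶠ δ in 𝓝[>] (0 : ℝ), ∀ k, ∀ j : Fin N, k ≠ j.succ → ∀ x ∈ closedBall (p j) (r j),
      δ < infDist x (arc (γ k)) := by
    simp only [eventually_all]
    intro k j hkj
    exact eventually_lt_infDist (isCompact_closedBall _ _) (isCompact_arc (hΓ.smooth _))
      arc_nonempty (hΓ.disjoint_closedBall hkj)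
  filter_upwards [hΓ.eventually_exists_inward, e1, e2, self_mem_nhdsWithin] with δ hin hslit hfar
    hδ i r' hr' hrr
  replace hδ : 0 < δ := hδ
  obtain ⟨w, cβ, hw, hc0, hc1, hsl⟩ := hslit i
  have hri : 0 < r i := hΓ.radius_pos i
  have hR := hΓ.radius_pos'
  set P := p i with hP
  set Γ := arc (γ i.succ) with hΓdef
  have hΓc : IsCompact Γ := isCompact_arc (hΓ.smooth _)
  have hd : 0 < r i - r' := sub_pos.2 hrr
  -- The slope is chosen so that inside the disc `Ψ` lies strictly below the constraint of the tube:
  -- on the small disc it is below `-2 * δ`, and on the region A it falls at rate at least 2 towards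
  -- the centre, whereas the distance to the arc falls at rate at most 1.
  obtain ⟨Ψ, hΨc, hΨpos, hΨ0, hΨle, hΨ1, hΨ2, hΨ3⟩ := exists_slit_disc_function P hw hc0 hc1 hr' hrr
    (show 0 < 2 + 2 * δ / (r i - r') by positivity)
  have hΨnp : ∀ x, ‖x - P‖ ≤ r i → Ψ x ≤ 0 := fun x hx => by
    have := hΨle x hx
    have h1 := mul_nonneg (show 0 ≤ 2 + 2 * δ / (r i - r') by positivity) (sub_nonneg.2 hx)
    linarith
  have hslf : ∀ a ∈ sphere P (r i), δ ≤ infDist a Γ ↔ 0 ≤ slitFun P w cβ a := by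
    intro a ha
    rw [slitFun, mem_sphere_iff_norm.1 ha]
    rcases hsl a ha with ⟨h1, h2⟩ | ⟨h1, h2, -⟩ | ⟨h1, h2⟩
    · exact ⟨fun h => absurd h2 (not_lt.2 h), fun h => by linarith⟩
    · exact ⟨fun _ => by linarith, fun _ => h2.ge⟩
    · exact ⟨fun _ => by linarith, fun _ => h2.le⟩
  set B := closedBall c R \ graphNbhd p r γ δ with hB
  set S := B ∪ (regionA P (r i) r' Γ δ ∪ closedBall P r') with hS
  let G := baseConstraint p r c R γ δ i Ψ
  have hG : ∀ o, Continuous (G o) := continuous_baseConstraint hΨc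
  have hne : (Finset.univ : Finset (Option (Fin (N + 1) ⊕ Fin N))).Nonempty := ⟨none, by simp⟩
  let H : ℂ → ℝ := fun z => Finset.univ.inf' hne fun o => G o z
  have hHc : Continuous H := Continuous.finset_inf'_apply hne fun o _ => hG o
  have hGi : G (some (Sum.inr i)) = Ψ := by simp [G, baseConstraint]
  have hGj : ∀ j, j ≠ i → G (some (Sum.inr j)) = fun z => 1 * ‖z - p j‖ ^ 2 + -(r j ^ 2) := by
    intro j hj
    simp [G, baseConstraint, hj]
  have hBH : ∀ x, x ∈ B ↔ 0 ≤ H x := by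
    intro x
    rw [hB, mem_base_iff, Finset.le_inf'_iff]
    have hΨiff : 0 ≤ Ψ x ↔ r i ≤ ‖x - P‖ := by
      rcases lt_trichotomy ‖x - P‖ (r i) with h | h | h
      · have h1 := hΨle x h.le
        have h2 : 0 < (2 + 2 * δ / (r i - r')) * (r i - ‖x - P‖) :=
          mul_pos (by positivity) (sub_pos.2 h)
        exact ⟨fun h3 => by linarith, fun h3 => by linarith⟩
      · exact ⟨fun _ => h.ge, fun _ => (hΨ0 x h).ge⟩
      · exact ⟨fun _ => h.le, fun _ => (hΨpos x h).le⟩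
    have hout : 0 ≤ G none x ↔ ‖x - c‖ ≤ R := by
      change 0 ≤ (-1) * ‖x - c‖ ^ 2 + R ^ 2 ↔ _
      rw [← pow_le_pow_iff_left₀ (norm_nonneg _) hR.le two_ne_zero]
      constructor <;> intro h <;> linarith
    have hdj : ∀ j, 0 ≤ G (some (Sum.inr j)) x ↔ r j ≤ ‖x - p j‖ := by
      intro j
      by_cases hj : j = i
      · subst hj
        rw [hGi, hΨiff]
      · rw [hGj j hj, ← pow_le_pow_iff_left₀ (hΓ.radius_pos j).le (norm_nonneg _) two_ne_zero]
        constructor <;> intro h <;> linarith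
    have htk : ∀ k, 0 ≤ G (some (Sum.inl k)) x ↔ δ ≤ infDist x (arc (γ k)) := fun k => sub_nonneg
    constructor
    · rintro ⟨h1, h2, h3⟩ o -
      rcases o with _ | k | j
      · exact hout.2 h1
      · exact (htk k).2 (h2 k)
      · exact (hdj j).2 (h3 j)
    · exact fun h => ⟨hout.1 (h none (by simp)), fun k => (htk k).1 (h _ (by simp)),
        fun j => (hdj j).1 (h _ (by simp))⟩
  have hA : ∀ x, x ∈ regionA P (r i) r' Γ δ ↔
      r' ≤ ‖x - P‖ ∧ ‖x - P‖ ≤ r i ∧ 0 ≤ slitFun P w cβ x :=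
    fun x => mem_regionA_iff hr' hrr arc_nonempty hslf
  have hSiff : ∀ x, x ∈ S ↔ x ∈ B ∨ (‖x - P‖ ≤ r i ∧ (‖x - P‖ ≤ r' ∨ 0 ≤ slitFun P w cβ x)) := by
    intro x
    rw [hS, mem_union, mem_union, hA, mem_closedBall, dist_eq_norm]
    refine or_congr_right ⟨?_, ?_⟩
    · rintro (⟨h1, h2, h3⟩ | h)
      · exact ⟨h2, Or.inr h3⟩
      · exact ⟨h.trans hrr.le, Or.inl h⟩
    · rintro ⟨h1, h2 | h2⟩
      · exact Or.inr h2
      · rcases le_total ‖x - P‖ r' with h3 | h3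
        · exact Or.inr h3
        · exact Or.inl ⟨h3, h1, h2⟩
  have hBr : ∀ x, x ∈ B → r i ≤ ‖x - P‖ := fun x hx => (mem_base_iff.1 hx).2.2 i
  have hsc := continuous_slitFun P w cβ
  have hnc : Continuous fun x : ℂ => ‖x - P‖ := by fun_prop
  have hclosed : IsClosed S := by
    have h1 : IsClosed B := by
      have : B = {x | 0 ≤ H x} := Set.ext hBH
      rw [this]
      exact isClosed_le continuous_const hHc
    have h2 : S = B ∪ ({x | ‖x - P‖ ≤ r i} ∩ ({x | ‖x - P‖ ≤ r'} ∪ {x | 0 ≤ slitFun P w cβ x})) :=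
      Set.ext hSiff
    rw [h2]
    exact h1.union ((isClosed_le hnc continuous_const).inter
      ((isClosed_le hnc continuous_const).union (isClosed_le continuous_const hsc)))
  have hoth : ∀ x, ‖x - P‖ ≤ r i → ∀ o, o ≠ some (Sum.inl i.succ) → o ≠ some (Sum.inr i) →
      0 < G o x := by
    intro x hx o ho1 ho2
    have hxmem : x ∈ closedBall P (r i) := by rwa [mem_closedBall, dist_eq_norm]
    rcases o with _ | k | j
    · have h1 := hΓ.discs_subset i hxmem
      rw [mem_ball, dist_eq_norm] at h1
      change 0 < (-1) * ‖x - c‖ ^ 2 + R ^ 2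
      have := pow_lt_pow_left₀ h1 (norm_nonneg _) two_ne_zero
      linarith
    · exact sub_pos.2 (hfar k i (fun h => ho1 (by rw [h])) x hxmem)
    · have hj : j ≠ i := fun h => ho2 (by rw [h])
      have h1 := disjoint_left.1 (hΓ.discs_disjoint i j hj.symm) hxmem
      rw [mem_closedBall, dist_eq_norm, not_le] at h1
      rw [hGj j hj]
      have := pow_lt_pow_left₀ h1 (hΓ.radius_pos j).le two_ne_zero
      change 0 < 1 * ‖x - p j‖ ^ 2 + -(r j ^ 2)
      linarith
  -- On the closed disc `Ψ ≤ 0` while all constraints other than `Ψ` and the tube of the own arc are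
  -- positive, so only these two can attain the minimum.
  have hInc : ∀ x u, ‖x - P‖ ≤ r i → IncreasesAlong Ψ x u →
      (Ψ x < infDist x Γ - δ ∨ IncreasesAlong (fun z => infDist z Γ) x u) →
      IncreasesAlong H x u := by
    intro x u hx hΨu hor
    refine IncreasesAlong.inf'_of_active hne (fun o _ => (hG o).continuousAt) fun o _ ho => ?_
    by_cases ho2 : o = some (Sum.inr i)
    · rw [ho2, hGi]
      exact hΨu
    have ho' := ho (some (Sum.inr i)) (by simp)
    rw [hGi] at ho'
    by_cases ho1 : o = some (Sum.inl i.succ)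
    · subst ho1
      rcases hor with h | h
      · exact absurd h (not_lt.2 ho')
      · exact h.sub_const δ
    · exact absurd ((hoth x hx o ho1 ho2).trans_le (ho'.trans (hΨnp x hx))) (lt_irrefl _)
  have hlocal : ∀ x, ‖x - P‖ < r i → ∀ᶠ y in 𝓝 x,
      y ∈ ({y | ‖y - P‖ ≤ r'} ∪ {y | 0 ≤ slitFun P w cβ y} : Set ℂ) ↔ y ∈ S := by
    intro x hx
    filter_upwards [hnc.continuousAt.eventually_lt_const hx] with y hy
    rw [hSiff]
    exact ⟨fun h => Or.inr ⟨hy.le, h⟩, fun h => (h.resolve_left fun hb => absurd hy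
      (not_lt.2 (hBr y hb))).2⟩
  have htube : ∀ x ∈ S, ‖x - P‖ < r i → Ψ x < infDist x Γ - δ := by
    intro x hx hxr
    have h1 := hΨle x hxr.le
    have h2 := ((hSiff x).1 hx).resolve_left fun hb => absurd hxr (not_lt.2 (hBr x hb))
    have h3 : 0 < r i - ‖x - P‖ := sub_pos.2 hxr
    rcases le_or_gt ‖x - P‖ r' with h4 | h4
    · have h5 : 2 * δ ≤ 2 * δ / (r i - r') * (r i - ‖x - P‖) := by
        rw [div_mul_eq_mul_div, le_div_iff₀ hd]
        exact mul_le_mul_of_nonneg_left (by linarith) (by linarith)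
      have := infDist_nonneg (x := x) (s := Γ)
      nlinarith
    · have h5 := h2.2.resolve_left (not_le.2 h4)
      have hx0 : 0 < ‖x - P‖ := hr'.trans h4
      set a := P + (r i / ‖x - P‖) • (x - P) with ha
      have has : a ∈ sphere P (r i) := by
        rw [mem_sphere_iff_norm, ha, add_sub_cancel_left, norm_smul,
          Real.norm_of_nonneg (by positivity)]
        field_simp
      have h6 : 0 ≤ slitFun P w cβ a := by
        have : slitFun P w cβ a = (r i / ‖x - P‖) * slitFun P w cβ x := by
          simp only [slitFun, ha, add_sub_cancel_left, norm_smul, inner_smul_left, conj_trivial,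
            Real.norm_of_nonneg (show 0 ≤ r i / ‖x - P‖ by positivity)]
          ring
        rw [this]
        positivity
      have h7 := (hslf a has).2 h6
      have h8 : dist a x = r i - ‖x - P‖ := by
        have : a - x = (r i / ‖x - P‖ - 1) • (x - P) := by
          rw [ha, sub_smul, one_smul]; abel
        rw [dist_eq_norm, this, norm_smul, Real.norm_of_nonneg]
        · field_simp
        · rw [sub_nonneg, one_le_div hx0]; exact hxr.le
      have h9 : infDist a Γ ≤ infDist x Γ + dist a x := infDist_le_infDist_add_dist
      have h10 : 0 ≤ 2 * δ / (r i - r') * (r i - ‖x - P‖) := by positivity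
      nlinarith
  have hwx : ∀ x : ℂ, inner ℝ (x - P) w ≤ ‖x - P‖ := fun x =>
    (real_inner_le_norm _ _).trans_eq (by rw [hw, mul_one])
  have hslw : ∀ x, x ≠ P → IncreasesAlong (slitFun P w cβ) x (-w) := by
    intro x hx
    refine increasesAlong_slitFun hx ?_
    rw [inner_neg_right, inner_neg_left, real_inner_self_eq_norm_sq, hw]
    have := norm_pos_iff.2 (sub_ne_zero.2 hx)
    nlinarith [mul_le_mul_of_nonneg_left (hwx x) hc0.le]
  -- The radial vector is tangent to the sides of the slit, so it is tilted slightly by `-w`, which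
  -- makes it point strictly away from the slit.
  have hrad : ∀ x ∈ S, r' < ‖x - P‖ → ‖x - P‖ < r i → ∀ η > 0, ∃ u, ‖u - (x - P)‖ < η ∧
      PointsInto S x u ∧ IncreasesAlong H x u := by
    intro x hx hx1 hx2 η hη
    have h2 := (((hSiff x).1 hx).resolve_left fun hb => absurd hx2 (not_lt.2 (hBr x hb))).2.resolve_left
      (not_le.2 hx1)
    have h3 := hΨ2 x hx1 (by rw [slitFun] at h2; linarith)
    have h4 : Tendsto (fun t : ℝ => (x, (x - P) + t • (-w))) (𝓝[>] 0) (𝓝 (x, x - P)) := by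
      have : Continuous fun t : ℝ => (x, (x - P) + t • (-w)) := by fun_prop
      have := this.tendsto 0
      rw [zero_smul, add_zero] at this
      exact this.mono_left nhdsWithin_le_nhds
    obtain ⟨t, ht1, ht2⟩ := ((h4.eventually h3.eventually).and (Ioo_mem_nhdsGT hη)).exists
    have hx0 : x ≠ P := by
      rintro rfl
      rw [sub_self, norm_zero] at hx1
      exact absurd hr' (not_lt.2 hx1.le)
    refine ⟨(x - P) + t • (-w), ?_, ?_, hInc x _ hx2.le ht1 (Or.inl (htube x hx hx2))⟩
    · rw [add_sub_cancel_left, norm_smul, norm_neg, hw, mul_one, Real.norm_of_nonneg ht2.1.le]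
      exact ht2.2
    · have h5 : PointsInto {y | 0 ≤ slitFun P w cβ y} x ((x - P) + t • (-w)) := by
        refine (increasesAlong_slitFun hx0 ?_).pointsInto 0
        have hn := norm_pos_iff.2 (sub_ne_zero.2 hx0)
        simp only [inner_add_left, inner_add_right, inner_smul_left, inner_smul_right,
          inner_neg_left, inner_neg_right, real_inner_self_eq_norm_sq, hw, conj_trivial]
        rw [slitFun] at h2
        have h6 := mul_le_mul_of_nonneg_left (hwx x) hc0.le
        have h7 : 0 < t * (‖x - P‖ - cβ * inner ℝ (x - P) w) :=
          mul_pos ht2.1 (by nlinarith)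
        have h8 := mul_nonneg hn.le h2
        nlinarith
      refine h5.congr ?_
      filter_upwards [hlocal x hx2, hnc.continuousAt.eventually_const_lt hx1] with y hy hy'
      rw [← hy]
      exact ⟨fun h => Or.inr h, fun h => h.resolve_left (not_le.2 hy')⟩
  refine ⟨H, hHc, hBH, hclosed, fun x hx => ⟨?_, hrad x hx⟩⟩
  rcases lt_trichotomy ‖x - P‖ (r i) with hxr | hxr | hxr
  · rcases le_or_gt ‖x - P‖ r' with hx1 | hx1
    · refine ⟨-w, ?_, fun _ => hInc x _ hxr.le (hΨ1 x hx1) (Or.inl (htube x hx hxr))⟩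
      refine PointsInto.congr ?_ (hlocal x hxr)
      rcases hx1.lt_or_eq with hx2 | hx2
      · refine pointsInto_of_mem_nhds ?_ _
        filter_upwards [hnc.continuousAt.eventually_lt_const hx2] with y hy
        exact Or.inl hy.le
      have hx0 : x ≠ P := by
        rintro rfl
        rw [sub_self, norm_zero] at hx2
        exact hr'.ne hx2
      rcases lt_or_ge 0 (slitFun P w cβ x) with h3 | h3
      · refine pointsInto_of_mem_nhds ?_ _
        filter_upwards [hsc.continuousAt.eventually_const_lt h3] with y hy
        exact Or.inr hy.le
      -- On this part of the small circle `-w` leads both into the small disc and into the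
      -- complement of the cone, so it is inward even at the re-entrant corner.
      · refine PointsInto.union ?_ ((hslw x hx0).pointsInto 0)
        have h4 : 0 < (-1) * inner ℝ (x - P) (-w) := by
          rw [slitFun, hx2] at h3
          rw [inner_neg_right]
          nlinarith
        refine ((increasesAlong_norm_sub_sq (r' ^ 2) h4).pointsInto 0).congr
          (Eventually.of_forall fun y => ?_)
        simp only [mem_ofPred_eq]
        rw [← pow_le_pow_iff_left₀ (norm_nonneg _) hr'.le two_ne_zero]
        constructor <;> intro h <;> linarith
    · obtain ⟨u, -, h1, h2⟩ := hrad x hx hx1 hxr 1 one_pos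
      exact ⟨u, h1, fun _ => h2⟩
  · have hxs : x ∈ sphere P (r i) := mem_sphere_iff_norm.2 hxr
    have hΨx := hΨ0 x hxr
    have hxP : x ≠ P := by
      rintro rfl
      rw [sub_self, norm_zero] at hxr
      exact hri.ne hxr
    have hdx : δ ≤ infDist x Γ := by
      rcases (hSiff x).1 hx with h | h
      · exact (mem_base_iff.1 h).2.1 i.succ
      · refine (hslf x hxs).2 (h.2.resolve_left ?_)
        rw [hxr, not_le]
        exact hrr
    -- Near the circle the base is glued from the complement of the cone inside and the complement
    -- of the tube outside; the two agree on the circle.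
    have hSloc : ∀ᶠ y in 𝓝 x, y ∈ {y | (‖y - P‖ - r i ≤ 0 ∧ y ∈ {y | 0 ≤ slitFun P w cβ y}) ∨
        (0 ≤ ‖y - P‖ - r i ∧ y ∈ {y | δ ≤ infDist y Γ})} ↔ y ∈ S := by
      have h1 : ∀ᶠ y in 𝓝 x, ∀ o, o ≠ some (Sum.inl i.succ) → o ≠ some (Sum.inr i) → 0 < G o y := by
        rw [eventually_all]
        intro o
        simp only [eventually_imp_distrib_left]
        intro ho1 ho2
        exact (hG o).continuousAt.eventually_const_lt (hoth x hxr.le o ho1 ho2)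
      filter_upwards [h1, hnc.continuousAt.eventually_const_lt (hrr.trans_eq hxr.symm)] with y hy hy'
      rw [hSiff, sub_nonpos, sub_nonneg]
      constructor
      · rintro (⟨h2, h3⟩ | ⟨h2, h3⟩)
        · exact Or.inr ⟨h2, Or.inr h3⟩
        · left
          rw [hBH, Finset.le_inf'_iff]
          intro o _
          by_cases ho1 : o = some (Sum.inl i.succ)
          · rw [ho1]
            exact sub_nonneg.2 h3
          by_cases ho2 : o = some (Sum.inr i)
          · rw [ho2, hGi]
            rcases h2.eq_or_lt with h4 | h4
            · exact (hΨ0 y h4.symm).ge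
            · exact (hΨpos y h4).le
          · exact (hy o ho1 ho2).le
      · rintro (h2 | ⟨h2, h3⟩)
        · exact Or.inr ⟨hBr y h2, (mem_base_iff.1 h2).2.1 i.succ⟩
        · exact Or.inl ⟨h2, h3.resolve_left (not_le.2 hy')⟩
    rcases hdx.eq_or_lt with hdx' | hdx'
    · obtain ⟨hin1, -, hq⟩ : inner ℝ (x - P) w = r i * cβ ∧ infDist x Γ = δ ∧
          ∀ q ∈ Γ, dist x q = infDist x Γ → 0 < inner ℝ (x - q) (cβ • (x - P) - r i • w) := by
        rcases hsl x hxs with h | h | h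
        · exact absurd h.2 (not_lt.2 hdx)
        · exact h
        · exact absurd hdx' h.2.ne
      -- At an end of the slit `E` is tangent to the circle and leads away from the slit, increasing
      -- both the distance to the arc and `slitFun`. A small radial component is added later to
      -- increase `Ψ` as well.
      set E := cβ • (x - P) - r i • w with hE
      have hxΓ : x ∉ Γ := fun h => by
        rw [infDist_zero_of_mem h] at hdx'
        exact hδ.ne' hdx'
      have hd1 : IncreasesAlong (fun z => infDist z Γ) x E :=
        increasesAlong_infDist hΓc arc_nonempty hxΓ hq
      have hxE : inner ℝ (x - P) E = 0 := by
        rw [hE, inner_sub_right, inner_smul_right, inner_smul_right, real_inner_self_eq_norm_sq,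
          hxr, hin1]
        ring
      have hs1 : IncreasesAlong (slitFun P w cβ) x E := by
        refine increasesAlong_slitFun hxP ?_
        rw [hxE, hE, inner_sub_left, inner_smul_left, inner_smul_left, real_inner_self_eq_norm_sq,
          hw, hxr, hin1]
        simp only [conj_trivial]
        have : 0 < r i ^ 2 * (1 - cβ ^ 2) := mul_pos (by positivity) (by nlinarith)
        nlinarith
      have h4 : Tendsto (fun t : ℝ => (x, E + t • (x - P))) (𝓝[>] 0) (𝓝 (x, E)) := by
        have : Continuous fun t : ℝ => (x, E + t • (x - P)) := by fun_prop
        have := this.tendsto 0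
        rw [zero_smul, add_zero] at this
        exact this.mono_left nhdsWithin_le_nhds
      obtain ⟨t, ⟨ht1, ht2⟩, ht3⟩ := (((h4.eventually hd1.eventually).and
        (h4.eventually hs1.eventually)).and self_mem_nhdsWithin).exists
      replace ht3 : 0 < t := ht3
      refine ⟨E + t • (x - P), ?_, fun _ => hInc x _ hxr.le (hΨ3 x _ hxr ?_) (Or.inr ht1)⟩
      · refine ((ht2.pointsInto 0).glue (ht1.pointsInto δ) (h := fun y => ‖y - P‖ - r i)
          (by fun_prop) (Eventually.of_forall fun y hy => ?_)).congr hSloc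
        exact (hslf y (mem_sphere_iff_norm.2 (sub_eq_zero.1 hy))).symm
      · rw [inner_add_right, hxE, inner_smul_right, real_inner_self_eq_norm_sq, hxr]
        positivity
    · have hsx : 0 < slitFun P w cβ x := by
        rw [slitFun, hxr]
        rcases hsl x hxs with h | h | h
        · exact absurd h.2 (not_lt.2 hdx)
        · exact absurd h.2.1 hdx'.ne'
        · linarith [h.1]
      refine ⟨x - P, pointsInto_of_mem_nhds ?_ _, fun _ => hInc x _ hxr.le (hΨ3 x _ hxr ?_)
        (Or.inl (by rw [hΨx]; linarith))⟩
      · filter_upwards [hSloc, hsc.continuousAt.eventually_const_lt hsx,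
          (continuous_infDist_pt Γ).continuousAt.eventually_const_lt hdx'] with y hy hy1 hy2
        rw [← hy]
        rcases le_total (‖y - P‖ - r i) 0 with h | h
        · exact Or.inl ⟨h, hy1.le⟩
        · exact Or.inr ⟨h, hy2.le⟩
      · rw [real_inner_self_eq_norm_sq, hxr]
        positivity
  · have hxB : x ∈ B := ((hSiff x).1 hx).resolve_right fun h => absurd hxr (not_lt.2 h.1)
    have hSB : ∀ᶠ y in 𝓝 x, y ∈ {y | 0 ≤ H y} ↔ y ∈ S := by
      filter_upwards [hnc.continuousAt.eventually_const_lt hxr] with y hy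
      rw [hSiff, ← hBH]
      exact ⟨Or.inl, fun h => h.resolve_right fun h => absurd hy (not_lt.2 h.1)⟩
    rcases ((hBH x).1 hxB).lt_or_eq with hHx | hHx
    · refine ⟨0, pointsInto_of_mem_nhds ?_ _, fun h => absurd hHx (not_lt.2 h)⟩
      filter_upwards [hSB, hHc.continuousAt.eventually_const_lt hHx] with y hy hy'
      exact hy.1 hy'.le
    -- Outside the disc every constraint attaining the minimum vanishes at `x`, so it belongs to a
    -- boundary face through `x`, and the common inward vector increases it.
    · obtain ⟨hm1, hm2, hm3⟩ := mem_base_iff.1 hxB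
      obtain ⟨u, hu1, hu2, hu3⟩ := hin x hm1 hm2 hm3
      have hu : IncreasesAlong H x u := by
        refine IncreasesAlong.inf'_of_active hne (fun o _ => (hG o).continuousAt) fun o _ ho => ?_
        have hGo : G o x = 0 := by
          refine le_antisymm ?_ ?_
          · rw [hHx]
            exact Finset.le_inf' _ _ ho
          · rw [hHx]
            exact Finset.inf'_le _ (Finset.mem_univ o)
        rcases o with _ | k | j
        · have h1 : (-1) * ‖x - c‖ ^ 2 + R ^ 2 = 0 := hGo
          have h2 : ‖x - c‖ = R :=
            (pow_left_inj₀ (norm_nonneg _) hR.le two_ne_zero).1 (by linarith)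
          refine increasesAlong_norm_sub_sq _ ?_
          have := hu1 h2
          linarith
        · have h1 : infDist x (arc (γ k)) = δ := sub_eq_zero.1 hGo
          have h2 : x ∉ arc (γ k) := fun h => by
            rw [infDist_zero_of_mem h] at h1
            exact hδ.ne h1
          exact (increasesAlong_infDist (isCompact_arc (hΓ.smooth k)) arc_nonempty h2
            fun q hq hxq => hu3 k h1 q hq (hxq.trans h1)).sub_const δ
        · by_cases hj : j = i
          · subst hj
            rw [hGi] at hGo
            exact absurd hGo (hΨpos x hxr).ne'
          · rw [hGj j hj] at hGo ⊢
            have h1 : 1 * ‖x - p j‖ ^ 2 + -(r j ^ 2) = 0 := hGo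
            have h2 : ‖x - p j‖ = r j :=
              (pow_left_inj₀ (norm_nonneg _) (hΓ.radius_pos j).le two_ne_zero).1 (by linarith)
            refine increasesAlong_norm_sub_sq _ ?_
            rw [one_mul]
            exact hu2 j h2
      exact ⟨u, (hu.pointsInto 0).congr hSB, fun _ => hu⟩

end BaseModel
end PlaneCurve

namespace PlaneCurve
open Filter Topology Metric Set

/-! ### The total space: combining base and fibre directions. -/

section Total

theorem IncreasesAlong.comp_snd {E F : Type*} [NormedAddCommGroup E] [NormedSpace ℝ E]
    [NormedAddCommGroup F] [NormedSpace ℝ F] {H : F → ℝ} {x w : E × F}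
    (h : IncreasesAlong H x.2 w.2) : IncreasesAlong (fun z : E × F => H z.2) x w := by
  obtain ⟨η, hη, c, hc, H⟩ := h
  refine ⟨η, hη, c, hc, fun y hyx u hu t ht htη => H y.2 ?_ u.2 ?_ t ht htη⟩
  · exact (norm_snd_le (y - x)).trans_lt hyx
  · exact (norm_snd_le (u - w)).trans_lt hu

theorem regionA_subset_closedBall (p : ℂ) (r r' : ℝ) (s : Set ℂ) (δ : ℝ) :
    regionA p r r' s δ ⊆ closedBall p r := by
  intro x hx
  simp only [regionA, mem_iUnion] at hx
  obtain ⟨a, -, -, hx⟩ := hx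
  exact closure_minimal (sdiff_subset.trans ball_subset_closedBall) isClosed_closedBall hx

theorem mem_preim_iff {f : MvPolynomial (Fin 2) ℂ} {g : ℂ × ℂ → ℝ} {ε : ℝ} {D S : Set ℂ} {b : ℂ}
    {T : ℝ} {z : ℂ × ℂ} (hS : S ⊆ D) :
    z ∈ preim D (closedBall b T) (curveNbhd f g ε) S ↔
      z.1 ∈ S ∧ ‖z.2 - b‖ ≤ T ∧ ε ≤ tubeFun f g z := by
  simp only [preim, curveNbhd, tubeFun, mem_ofPred_eq, Set.mem_sdiff, mem_prod, mem_closedBall,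
    dist_eq_norm, not_lt]
  exact ⟨fun h => ⟨h.2, h.1.1.2, h.1.2⟩, fun h => ⟨⟨⟨hS h.1, h.2.1⟩, h.2.2⟩, h.1⟩⟩

theorem pieceM₂_eq {f : MvPolynomial (Fin 2) ℂ} {g : ℂ × ℂ → ℝ} {ε : ℝ} {D Dy : Set ℂ} {N : ℕ}
    {p : Fin N → ℂ} {r : Fin N → ℝ} {γ : Fin (N + 1) → ℝ → ℂ} {δ : ℝ} {i : Fin N} {r' : ℝ} :
    pieceM₂ D Dy (curveNbhd f g ε) p r γ δ i r' = preim D Dy (curveNbhd f g ε)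
      (D \ graphNbhd p r γ δ ∪
        (regionA (p i) (r i) r' (arc (γ i.succ)) δ ∪ closedBall (p i) r')) := by
  ext z
  simp only [pieceM₂, pieceM₁, preim, mem_union, mem_ofPred_eq]
  tauto

end Total

/-- Over a thin neighbourhood of the graph, the piece near a special value can be absorbed. -/
theorem exists_diffeomorphicUpToCorners_pieces
    (f : MvPolynomial (Fin 2) ℂ) (hgen : IsGenericProjection f)
    {N : ℕ} (p q : Fin N → ℂ)
    (hX : range p = specialValues f)
    (hq : ∀ i, IsSpecialPoint f (p i) (q i))
    (r : Fin N → ℝ) (c : ℂ) (R : ℝ) (p₀ : ℂ) (γ : Fin (N + 1) → ℝ → ℂ)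
    (hΓ : IsArcSystem p r c R p₀ γ)
    (b : ℂ) (T : ℝ)
    (hDy : ∀ x ∈ closedBall c R, ∀ y, value f x y = 0 → y ∈ ball b T)
    (g : ℂ × ℂ → ℝ) (hg : ContDiff ℝ ∞ g) (hg_pos : ∀ z, 0 < g z) :
    ∃ δ₀ > (0 : ℝ), ∃ ε₀ > (0 : ℝ), ∀ δ ∈ Ioo 0 δ₀, ∀ ε ∈ Ioo 0 ε₀,
      ∀ (i : Fin N) (r' : ℝ), 0 < r' → r' < r i →
        IsModelDisc f g ε (closedBall b T)
          (f.totalDegree - ((fibrePoly f (p i)).rootMultiplicity (q i) - 1))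
          (closedBall (p i) r') →
        DiffeomorphicUpToCorners
          (pieceM₂ (closedBall c R) (closedBall b T)
            (curveNbhd f g ε) p r γ δ i r')
          (pieceM₁ (closedBall c R) (closedBall b T)
            (curveNbhd f g ε) p r γ δ) := by
  obtain ⟨ε₀, hε₀, hlevel⟩ := exists_level_bound hgen hX hΓ.radius_pos (isCompact_closedBall c R)
    hDy hg hg_pos
  obtain ⟨δ₀, hδ₀, hbase⟩ := mem_nhdsGT_iff_exists_Ioo_subset.1 hΓ.eventually_base_model
  refine ⟨δ₀, hδ₀, ε₀, hε₀, fun δ hδ ε hε i r' hr' hrr hmodel => ?_⟩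
  obtain ⟨HB, hHc, hBH, hclosed, hvec⟩ := hbase hδ i r' hr' hrr
  set S := closedBall c R \ graphNbhd p r γ δ ∪
    (regionA (p i) (r i) r' (arc (γ i.succ)) δ ∪ closedBall (p i) r') with hS
  have hdisc : closedBall (p i) (r i) ⊆ closedBall c R :=
    (hΓ.discs_subset i).trans ball_subset_closedBall
  have hSin : regionA (p i) (r i) r' (arc (γ i.succ)) δ ∪ closedBall (p i) r'
      ⊆ closedBall (p i) (r i) :=
    union_subset (regionA_subset_closedBall _ _ _ _ _) (closedBall_subset_closedBall hrr.le)
  have hSD : S ⊆ closedBall c R := union_subset sdiff_subset (hSin.trans hdisc)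
  have hT : 0 < T := pos_of_mem_ball
    (hDy (p i) (hdisc (mem_closedBall_self (hΓ.radius_pos i).le)) (q i) (hq i).1)
  have htube := continuous_tubeFun (f := f) hg
  let F : ℂ × ℂ → ℝ := fun z => min ((-1) * ‖z.2 - b‖ ^ 2 + T ^ 2) (tubeFun f g z - ε)
  have hF1 : Continuous fun z : ℂ × ℂ => (-1) * ‖z.2 - b‖ ^ 2 + T ^ 2 := by fun_prop
  have hF2 : Continuous fun z => tubeFun f g z - ε := htube.sub continuous_const
  have hFc : Continuous F := hF1.min hF2
  have hF : ∀ z : ℂ × ℂ, 0 ≤ F z ↔ ‖z.2 - b‖ ≤ T ∧ ε ≤ tubeFun f g z := by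
    intro z
    rw [le_min_iff, sub_nonneg, ← pow_le_pow_iff_left₀ (norm_nonneg _) hT.le two_ne_zero]
    exact and_congr_left fun _ => ⟨fun h => by linarith, fun h => by linarith⟩
  have hMX : ∀ z, z ∈ pieceM₂ (closedBall c R) (closedBall b T) (curveNbhd f g ε) p r γ δ i r' ↔
      z.1 ∈ S ∧ 0 ≤ F z := by
    intro z
    rw [pieceM₂_eq, mem_preim_iff hSD, hF]
  have hMY : ∀ z, z ∈ pieceM₁ (closedBall c R) (closedBall b T) (curveNbhd f g ε) p r γ δ ↔
      0 ≤ HB z.1 ∧ 0 ≤ F z := by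
    intro z
    rw [pieceM₁, mem_preim_iff sdiff_subset, hF, hBH]
  refine diffeomorphicUpToCorners_of_increasing (H := fun z => min (HB z.1) (F z)) ?_ ?_ ?_ ?_ ?_
  · refine ((isCompact_closedBall c R).prod (isCompact_closedBall b T)).of_isClosed_subset ?_ ?_
    · have : pieceM₂ (closedBall c R) (closedBall b T) (curveNbhd f g ε) p r γ δ i r'
          = Prod.fst ⁻¹' S ∩ {z | 0 ≤ F z} := Set.ext hMX
      rw [this]
      exact (hclosed.preimage continuous_fst).inter (isClosed_le continuous_const hFc)
    · intro z hz
      have hz' := (hMX z).1 hz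
      refine ⟨hSD hz'.1, ?_⟩
      rw [mem_closedBall, dist_eq_norm]
      exact ((hF z).1 hz'.2).1
  · exact fun z hz => (hMX z).2 ⟨Or.inl ((hBH _).2 ((hMY z).1 hz).1), ((hMY z).1 hz).2⟩
  · exact (hHc.comp continuous_fst).min hFc
  · ext z
    exact (hMY z).trans le_min_iff.symm
  rintro ⟨x, y⟩ hz
  obtain ⟨hxS, hFz⟩ := (hMX _).1 hz
  obtain ⟨hyT, hyε⟩ := (hF _).1 hFz
  -- Membership in the larger piece and the minimum both split into a base condition and a fibre
  -- condition, so one vector has to satisfy the two separately.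
  suffices h : ∃ w : ℂ × ℂ, PointsInto S x w.1 ∧ (HB x ≤ 0 → IncreasesAlong HB x w.1) ∧
      (F (x, y) ≤ 0 → IncreasesAlong F (x, y) w) by
    obtain ⟨w, h1, h2, h3⟩ := h
    refine ⟨w, ?_, fun hH => ?_⟩
    · have h4 : PointsInto {z | 0 ≤ F z} (x, y) w := by
        rcases hFz.lt_or_eq with h | h
        · refine pointsInto_of_mem_nhds ?_ _
          filter_upwards [hFc.continuousAt.eventually_const_lt h] with z hz using hz.le
        · exact (h3 h.ge).pointsInto 0
      exact ((PointsInto.preimage (x := (x, y)) h1).inter h4).congr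
        (Eventually.of_forall fun z => (hMX z).symm)
    · refine IncreasesAlong.min_of_active (hHc.comp continuous_fst).continuousAt hFc.continuousAt
        (fun h => ?_) fun h => ?_
      · rw [min_eq_left h] at hH
        exact IncreasesAlong.comp_fst (x := (x, y)) (h2 hH)
      · rw [min_eq_right h] at hH
        exact h3 hH
  obtain ⟨⟨u, hu1, hu2⟩, hrad⟩ := hvec x hxS
  have hxD := hSD hxS
  have hyD : y ∈ closedBall b T := by rwa [mem_closedBall, dist_eq_norm]
  obtain ⟨hcrit, hbd⟩ := hlevel ε hε x hxD y hyD
  rcases hyT.eq_or_lt with hy | hy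
  -- Over the boundary circle of the fibre disc the tube function exceeds `ε`, so only the
  -- constraint of the disc is active.
  · have h1 := hbd hy
    refine ⟨(u, -(y - b)), hu1, hu2, fun _ => ?_⟩
    refine IncreasesAlong.min_of_active hF1.continuousAt hF2.continuousAt (fun _ => ?_) fun h => ?_
    · refine IncreasesAlong.comp_snd (H := fun y => (-1) * ‖y - b‖ ^ 2 + T ^ 2) (x := (x, y))
        (increasesAlong_norm_sub_sq _ ?_)
      have hy' : ‖y - b‖ = T := hy
      rw [inner_neg_right, real_inner_self_eq_norm_sq, hy', neg_one_mul, neg_neg]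
      positivity
    · have hy' : ‖y - b‖ = T := hy
      simp only [hy'] at h
      linarith
  have hy' : ‖y - b‖ < T := hy
  have hdpos : 0 < (-1) * ‖y - b‖ ^ 2 + T ^ 2 := by
    have := pow_lt_pow_left₀ hy' (norm_nonneg _) two_ne_zero
    linarith
  rcases hyε.lt_or_eq with hlt | heq
  · exact ⟨(u, 0), hu1, hu2, fun h => absurd (lt_min hdpos (sub_pos.2 hlt)) (not_lt.2 h)⟩
  have hval : value f x y ≠ 0 := by
    intro h
    simp only [tubeFun, h, norm_zero, mul_zero] at heq
    exact hε.1.ne' heq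
  have hder := hasStrictFDerivAt_tubeFun (z := (x, y)) hg hval
  have hIncF : ∀ w : ℂ × ℂ, 0 < fderiv ℝ (tubeFun f g) (x, y) w → IncreasesAlong F (x, y) w := by
    intro w hw
    refine IncreasesAlong.min_of_active hF1.continuousAt hF2.continuousAt (fun h => ?_)
      fun _ => (hder.increasesAlong hw).sub_const ε
    have h1 : (-1) * ‖y - b‖ ^ 2 + T ^ 2 ≤ tubeFun f g (x, y) - ε := h
    linarith
  by_cases hfib : fderiv ℝ (fun w => g (x, w) * ‖value f x w‖) y = 0
  swap
  -- If the level is regular along the vertical line, the fibre component can be scaled so that the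
  -- derivative along the completed vector is exactly 1, whatever the base vector does.
  · obtain ⟨v, hv⟩ := DFunLike.ne_iff.1 hfib
    rw [fderiv_fibre_tubeFun hg hval] at hv
    replace hv : fderiv ℝ (tubeFun f g) (x, y) (0, v) ≠ 0 := hv
    set d := fderiv ℝ (tubeFun f g) (x, y) with hd
    refine ⟨(u, ((1 - d (u, 0)) / d (0, v)) • v), hu1, hu2, fun _ => hIncF _ ?_⟩
    have h1 : (u, ((1 - d (u, 0)) / d (0, v)) • v)
        = (u, (0 : ℂ)) + ((1 - d (u, 0)) / d (0, v)) • ((0 : ℂ), v) := by simp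
    rw [h1, map_add, map_smul, smul_eq_mul, div_mul_cancel₀ _ hv]
    norm_num
  -- The critical point lies over one of the open discs, hence not over the complement of the graph
  -- neighbourhood; so it lies over the disc `i`, and by the assumption on the fibres over the small
  -- disc, outside that small disc.
  obtain ⟨j, hj1, hj2⟩ := hcrit heq.symm hfib
  have hxnB : x ∉ closedBall c R \ graphNbhd p r γ δ := fun h =>
    absurd hj1 (not_lt.2 ((mem_base_iff.1 h).2.2 j))
  have hxAV := hxS.resolve_left hxnB
  have hji : j = i := by
    by_contra hne
    refine disjoint_left.1 (hΓ.discs_disjoint j i hne) ?_ (hSin hxAV)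
    rw [mem_closedBall, dist_eq_norm]
    exact hj1.le
  subst hji
  have hxV : r' < ‖x - p j‖ := by
    by_contra hcon
    refine (hmodel x ?_).2 y hyD heq.symm hfib
    rw [mem_closedBall, dist_eq_norm]
    exact not_lt.1 hcon
  have hpos := hj2 fun h => by
    rw [h, sub_self, norm_zero] at hxV
    exact absurd hr' (not_lt.2 hxV.le)
  -- Increase of the tube function is an open condition on the base vector, so it survives the
  -- passage from the radial vector to the nearby one that points strictly into the base.
  have hev : ∀ᶠ u in 𝓝 (x - p j), 0 < fderiv ℝ (tubeFun f g) (x, y) (u, 0) :=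
    (by fun_prop : Continuous fun u : ℂ => fderiv ℝ (tubeFun f g) (x, y) (u, 0)).continuousAt.eventually_const_lt
      hpos
  obtain ⟨η, hη, hη2⟩ := Metric.eventually_nhds_iff.1 hev
  obtain ⟨u', hu'1, hu'2, hu'3⟩ := hrad hxV hj1 η hη
  exact ⟨(u', 0), hu'2, fun _ => hu'3, fun _ => hIncF _ (hη2 (by rwa [dist_eq_norm]))⟩

end PlaneCurve

theorem mainTheorem4
    (f : MvPolynomial (Fin 2) ℂ) (hf : Squarefree f) (hgen : PlaneCurve.IsGenericProjection f)
    {N : ℕ} (p q : Fin N → ℂ) (hp : Function.Injective p)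
    (hX : Set.range p = PlaneCurve.specialValues f)
    (hq : ∀ i, PlaneCurve.IsSpecialPoint f (p i) (q i))
    (r : Fin N → ℝ) (c : ℂ) (R : ℝ) (p₀ : ℂ) (γ : Fin (N + 1) → ℝ → ℂ)
    (hΓ : PlaneCurve.IsArcSystem p r c R p₀ γ)
    (b : ℂ) (T : ℝ)
    (hDy : ∀ x ∈ Metric.closedBall c R, ∀ y, PlaneCurve.value f x y = 0 → y ∈ Metric.ball b T)
    (g : ℂ × ℂ → ℝ) (hg : ContDiff ℝ ∞ g) (hg_pos : ∀ z, 0 < g z) :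
    ∃ δ₀ > (0 : ℝ), ∃ ε₀ > (0 : ℝ), ∀ δ ∈ Set.Ioo 0 δ₀, ∀ ε ∈ Set.Ioo 0 ε₀,
      ∀ (i : Fin N) (r' : ℝ), 0 < r' → r' < r i →
        PlaneCurve.IsModelDisc f g ε (Metric.closedBall b T)
          (f.totalDegree - ((PlaneCurve.fibrePoly f (p i)).rootMultiplicity (q i) - 1))
          (Metric.closedBall (p i) r') →
        PlaneCurve.DiffeomorphicUpToCorners
          (PlaneCurve.pieceM₂ (Metric.closedBall c R) (Metric.closedBall b T)
            (PlaneCurve.curveNbhd f g ε) p r γ δ i r')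
          (PlaneCurve.pieceM₁ (Metric.closedBall c R) (Metric.closedBall b T)
            (PlaneCurve.curveNbhd f g ε) p r γ δ) :=
  PlaneCurve.exists_diffeomorphicUpToCorners_pieces f hgen p q hX hq r c R p₀ γ hΓ b T hDy g hg hg_pos
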